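/- **Conventions.** Let $M$ and $N$ be smooth Riemannian manifolds (without boundary, not necessarily complete or connected; points in different components have infinite distance) of dimensions $m$ and $n$, let $B_r(x)$ denote open metric balls, and let $F: M\to N$ be a locally Lipschitz map. If two points $x,y$ of $M$ (or of $N$) are joined by a unique minimal geodesic segment $[0,1]\to M$ (resp. $N$) from $x$ to $y$, let $\tau^x_y: T_xM\to T_yM$ (resp. $T_xN\to T_yN$) be the parallel translation along it. For $p\in M$ let $K_F(p)$ be the set of all linear maps $G: T_pM\to T_{F(p)}N$ for which there is a sequence $x_i\to p$ of points of differentiability of $F$ with $\tau^{F(x_i)}_{F(p)}\circ dF_{x_i}\circ\tau^p_{x_i}\to G$ (for large $i$ both parallel translations are defined). The generalized differential of $F$ at $p$ is the convex hull $\partial F(p):=\mathrm{Conv}(K_F(p))$. The point $p$ is called nonsingular for $F$ (in the sense of Clarke) if $\operatorname{rank} g=\min\{m,n\}$ for every $g\in\partial F(p)$. **Proposition.** Assume $m\le n$, let $p\in M$ be nonsingular for $F$, and let $t>0$. Then there are constants $\lambda>0$ and $\delta>0$ such that the following hold. (i) $B_{2\lambda}(p)$ is strongly convex, i.e. for any two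 points $q,q'$ of its closure (where $q=q'$ is allowed only if $q\in B_{2\lambda}(p)$) there is a unique geodesic segment $\gamma:[0,1]\to M$ with $\gamma(0)=q$, $\gamma(1)=q'$ and $\gamma((0,1))\subset B_{2\lambda}(p)$; and $\exp_p$ is defined on $\{v\in T_pM : \|v\|<2\lambda\}$ and maps it diffeomorphically onto $B_{2\lambda}(p)$. (ii) $F$ is Lipschitz on $B_{2\lambda}(p)$ and $F(B_{2\lambda}(p))\subset B_t(F(p))$. (iii) For every $u\in T_pM$ with $\|u\|=1$ and every $x\in B_{2\lambda}(p)$ there is $V\in T_{F(x)}N$ with $\|V\|=1$ such that $\langle g(\tau^p_x u),V\rangle\ge\delta$ for all $g\in\partial F(x)$. (iv) Every $x\in B_{2\lambda}(p)$ is nonsingular for $F$. -/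

import Mathlib

open Set Filter Topology Bundle
open scoped Manifold ContDiff ENNReal NNReal

noncomputable section

/- Keeps vector spaces, as manifolds, on their standard charted space `chartedSpaceSelf`. -/
attribute [-instance] TopCat.of.chartedSpace

namespace ClarkeLip

variable {m : ℕ} {M : Type*} [EMetricSpace M] [ChartedSpace (EuclideanSpace ℝ (Fin m)) M]
  [RiemannianBundle (fun x : M => TangentSpace (𝓡 m) x)]

/-- The Riemannian metric read in the chart at `p₀`: the bilinear form `g_y(v, w)` in the
coordinates of that chart. -/
def chartMetric (p₀ : M) (y v w : EuclideanSpace ℝ (Fin m)) : ℝ :=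
  inner ℝ
    (mfderiv 𝓘(ℝ, EuclideanSpace ℝ (Fin m)) (𝓡 m) (extChartAt (𝓡 m) p₀).symm y v)
    (mfderiv 𝓘(ℝ, EuclideanSpace ℝ (Fin m)) (𝓡 m) (extChartAt (𝓡 m) p₀).symm y w)

/-- The Christoffel symbols of the first kind of the Levi-Civita connection in the chart at `p₀`,
as a trilinear form: `½ (∂_u g(v, z) + ∂_v g(u, z) - ∂_z g(u, v))`. -/
def christoffelFirst (p₀ : M) (y u v z : EuclideanSpace ℝ (Fin m)) : ℝ :=
  (fderiv ℝ (fun y' => chartMetric p₀ y' v z) y u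
    + fderiv ℝ (fun y' => chartMetric p₀ y' u z) y v
    - fderiv ℝ (fun y' => chartMetric p₀ y' u v) y z) / 2

/-- The foot point of a vector, in the chart at `p₀`. -/
def chartPoint (p₀ : M) (X : TangentBundle (𝓡 m) M) : EuclideanSpace ℝ (Fin m) :=
  extChartAt (𝓡 m) p₀ X.proj

/-- The coordinates of a tangent vector in the chart at `p₀`. -/
def chartVector (p₀ : M) (X : TangentBundle (𝓡 m) M) : EuclideanSpace ℝ (Fin m) :=
  mfderiv (𝓡 m) 𝓘(ℝ, EuclideanSpace ℝ (Fin m)) (extChartAt (𝓡 m) p₀) X.proj X.snd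

/-- A vector field along a curve, given as a curve `X` in the tangent bundle, is parallel on
`[0, 1]` for the Levi-Civita connection: in every chart the coordinates `V` of the field and `c` of
the base curve satisfy `V' + Γ(c', V) = 0`, written with the lower index as
`g_c(V', z) + Γ(c', V; z) = 0` for all `z`. -/
def IsParallel (X : ℝ → TangentBundle (𝓡 m) M) : Prop :=
  ∀ p₀ : M, ∀ t ∈ Icc (0 : ℝ) 1, (X t).proj ∈ (extChartAt (𝓡 m) p₀).source →
    DifferentiableWithinAt ℝ (fun s => chartVector p₀ (X s)) (Icc 0 1) t ∧
    ∀ z : EuclideanSpace ℝ (Fin m),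
      chartMetric p₀ (chartPoint p₀ (X t))
          (derivWithin (fun s => chartVector p₀ (X s)) (Icc 0 1) t) z
        + christoffelFirst p₀ (chartPoint p₀ (X t))
          (derivWithin (fun s => chartPoint p₀ (X s)) (Icc 0 1) t)
          (chartVector p₀ (X t)) z = 0

/-- The velocity of a curve defined on `[0, 1]`, as a curve in the tangent bundle. -/
def velocity (γ : ℝ → M) (t : ℝ) : TangentBundle (𝓡 m) M :=
  ⟨γ t, mfderivWithin 𝓘(ℝ, ℝ) (𝓡 m) γ (Icc 0 1) t (1 : ℝ)⟩

variable (m) in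
/-- A geodesic segment `γ : [0, 1] → M`: a smooth curve with parallel velocity. -/
def IsGeodesic (γ : ℝ → M) : Prop :=
  ContMDiffOn 𝓘(ℝ, ℝ) (𝓡 m) ∞ γ (Icc 0 1) ∧ IsParallel (velocity (m := m) γ)

variable (m) in
/-- A minimal geodesic segment from `x` to `y`: its length is the distance. -/
def IsMinimalGeodesic (x y : M) (γ : ℝ → M) : Prop :=
  IsGeodesic m γ ∧ γ 0 = x ∧ γ 1 = y ∧ Manifold.pathELength (𝓡 m) γ 0 1 = edist x y

variable (m) in
/-- There is exactly one minimal geodesic segment `[0, 1] → M` from `x` to `y`. -/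
def HasUniqueMinimalGeodesic (x y : M) : Prop :=
  ∃ γ : ℝ → M, IsMinimalGeodesic m x y γ ∧
    ∀ γ' : ℝ → M, IsMinimalGeodesic m x y γ' → EqOn γ' γ (Icc 0 1)

/-- `L` is the parallel translation along a minimal geodesic segment from `x` to `y`: every `u` is
carried to `L u` by a parallel field along such a segment. -/
def IsParallelTranslation (x y : M)
    (L : TangentSpace (𝓡 m) x →L[ℝ] TangentSpace (𝓡 m) y) : Prop :=
  ∀ u : TangentSpace (𝓡 m) x, ∃ X : ℝ → TangentBundle (𝓡 m) M,
    IsParallel X ∧ IsMinimalGeodesic m x y (fun t => (X t).proj) ∧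
      X 0 = ⟨x, u⟩ ∧ X 1 = ⟨y, L u⟩

open Classical in
variable (m) in
/-- The parallel translation `T_x M → T_y M` along the unique minimal geodesic segment from `x` to
`y` (and `0` if there is no unique one). -/
def parallelTranslation (x y : M) : TangentSpace (𝓡 m) x →L[ℝ] TangentSpace (𝓡 m) y :=
  if h : HasUniqueMinimalGeodesic m x y ∧
      ∃ L : TangentSpace (𝓡 m) x →L[ℝ] TangentSpace (𝓡 m) y, IsParallelTranslation x y L
  then h.2.choose else 0

/-- `y` is the end point of a geodesic segment on `[0, 1]` that starts at `x` with velocity `v`. -/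
def IsExp (x : M) (v : TangentSpace (𝓡 m) x) (y : M) : Prop :=
  ∃ γ : ℝ → M, IsGeodesic m γ ∧ velocity (m := m) γ 0 = ⟨x, v⟩ ∧ γ 1 = y

variable (m) in
/-- The ball `B_α(x)` is strongly convex: any two points `p`, `q` of its closure are joined by
exactly one geodesic segment `[0, 1] → M` that maps `(0, 1)` into the ball. The only pairs left out
are `p = q` on the boundary, whose constant segment never enters the ball. -/
def IsStronglyConvexBall (x : M) (α : ℝ) : Prop :=
  ∀ p ∈ closure (Metric.eball x (ENNReal.ofReal α)),
  ∀ q ∈ closure (Metric.eball x (ENNReal.ofReal α)),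
    (p = q → p ∈ Metric.eball x (ENNReal.ofReal α)) →
    ∃ γ : ℝ → M,
      (IsGeodesic m γ ∧ γ 0 = p ∧ γ 1 = q ∧
        MapsTo γ (Ioo 0 1) (Metric.eball x (ENNReal.ofReal α))) ∧
      ∀ γ' : ℝ → M,
        (IsGeodesic m γ' ∧ γ' 0 = p ∧ γ' 1 = q ∧
          MapsTo γ' (Ioo 0 1) (Metric.eball x (ENNReal.ofReal α))) →
        EqOn γ' γ (Icc 0 1)

variable (m) in
/-- The exponential map at `x` is defined on the open ball of radius `α` of `T_x M` and is a
diffeomorphism of it onto `B_α(x)`. -/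
def IsExpDiffeoBall (x : M) (α : ℝ) : Prop :=
  ∃ Φ : PartialDiffeomorph 𝓘(ℝ, TangentSpace (𝓡 m) x) (𝓡 m) (TangentSpace (𝓡 m) x) M ∞,
    Φ.source = Metric.ball 0 α ∧ Φ.target = Metric.eball x (ENNReal.ofReal α) ∧
    ∀ v ∈ Metric.ball (0 : TangentSpace (𝓡 m) x) α, ∀ y : M, IsExp x v y ↔ y = Φ v

variable {n : ℕ} {N : Type*} [EMetricSpace N] [ChartedSpace (EuclideanSpace ℝ (Fin n)) N]
  [RiemannianBundle (fun x : N => TangentSpace (𝓡 n) x)]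

variable (m n) in
/-- The mixture `K_F(p)` of the differential of `F` at `p`: the limits of
`τ_{F(p)}^{F(x_i)} ∘ dF_{x_i} ∘ τ_{x_i}^p` for sequences `x_i → p` of points of differentiability
of `F`. Only the tail of the sequence matters, and there both parallel translations exist. -/
def mixture (F : M → N) (p : M) :
    Set (TangentSpace (𝓡 m) p →L[ℝ] TangentSpace (𝓡 n) (F p)) :=
  {G | ∃ x : ℕ → M, (∀ i, MDifferentiableAt (𝓡 m) (𝓡 n) F (x i)) ∧
    Tendsto x atTop (𝓝 p) ∧
    Tendsto (fun i => (parallelTranslation n (F (x i)) (F p)).comp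
      ((mfderiv (𝓡 m) (𝓡 n) F (x i)).comp (parallelTranslation m p (x i)))) atTop (𝓝 G)}

variable (m n) in
/-- The generalized differential `∂F(p)`: the convex hull of the mixture. -/
def generalizedDifferential (F : M → N) (p : M) :
    Set (TangentSpace (𝓡 m) p →L[ℝ] TangentSpace (𝓡 n) (F p)) :=
  convexHull ℝ (mixture m n F p)

variable (m n) in
/-- `p` is nonsingular for `F` in the sense of Clarke: every element of `∂F(p)` has maximal
rank. -/
def IsNonsingular (F : M → N) (p : M) : Prop :=
  ∀ g ∈ generalizedDifferential m n F p,
    Module.finrank ℝ (LinearMap.range g.toLinearMap) = min m n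

end ClarkeLip

end

/-! Assertion (iii) is upper semicontinuity of `∂F` combined with a separation argument; the rest is
local Riemannian geometry, developed here from the geodesic equation.

Read `F` in the charts at `p` and `F p`. Near the centre, parallel translation is the propagator of
`V' = -Γ(c', V)` along a short geodesic, so in coordinates it is as close to the identity as desired
(`exists_nhds_parallelTranslation`). The transported differentials defining `∂F(x)` are therefore
close to the coordinate differentials of `F`, which are bounded because `F` is locally Lipschitz.
Let `C` be the convex hull of the cluster values at `p` of the coordinate differentials. It is
compact, its elements represent elements of `∂F(p)`, and for `x` near `p` every element of `∂F(x)`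
is, in coordinates, within `ε` of `C` (`exists_compact_convex_generalizedDifferential`).

Since `m ≤ n` and `p` is nonsingular, every `a ∈ C` is injective. For `u ≠ 0` the compact convex set
`{a u : a ∈ C}` misses `0`, and its point nearest to `0` spans a direction `e` with `⟨e, a u⟩ ≥ d
‖u‖` on all of `C`, where `d` is uniform by compactness (`exists_uniform_separation`). The
`ε`-errors use at most half of this margin, and the Riesz representative of `⟨e, ·⟩` is rescaled to
`V` (`IsNonsingular.exists_uniform_direction`). Assertion (iv) follows: a kernel vector would have
pairing `0` with its `V`.

For (i), exponential maps come from the inverse function theorem on a space of accelerations. The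
Gauss lemma shows that radial geodesics realise distances (`IsNormalBall.edist_eq`). Squared
distance from `p` is strictly convex along nearby geodesics, since its Hessian at `p` is twice the
metric; this gives strong convexity (`IsNormalBall.isStronglyConvexBall`). Continuity gives (ii),
and one sufficiently small ball serves all four assertions. -/

noncomputable section

set_option maxSynthPendingDepth 3
set_option linter.unusedSectionVars false

attribute [-instance] TopCat.of.chartedSpace

namespace ClarkeLip

/-! ### Superposition operators on spaces of continuous maps. -/

section Superposition

variable {K : Type*} [TopologicalSpace K] [CompactSpace K]

section

variable {E F : Type*} [NormedAddCommGroup E] [NormedSpace ℝ E]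
  [NormedAddCommGroup F] [NormedSpace ℝ F]

/-- Pointwise evaluation of a continuous family of linear maps on a continuous family of
vectors. -/
def pointwiseEval (A : C(K, E →L[ℝ] F)) (h : C(K, E)) : C(K, F) :=
  ⟨fun k => A k (h k), A.continuous.clm_apply h.continuous⟩

theorem norm_pointwiseEval_le (A : C(K, E →L[ℝ] F)) (h : C(K, E)) :
    ‖pointwiseEval A h‖ ≤ ‖A‖ * ‖h‖ :=
  (ContinuousMap.norm_le _ (mul_nonneg (norm_nonneg _) (norm_nonneg _))).2 fun k =>
    ((A k).le_opNorm _).trans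
      (mul_le_mul (A.norm_coe_le_norm k) (h.norm_coe_le_norm k) (norm_nonneg _) (norm_nonneg _))

/-- `pointwiseEval` as a linear map in the vector argument. -/
def pointwiseEvalCLM (A : C(K, E →L[ℝ] F)) : C(K, E) →L[ℝ] C(K, F) :=
  LinearMap.mkContinuous
    { toFun := pointwiseEval A
      map_add' := fun _ _ => ContinuousMap.ext fun k => map_add (A k) _ _
      map_smul' := fun _ _ => ContinuousMap.ext fun k => map_smul (A k) _ _ } ‖A‖
    (norm_pointwiseEval_le A)

variable (K E F) in
/-- `pointwiseEval` as a bounded bilinear operation. -/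
def pointwiseApply : C(K, E →L[ℝ] F) →L[ℝ] C(K, E) →L[ℝ] C(K, F) :=
  LinearMap.mkContinuous
    { toFun := pointwiseEvalCLM
      map_add' := fun _ _ => ContinuousLinearMap.ext fun h => ContinuousMap.ext fun k => rfl
      map_smul' := fun _ _ => ContinuousLinearMap.ext fun h => ContinuousMap.ext fun k => rfl } 1
    (fun A => by
      rw [one_mul]
      exact LinearMap.mkContinuous_norm_le _ (norm_nonneg _) (norm_pointwiseEval_le A))

@[simp] theorem pointwiseApply_apply (A : C(K, E →L[ℝ] F)) (h : C(K, E)) (k : K) :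
    pointwiseApply K E F A h k = A k (h k) := rfl

end

variable {E F : Type} [NormedAddCommGroup E] [NormedSpace ℝ E]
  [NormedAddCommGroup F] [NormedSpace ℝ F]

/-- The superposition operator `c ↦ f ∘ c` on spaces of continuous maps. -/
def superposition (K : Type*) [TopologicalSpace K] (f : E → F) (hf : Continuous f)
    (c : C(K, E)) : C(K, F) :=
  (⟨f, hf⟩ : C(E, F)).comp c

/-- The mean value inequality on each segment from `c k` to `c k + u k` bounds the remainder by the
oscillation of `fderiv ℝ f`. This is uniform in `k` because `c ↦ fderiv ℝ f ∘ c` is continuous for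
the sup norm. -/
theorem hasFDerivAt_superposition {f : E → F} (hf : ContDiff ℝ 1 f) (c : C(K, E)) :
    HasFDerivAt (superposition K f hf.continuous)
      (pointwiseApply K E F
        (superposition K (fderiv ℝ f) (hf.continuous_fderiv one_ne_zero) c)) c := by
  set D := superposition K (fderiv ℝ f) (hf.continuous_fderiv one_ne_zero) with hD
  have hDc : Continuous D := ContinuousMap.continuous_postcomp _
  rw [hasFDerivAt_iff_isLittleO_nhds_zero, Asymptotics.isLittleO_iff]
  intro ε hε
  obtain ⟨δ, hδ, h⟩ := Metric.continuousAt_iff.1 (hDc.continuousAt (x := c)) ε hε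
  filter_upwards [Metric.ball_mem_nhds (0 : C(K, E)) hδ] with u hu
  rw [mem_ball_zero_iff] at hu
  refine (ContinuousMap.norm_le _ (by positivity)).2 fun k => ?_
  have := (convex_Icc (0 : ℝ) 1).norm_image_sub_le_of_norm_hasDerivWithin_le
    (f := fun s : ℝ => f (c k + s • u k) - s • fderiv ℝ f (c k) (u k))
    (f' := fun s => fderiv ℝ f (c k + s • u k) (u k) - fderiv ℝ f (c k) (u k))
    (C := ε * ‖u‖) (x := 0) (y := 1) (fun s _ => ?_) (fun s hs => ?_) (by simp) (by simp)
  · simp only [one_smul, zero_smul, add_zero, sub_zero, norm_one, mul_one] at this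
    have e : (superposition K f hf.continuous (c + u) - superposition K f hf.continuous c
        - pointwiseApply K E F (D c) u) k
        = f (c k + u k) - fderiv ℝ f (c k) (u k) - f (c k) := by
      simp [superposition, hD]; abel
    rw [e]; exact this
  · have h1 : HasDerivAt (fun s : ℝ => c k + s • u k) (u k) s := by
      simpa using ((hasDerivAt_id s).smul_const (u k)).const_add (c k)
    have h2 := ((hf.differentiable one_ne_zero) (c k + s • u k)).hasFDerivAt.comp_hasDerivAt s h1
    have h3 : HasDerivAt (fun s : ℝ => s • fderiv ℝ f (c k) (u k)) (fderiv ℝ f (c k) (u k)) s := by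
      simpa using (hasDerivAt_id s).smul_const (fderiv ℝ f (c k) (u k))
    exact (h2.sub h3).hasDerivWithinAt
  · rw [← sub_apply]
    refine (ContinuousLinearMap.le_opNorm _ _).trans ?_
    refine mul_le_mul ?_ (u.norm_coe_le_norm k) (norm_nonneg _) hε.le
    have hb : dist (D (c + s • u)) (D c) < ε := by
      apply h
      rw [dist_eq_norm, add_sub_cancel_left, norm_smul, Real.norm_eq_abs, abs_of_nonneg hs.1]
      exact (mul_le_of_le_one_left (norm_nonneg _) hs.2).trans_lt hu
    rw [dist_eq_norm] at hb
    exact ((D (c + s • u) - D c).norm_coe_le_norm k).trans hb.le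

/-- The derivative is a bounded linear operation applied to the superposition operator of `fderiv ℝ
f`, so induction applies. The target `F` must vary in the induction, as `fderiv ℝ f` takes values in
`E →L[ℝ] F`. -/
theorem contDiff_superposition_nat (n : ℕ) : ∀ {F : Type} [NormedAddCommGroup F]
    [NormedSpace ℝ F] {f : E → F} (hf : ContDiff ℝ n f),
    ContDiff ℝ n (superposition K f hf.continuous) := by
  induction n with
  | zero =>
    intro F _ _ f hf
    exact contDiff_zero.2 (ContinuousMap.continuous_postcomp _)
  | succ n ih =>
    intro F _ _ f hf
    have hf1 : ContDiff ℝ 1 f := hf.of_le (by norm_cast; omega)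
    have hf' : ContDiff ℝ n (fderiv ℝ f) := hf.fderiv_right (by norm_cast)
    push_cast
    rw [contDiff_succ_iff_hasFDerivAt]
    exact ⟨_, (pointwiseApply K E F).contDiff.comp (ih hf'),
      fun c => hasFDerivAt_superposition hf1 c⟩

/-- The superposition operator of a smooth map is smooth. -/
theorem contDiff_superposition {f : E → F} (hf : ContDiff ℝ ∞ f) :
    ContDiff ℝ ∞ (superposition K f hf.continuous) :=
  contDiff_infty.2 fun n => contDiff_superposition_nat n (hf.of_le (by exact_mod_cast le_top))

end Superposition

/-! ### A smooth inverse function theorem. -/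

section InverseFunction

variable {E F : Type*} [NormedAddCommGroup E] [NormedSpace ℝ E] [CompleteSpace E]
  [NormedAddCommGroup F] [NormedSpace ℝ F]

/-- Smooth inverse function theorem, with a smooth inverse on a whole neighbourhood. -/
theorem exists_openPartialHomeomorph_contDiffOn {f : E → F} {U : Set E} (hU : IsOpen U)
    (hf : ContDiffOn ℝ ∞ f U) {a : E} (ha : a ∈ U) (L : E ≃L[ℝ] F)
    (hL : HasFDerivAt f (L : E →L[ℝ] F) a) :
    ∃ Φ : OpenPartialHomeomorph E F, a ∈ Φ.source ∧ Φ.source ⊆ U ∧ EqOn Φ f Φ.source ∧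
      ContDiffOn ℝ ∞ Φ.symm Φ.target := by
  have hfa : ContDiffAt ℝ ∞ f a := hf.contDiffAt (hU.mem_nhds ha)
  set Φ₀ := hfa.toOpenPartialHomeomorph f hL (by simp) with hΦ₀
  have hc : ContinuousOn (fderiv ℝ f) U :=
    (hf.continuousOn_fderiv_of_isOpen hU (by simp))
  -- Smoothness of the inverse is needed at every point of the target, so the source is cut down to
  -- the open set where the derivative is invertible.
  set W : Set E := U ∩ fderiv ℝ f ⁻¹' (range ((↑) : (E ≃L[ℝ] F) → E →L[ℝ] F)) with hW
  have hWo : IsOpen W := hc.isOpen_inter_preimage hU (ContinuousLinearEquiv.isOpen)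
  have haW : a ∈ W := ⟨ha, ⟨L, hL.fderiv.symm⟩⟩
  refine ⟨Φ₀.restrOpen W hWo, ?_, ?_, ?_, ?_⟩
  · exact ⟨hfa.mem_toOpenPartialHomeomorph_source hL (by simp), haW⟩
  · exact fun x hx => hx.2.1
  · intro x hx
    rfl
  · intro y hy
    obtain ⟨L', hL'⟩ := ((Φ₀.restrOpen W hWo).map_target hy).2.2
    have hU' := ((Φ₀.restrOpen W hWo).map_target hy).2.1
    have hd : ContDiffAt ℝ ∞ f ((Φ₀.restrOpen W hWo).symm y) := hf.contDiffAt (hU.mem_nhds hU')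
    refine ((Φ₀.restrOpen W hWo).contDiffAt_symm (f₀' := L') hy ?_ hd).contDiffWithinAt
    have := (hd.differentiableAt (by simp)).hasFDerivAt
    rw [← hL'] at this
    exact this

end InverseFunction

/-! ### Iterated primitives and time rescaling. -/

section Primitive

variable {E : Type} [NormedAddCommGroup E] [NormedSpace ℝ E]

/-- The primitive vanishing at `0` of a continuous function on `[0, 1]`, extended constantly. -/
def primFun (a : C(unitInterval, E)) (t : ℝ) : E :=
  ∫ s in (0 : ℝ)..t, a (projIcc 0 1 zero_le_one s)

theorem continuous_extend {E : Type} [NormedAddCommGroup E] (a : C(unitInterval, E)) :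
    Continuous fun s : ℝ => a (projIcc 0 1 zero_le_one s) :=
  a.continuous.comp continuous_projIcc

theorem hasDerivAt_primFun [CompleteSpace E] (a : C(unitInterval, E)) (t : ℝ) :
    HasDerivAt (primFun a) (a (projIcc 0 1 zero_le_one t)) t :=
  intervalIntegral.integral_hasDerivAt_right ((continuous_extend a).intervalIntegrable _ _)
    ((continuous_extend a).stronglyMeasurableAtFilter _ _) (continuous_extend a).continuousAt

@[simp] theorem primFun_zero (a : C(unitInterval, E)) : primFun a 0 = 0 := by simp [primFun]

theorem norm_primFun_le (a : C(unitInterval, E)) {t : ℝ} (ht : t ∈ Icc (0 : ℝ) 1) :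
    ‖primFun a t‖ ≤ ‖a‖ := by
  refine (intervalIntegral.norm_integral_le_of_norm_le_const (C := ‖a‖)
    fun s _ => a.norm_coe_le_norm _).trans ?_
  rw [sub_zero, abs_of_nonneg ht.1]
  exact mul_le_of_le_one_right (norm_nonneg _) ht.2

/-- `primFun` as a bounded operator on `C([0, 1], E)`. -/
def primitive [CompleteSpace E] : C(unitInterval, E) →L[ℝ] C(unitInterval, E) :=
  LinearMap.mkContinuous
    { toFun := fun a => ⟨fun t => primFun a t,
        (continuous_iff_continuousAt.2 fun t => (hasDerivAt_primFun a t).continuousAt).comp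
          continuous_subtype_val⟩
      map_add' := fun a b => ContinuousMap.ext fun t =>
        intervalIntegral.integral_add ((continuous_extend a).intervalIntegrable _ _)
          ((continuous_extend b).intervalIntegrable _ _)
      map_smul' := fun r a => ContinuousMap.ext fun t => intervalIntegral.integral_smul _ _ } 1
    (fun a => by
      rw [one_mul]
      exact (ContinuousMap.norm_le _ (norm_nonneg _)).2 fun t => norm_primFun_le a t.2)

@[simp] theorem primitive_apply [CompleteSpace E] (a : C(unitInterval, E)) (t : unitInterval) :
    primitive a t = primFun a t := rfl

/-- The function `t ↦ s² a(s t)`. -/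
def rescale (s : unitInterval) (a : C(unitInterval, E)) : C(unitInterval, E) :=
  ⟨fun t => (s : ℝ) ^ 2 • a (s * t), by fun_prop⟩

theorem norm_rescale_le (s : unitInterval) (a : C(unitInterval, E)) : ‖rescale s a‖ ≤ ‖a‖ := by
  refine (ContinuousMap.norm_le _ (norm_nonneg _)).2 fun t => ?_
  have h : (s : ℝ) ^ 2 ≤ 1 := pow_le_one₀ s.2.1 s.2.2
  change ‖(s : ℝ) ^ 2 • a (s * t)‖ ≤ _
  rw [norm_smul, Real.norm_eq_abs, abs_of_nonneg (by positivity)]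
  exact (mul_le_of_le_one_left (norm_nonneg _) h).trans (a.norm_coe_le_norm _)

/-- If a path has acceleration `a`, then `t ↦ c(s t)` has acceleration `rescale s a`. This identity
and the next are the corresponding substitutions for velocity and displacement. -/
theorem primFun_rescale (s : unitInterval) (a : C(unitInterval, E)) {t : ℝ}
    (ht : t ∈ Icc (0 : ℝ) 1) : primFun (rescale s a) t = (s : ℝ) • primFun a (s * t) := by
  have h := intervalIntegral.smul_integral_comp_mul_left (a := 0) (b := t)
    (fun u => a (projIcc 0 1 zero_le_one u)) (s : ℝ)
  rw [mul_zero] at h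
  rw [primFun, primFun, ← h, smul_smul, ← pow_two, ← intervalIntegral.integral_smul]
  refine intervalIntegral.integral_congr fun u hu => ?_
  rw [uIcc_of_le ht.1] at hu
  have hu' : u ∈ Icc (0 : ℝ) 1 := ⟨hu.1, hu.2.trans ht.2⟩
  have hsu : (s : ℝ) * u ∈ Icc (0 : ℝ) 1 := unitInterval.mul_mem s.2 hu'
  simp only [rescale, ContinuousMap.coe_mk, projIcc_of_mem _ hu', projIcc_of_mem _ hsu]
  rfl

theorem primFun_primitive_rescale [CompleteSpace E] (s : unitInterval) (a : C(unitInterval, E))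
    {t : ℝ} (ht : t ∈ Icc (0 : ℝ) 1) :
    primFun (primitive (rescale s a)) t = primFun (primitive a) (s * t) := by
  have h := intervalIntegral.smul_integral_comp_mul_left (a := 0) (b := t)
    (fun u => primitive a (projIcc 0 1 zero_le_one u)) (s : ℝ)
  rw [mul_zero] at h
  rw [primFun, primFun, ← h, ← intervalIntegral.integral_smul]
  refine intervalIntegral.integral_congr fun u hu => ?_
  rw [uIcc_of_le ht.1] at hu
  have hu' : u ∈ Icc (0 : ℝ) 1 := ⟨hu.1, hu.2.trans ht.2⟩
  have hsu : (s : ℝ) * u ∈ Icc (0 : ℝ) 1 := unitInterval.mul_mem s.2 hu'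
  simp only [projIcc_of_mem _ hu', projIcc_of_mem _ hsu, primitive_apply]
  rw [primFun_rescale s a hu']

end Primitive

/-! ### The exponential map of a spray. -/

section SprayExp

variable {E : Type} [NormedAddCommGroup E] [NormedSpace ℝ E]

/-- A solution `(c, w)` on `[0, 1]` of the second order equation `c'' = -Γ(c)(c', c')`. -/
def IsSpraySolution (Γ : E → E →L[ℝ] E →L[ℝ] E) (c w : ℝ → E) : Prop :=
  ∀ t ∈ Icc (0 : ℝ) 1, HasDerivWithinAt c (w t) (Icc 0 1) t ∧
    HasDerivWithinAt w (-Γ (c t) (w t) (w t)) (Icc 0 1) t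

variable {Γ : E → E →L[ℝ] E →L[ℝ] E}

theorem contDiff_spray (hΓ : ContDiff ℝ ∞ Γ) :
    ContDiff ℝ ∞ fun z : E × E => Γ z.1 z.2 z.2 :=
  ((hΓ.comp contDiff_fst).clm_apply contDiff_snd).clm_apply contDiff_snd

/-- The spray term is quadratic in the velocity, so it vanishes to first order at zero velocity. -/
theorem hasFDerivAt_spray_zero (hΓ : ContDiff ℝ ∞ Γ) (x : E) :
    HasFDerivAt (fun z : E × E => Γ z.1 z.2 z.2) (0 : E × E →L[ℝ] E) (x, 0) := by
  have h1 : HasFDerivAt (fun z : E × E => Γ z.1 z.2)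
      (fderiv ℝ (fun z : E × E => Γ z.1 z.2) (x, 0)) (x, 0) :=
    ((((hΓ.comp contDiff_fst).clm_apply contDiff_snd).differentiable (by simp)) _).hasFDerivAt
  have h2 := h1.clm_apply (hasFDerivAt_snd (𝕜 := ℝ) (E := E) (F := E) (p := (x, 0)))
  refine h2.congr_fderiv ?_
  ext <;> simp

variable [CompleteSpace E]

/-- The path and its velocity with given initial data and given acceleration. -/
def pathOfAcceleration :
    (E × E × C(unitInterval, E)) →L[ℝ] C(unitInterval, E × E) :=
  ⟨{  toFun := fun z => ⟨fun t => (z.1 + (t : ℝ) • z.2.1 + primitive (primitive z.2.2) t,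
        z.2.1 + primitive z.2.2 t), by fun_prop⟩
      map_add' := fun z z' => by
        ext t
        · simp; abel
        · simp; abel
      map_smul' := fun r z => by
        ext t
        · simp [smul_comm r (t : ℝ)]
        · simp },
    ContinuousMap.continuous_of_continuous_uncurry _ (by
      change Continuous fun q : (E × E × C(unitInterval, E)) × unitInterval =>
        (q.1.1 + (q.2 : ℝ) • q.1.2.1 + primitive (primitive q.1.2.2) q.2,
          q.1.2.1 + primitive q.1.2.2 q.2)
      fun_prop)⟩

theorem pathOfAcceleration_apply (z : E × E × C(unitInterval, E)) (t : unitInterval) :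
    pathOfAcceleration z t = (z.1 + (t : ℝ) • z.2.1 + primFun (primitive z.2.2) t,
      z.2.1 + primFun z.2.2 t) := rfl

/-- The defect of the geodesic equation. -/
def sprayDefect (hΓ : ContDiff ℝ ∞ Γ) (z : E × E × C(unitInterval, E)) : C(unitInterval, E) :=
  z.2.2 + superposition unitInterval _ (contDiff_spray hΓ).continuous (pathOfAcceleration z)

theorem contDiff_sprayDefect (hΓ : ContDiff ℝ ∞ Γ) : ContDiff ℝ ∞ (sprayDefect hΓ) :=
  (contDiff_snd.comp contDiff_snd).add
    ((contDiff_superposition (contDiff_spray hΓ)).comp (pathOfAcceleration (E := E)).contDiff)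

/-- At a constant path the nonlinear term contributes nothing to first order, which leaves the
projection onto the acceleration. -/
theorem hasFDerivAt_sprayDefect (hΓ : ContDiff ℝ ∞ Γ) (x : E) :
    HasFDerivAt (sprayDefect hΓ) ((ContinuousLinearMap.snd ℝ E C(unitInterval, E)).comp
      (ContinuousLinearMap.snd ℝ E (E × C(unitInterval, E)))) (x, 0, 0) := by
  have h1 := (hasFDerivAt_superposition (K := unitInterval)
    ((contDiff_spray hΓ).of_le (by simp)) (pathOfAcceleration (x, 0, 0))).comp (x, 0, 0)
      (pathOfAcceleration (E := E)).hasFDerivAt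
  have h2 := ((ContinuousLinearMap.snd ℝ E C(unitInterval, E)).comp
      (ContinuousLinearMap.snd ℝ E (E × C(unitInterval, E)))).hasFDerivAt (x := (x, 0, 0))
  refine (h2.add h1).congr_fderiv ?_
  rw [add_eq_left]
  refine ContinuousLinearMap.ext fun z => ContinuousMap.ext fun t => ?_
  have h0 : pathOfAcceleration (x, (0 : E), (0 : C(unitInterval, E))) t = (x, 0) := by
    rw [pathOfAcceleration_apply]; simp [primFun]
  simp only [ContinuousLinearMap.comp_apply, pointwiseApply_apply, superposition,
    ContinuousMap.comp_apply, ContinuousMap.coe_mk, h0, (hasFDerivAt_spray_zero hΓ x).fderiv]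
  rfl

theorem sprayDefect_apply (hΓ : ContDiff ℝ ∞ Γ) (x v : E) (a : C(unitInterval, E))
    (t : unitInterval) :
    sprayDefect hΓ (x, v, a) t = a t + Γ (x + (t : ℝ) • v + primFun (primitive a) t)
      (v + primFun a t) (v + primFun a t) := rfl

/-- Quadratic homogeneity of the spray: a solution run at speed `s` is again a solution, with
initial velocity `s v`. -/
theorem sprayDefect_rescale (hΓ : ContDiff ℝ ∞ Γ) {x v : E} {a : C(unitInterval, E)}
    (h : sprayDefect hΓ (x, v, a) = 0) (s : unitInterval) :
    sprayDefect hΓ (x, (s : ℝ) • v, rescale s a) = 0 := by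
  ext t
  have h1 := DFunLike.congr_fun h (s * t)
  rw [sprayDefect_apply] at h1
  have hst : ((s * t : unitInterval) : ℝ) = s * t := rfl
  rw [sprayDefect_apply, primFun_rescale s a t.2, primFun_primitive_rescale s a t.2, ← smul_add,
    smul_smul, mul_comm (t : ℝ) s]
  rw [hst] at h1
  have h2 : rescale s a t = (s : ℝ) ^ 2 • a (s * t) := rfl
  simp only [map_smul, smul_apply, smul_smul, ← pow_two, h2, ← smul_add, h1]
  simp

theorem isSpraySolution_of_sprayDefect (hΓ : ContDiff ℝ ∞ Γ) {x v : E} {a : C(unitInterval, E)}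
    (h : sprayDefect hΓ (x, v, a) = 0) :
    IsSpraySolution Γ (fun t => x + t • v + primFun (primitive a) t)
      (fun t => v + primFun a t) := by
  intro t ht
  have h1 : HasDerivAt (fun t : ℝ => x + t • v) v t := by
    simpa using ((hasDerivAt_id t).smul_const v).const_add x
  have h2 := hasDerivAt_primFun (primitive a) t
  have h3 := hasDerivAt_primFun a t
  rw [projIcc_of_mem _ ht] at h2 h3
  have h4 := DFunLike.congr_fun h ⟨t, ht⟩
  rw [sprayDefect_apply] at h4
  refine ⟨(h1.add h2).hasDerivWithinAt, ?_⟩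
  rw [← eq_neg_of_add_eq_zero_left h4]
  exact (h3.const_add v).hasDerivWithinAt

/-- Smooth dependence on initial data of the solutions of `c'' = -Γ(c)(c', c')` with small initial
velocity: the exponential map of a spray. -/
theorem exists_spray_exp (hΓ : ContDiff ℝ ∞ Γ) (x₀ : E) :
    ∃ ρ > 0, ∃ e : E × E → E,
      ContDiffOn ℝ ∞ e (Metric.ball x₀ ρ ×ˢ Metric.ball 0 ρ) ∧
      ∀ x ∈ Metric.ball x₀ ρ, ∀ v ∈ Metric.ball (0 : E) ρ, e (x, 0) = x ∧
        ∃ w : ℝ → E, w 0 = v ∧ IsSpraySolution Γ (fun t => e (x, t • v)) w := by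
  -- The acceleration is the unknown and `(x, v)` are parameters. The derivative of `Θ` at `(x₀, 0,
  -- 0)` is the identity, so inverting `Θ` over last component `0` gives the acceleration as a
  -- smooth function of `(x, v)`.
  set Θ : E × E × C(unitInterval, E) → E × E × C(unitInterval, E) :=
    fun z => (z.1, z.2.1, sprayDefect hΓ z) with hΘ
  have hΘs : ContDiff ℝ ∞ Θ :=
    contDiff_fst.prodMk ((contDiff_fst.comp contDiff_snd).prodMk (contDiff_sprayDefect hΓ))
  have hΘd : HasFDerivAt Θ (ContinuousLinearEquiv.refl ℝ (E × E × C(unitInterval, E)) :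
      (E × E × C(unitInterval, E)) →L[ℝ] (E × E × C(unitInterval, E))) (x₀, 0, 0) := by
    have h := (hasFDerivAt_fst (𝕜 := ℝ) (p := (x₀, (0 : E), (0 : C(unitInterval, E))))).prodMk
      ((hasFDerivAt_fst.comp (x₀, (0 : E), (0 : C(unitInterval, E)))
        (hasFDerivAt_snd (𝕜 := ℝ))).prodMk (hasFDerivAt_sprayDefect hΓ x₀))
    exact h
  obtain ⟨Φ, hmem, -, hEq, hsymm⟩ := exists_openPartialHomeomorph_contDiffOn isOpen_univ
    hΘs.contDiffOn (mem_univ _) _ hΘd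
  have hdef0 : sprayDefect hΓ (x₀, 0, 0) = 0 := by
    ext t; rw [sprayDefect_apply]; simp [primFun]
  have hΦ0 : Φ (x₀, 0, 0) = (x₀, 0, 0) := by rw [hEq hmem]; simp [hΘ, hdef0]
  obtain ⟨r, hr, hball⟩ := Metric.isOpen_iff.1 Φ.open_source _ hmem
  have htgt : (x₀, (0 : E), (0 : C(unitInterval, E))) ∈ Φ.target := by
    rw [← hΦ0]; exact Φ.map_source hmem
  have hsymm0 : Φ.symm (x₀, 0, 0) = (x₀, 0, 0) := by
    conv_lhs => rw [← hΦ0]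
    exact Φ.left_inv hmem
  have hev : ∀ᶠ z in 𝓝 (x₀, (0 : E)), (z.1, z.2, (0 : C(unitInterval, E))) ∈ Φ.target ∧
      Φ.symm (z.1, z.2, 0) ∈ Metric.ball (x₀, (0 : E), (0 : C(unitInterval, E))) r := by
    have hι : Continuous fun z : E × E => (z.1, z.2, (0 : C(unitInterval, E))) := by fun_prop
    have h1 := (hι.continuousAt (x := (x₀, (0 : E)))).eventually (Φ.open_target.mem_nhds htgt)
    have h2 : ContinuousAt Φ.symm (x₀, 0, 0) := Φ.continuousAt_symm htgt
    have h3 := (ContinuousAt.comp (x := (x₀, (0 : E))) (f := fun z : E × E =>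
      (z.1, z.2, (0 : C(unitInterval, E)))) h2 hι.continuousAt)
    have h4 := h3.eventually (Metric.ball_mem_nhds _ hr)
    simp only [Function.comp_apply, hsymm0] at h4
    exact h1.and h4
  obtain ⟨ρ, hρ, hρb⟩ := Metric.eventually_nhds_iff_ball.1 hev
  set A : E × E → C(unitInterval, E) := fun z => (Φ.symm (z.1, z.2, 0)).2.2 with hA
  have hS : ∀ z ∈ Metric.ball x₀ ρ ×ˢ Metric.ball (0 : E) ρ,
      (z.1, z.2, (0 : C(unitInterval, E))) ∈ Φ.target ∧
      Φ.symm (z.1, z.2, 0) = (z.1, z.2, A z) ∧ ‖A z‖ < r ∧ dist z.1 x₀ < r ∧ ‖z.2‖ < r ∧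
      sprayDefect hΓ (z.1, z.2, A z) = 0 := by
    intro z hz
    have hz' : z ∈ Metric.ball (x₀, (0 : E)) ρ := by
      rw [← ball_prod_same]; exact hz
    obtain ⟨h1, h2⟩ := hρb z hz'
    have h3 := Φ.right_inv h1
    rw [hEq (Φ.map_target h1)] at h3
    have e1 : (Φ.symm (z.1, z.2, 0)).1 = z.1 := congrArg Prod.fst h3
    have e2 : (Φ.symm (z.1, z.2, 0)).2.1 = z.2 := congrArg (fun y => y.2.1) h3
    have e3 : sprayDefect hΓ (Φ.symm (z.1, z.2, 0)) = 0 := congrArg (fun y => y.2.2) h3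
    have e4 : Φ.symm (z.1, z.2, 0) = (z.1, z.2, A z) := Prod.ext e1 (Prod.ext e2 rfl)
    rw [e4] at e3 h2
    simp only [← ball_prod_same, mem_prod, Metric.mem_ball, dist_zero_right] at h2
    exact ⟨h1, e4, h2.2.2, h2.1, h2.2.1, e3⟩
  refine ⟨ρ, hρ, fun z => z.1 + z.2 + primitive (primitive (A z)) 1, ?_, ?_⟩
  · have hAs : ContDiffOn ℝ ∞ A (Metric.ball x₀ ρ ×ˢ Metric.ball 0 ρ) := by
      have h1 : ContDiffOn ℝ ∞ (fun z : E × E => Φ.symm (z.1, z.2, (0 : C(unitInterval, E))))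
          (Metric.ball x₀ ρ ×ˢ Metric.ball 0 ρ) :=
        hsymm.comp (contDiff_fst.prodMk (contDiff_snd.prodMk contDiff_const)).contDiffOn
          fun z hz => (hS z hz).1
      exact (contDiff_snd.comp contDiff_snd).comp_contDiffOn h1
    have h2 : ContDiffOn ℝ ∞ (fun z => primitive (primitive (A z)) 1)
        (Metric.ball x₀ ρ ×ˢ Metric.ball 0 ρ) :=
      (((ContinuousMap.evalCLM ℝ (1 : unitInterval)).comp
        ((primitive (E := E)).comp primitive)).contDiff (n := ∞)).comp_contDiffOn hAs
    exact (contDiff_fst.add contDiff_snd).contDiffOn.add h2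
  · intro x hx v hv
    have hxv := hS (x, v) ⟨hx, hv⟩
    -- The rescaled acceleration solves the equation with velocity `s v` and stays in the ball where
    -- `Φ` is injective. It is therefore the acceleration selected for `(x, s v)`, whence `e (x, t
    -- v)` is the value at time `t` of the solution with velocity `v`.
    have key : ∀ s : unitInterval, A (x, (s : ℝ) • v) = rescale s (A (x, v)) := by
      intro s
      have hsv : ((x, (s : ℝ) • v) : E × E) ∈ Metric.ball x₀ ρ ×ˢ Metric.ball (0 : E) ρ := by
        refine ⟨hx, ?_⟩
        rw [mem_ball_zero_iff] at hv ⊢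
        rw [norm_smul, Real.norm_eq_abs, abs_of_nonneg s.2.1]
        exact (mul_le_of_le_one_left (norm_nonneg _) s.2.2).trans_lt hv
      have h1 := hS _ hsv
      have hmem1 : ((x, (s : ℝ) • v, rescale s (A (x, v))) : E × E × C(unitInterval, E)) ∈
          Φ.source := by
        apply hball
        simp only [← ball_prod_same, mem_prod, Metric.mem_ball, dist_zero_right]
        exact ⟨hxv.2.2.2.1, h1.2.2.2.2.1, (norm_rescale_le _ _).trans_lt hxv.2.2.1⟩
      have h2 : Φ (x, (s : ℝ) • v, rescale s (A (x, v))) = (x, (s : ℝ) • v, 0) := by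
        rw [hEq hmem1]
        simp only [hΘ, sprayDefect_rescale hΓ hxv.2.2.2.2.2 s]
      have h3 := Φ.left_inv hmem1
      rw [h2, h1.2.1] at h3
      exact congrArg (fun y => y.2.2) h3
    have hform : ∀ t ∈ Icc (0 : ℝ) 1, x + t • v + primitive (primitive (A (x, t • v))) 1
        = x + t • v + primFun (primitive (A (x, v))) t := by
      intro t ht
      have := key ⟨t, ht⟩
      simp only at this
      rw [this, primitive_apply, Icc.coe_one,
        primFun_primitive_rescale _ _ (right_mem_Icc.2 zero_le_one), mul_one]
    refine ⟨?_, fun t => v + primFun (A (x, v)) t, ?_, ?_⟩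
    · have := hform 0 (left_mem_Icc.2 zero_le_one)
      simpa using this
    · simp
    · intro t ht
      have h := isSpraySolution_of_sprayDefect hΓ hxv.2.2.2.2.2 t ht
      simp only at hform h ⊢
      rw [hform t ht]
      exact ⟨h.1.congr hform (hform t ht), h.2⟩

end SprayExp

/-! ### Cut-off extension of smooth maps. -/

section Extension

variable {E F : Type*} [NormedAddCommGroup E] [NormedSpace ℝ E] [FiniteDimensional ℝ E]
  [NormedAddCommGroup F] [NormedSpace ℝ F]

/-- A smooth map near a point agrees near that point with a globally smooth one. -/
theorem exists_contDiff_eventuallyEq {f : E → F} {U : Set E} (hU : IsOpen U)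
    (hf : ContDiffOn ℝ ∞ f U) {x₀ : E} (hx₀ : x₀ ∈ U) :
    ∃ f' : E → F, ContDiff ℝ ∞ f' ∧ f' =ᶠ[𝓝 x₀] f := by
  obtain ⟨r, hr, hball⟩ := Metric.nhds_basis_closedBall.mem_iff.1 (hU.mem_nhds hx₀)
  let χ : ContDiffBump x₀ := ⟨r / 2, r, by positivity, by linarith⟩
  refine ⟨fun x => χ x • f x, contDiff_iff_contDiffAt.2 fun x => ?_, ?_⟩
  · by_cases hx : x ∈ U
    · exact χ.contDiffAt.smul (hf.contDiffAt (hU.mem_nhds hx))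
    · have h : (tsupport χ)ᶜ ∈ 𝓝 x := by
        refine (isClosed_tsupport _).isOpen_compl.mem_nhds fun h => hx (hball ?_)
        rwa [χ.tsupport_eq] at h
      refine (contDiffAt_const (c := (0 : F))).congr_of_eventuallyEq ?_
      filter_upwards [h] with y hy
      rw [image_eq_zero_of_notMem_tsupport hy, zero_smul]
  · filter_upwards [χ.eventuallyEq_one] with y hy
    rw [hy]; simp

end Extension

/-! ### Uniqueness for the geodesic equation. -/

section Uniqueness

variable {E : Type} [NormedAddCommGroup E] [NormedSpace ℝ E]

theorem HasDerivWithinAt.Ici_of_Icc_zero_one {F : Type*} [NormedAddCommGroup F] [NormedSpace ℝ F]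
    {f : ℝ → F} {f' : F} {t : ℝ} (ht : t ∈ Ico (0 : ℝ) 1)
    (h : HasDerivWithinAt f f' (Icc 0 1) t) : HasDerivWithinAt f f' (Ici t) t :=
  (h.mono (Icc_subset_Icc_left ht.1)).mono_of_mem_nhdsWithin (Icc_mem_nhdsGE ht.2)

theorem eq_of_hasDerivWithinAt_Icc {F : Type*} [NormedAddCommGroup F] [NormedSpace ℝ F]
    {f : ℝ → F} {a b : F} {t : ℝ} (ht : t ∈ Icc (0 : ℝ) 1)
    (ha : HasDerivWithinAt f a (Icc 0 1) t) (hb : HasDerivWithinAt f b (Icc 0 1) t) : a = b :=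
  (uniqueDiffOn_Icc zero_lt_one t ht).eq_deriv _ ha hb

/-- Both orbits stay in a compact ball, on which the first-order system is Lipschitz. The end time
`T` is free so that the lemma also serves continuation arguments. -/
theorem spray_solution_unique [FiniteDimensional ℝ E] {Γ : E → E →L[ℝ] E →L[ℝ] E}
    (hΓ : ContDiff ℝ ∞ Γ) {T : ℝ}
    (hT : T ∈ Icc (0 : ℝ) 1) {c₁ w₁ c₂ w₂ : ℝ → E}
    (h₁ : ∀ t ∈ Icc (0 : ℝ) T, HasDerivWithinAt c₁ (w₁ t) (Icc 0 1) t ∧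
      HasDerivWithinAt w₁ (-Γ (c₁ t) (w₁ t) (w₁ t)) (Icc 0 1) t)
    (h₂ : ∀ t ∈ Icc (0 : ℝ) T, HasDerivWithinAt c₂ (w₂ t) (Icc 0 1) t ∧
      HasDerivWithinAt w₂ (-Γ (c₂ t) (w₂ t) (w₂ t)) (Icc 0 1) t)
    (hc : c₁ 0 = c₂ 0) (hw : w₁ 0 = w₂ 0) :
    EqOn c₁ c₂ (Icc 0 T) ∧ EqOn w₁ w₂ (Icc 0 T) := by
  have hsub : Icc (0 : ℝ) T ⊆ Icc 0 1 := Icc_subset_Icc_right hT.2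
  have cont : ∀ {c w : ℝ → E}, (∀ t ∈ Icc (0 : ℝ) T, HasDerivWithinAt c (w t) (Icc 0 1) t ∧
      HasDerivWithinAt w (-Γ (c t) (w t) (w t)) (Icc 0 1) t) →
      ContinuousOn (fun t => (c t, w t)) (Icc 0 T) := fun h t ht =>
    (((h t ht).1.continuousWithinAt.mono hsub).prodMk ((h t ht).2.continuousWithinAt.mono hsub))
  obtain ⟨R₁, hR₁⟩ := (isCompact_Icc.image_of_continuousOn (cont h₁)).isBounded.subset_closedBall 0
  obtain ⟨R₂, hR₂⟩ := (isCompact_Icc.image_of_continuousOn (cont h₂)).isBounded.subset_closedBall 0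
  set X : E × E → E × E := fun z => (z.2, -Γ z.1 z.2 z.2) with hX
  have hXs : ContDiff ℝ 1 X :=
    (contDiff_snd.prodMk (contDiff_spray hΓ).neg).of_le (by simp)
  obtain ⟨K, hK⟩ := hXs.contDiffOn.exists_lipschitzOnWith (s := Metric.closedBall 0 (max R₁ R₂))
    one_ne_zero (convex_closedBall _ _) (isCompact_closedBall _ _)
  have deriv : ∀ {c w : ℝ → E}, (∀ t ∈ Icc (0 : ℝ) T, HasDerivWithinAt c (w t) (Icc 0 1) t ∧
      HasDerivWithinAt w (-Γ (c t) (w t) (w t)) (Icc 0 1) t) → ∀ t ∈ Ico (0 : ℝ) T,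
      HasDerivWithinAt (fun t => (c t, w t)) (X (c t, w t)) (Ici t) t := fun h t ht =>
    have ht' : t ∈ Ico (0 : ℝ) 1 := ⟨ht.1, ht.2.trans_le hT.2⟩
    (HasDerivWithinAt.Ici_of_Icc_zero_one ht' (h t ⟨ht.1, ht.2.le⟩).1).prodMk
      (HasDerivWithinAt.Ici_of_Icc_zero_one ht' (h t ⟨ht.1, ht.2.le⟩).2)
  have := ODE_solution_unique_of_mem_Icc_right (v := fun _ => X)
    (s := fun _ => Metric.closedBall 0 (max R₁ R₂)) (fun _ _ => hK) (cont h₁) (deriv h₁)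
    (fun t ht => Metric.closedBall_subset_closedBall (le_max_left _ _)
      (hR₁ (mem_image_of_mem _ ⟨ht.1, ht.2.le⟩)))
    (cont h₂) (deriv h₂)
    (fun t ht => Metric.closedBall_subset_closedBall (le_max_right _ _)
      (hR₂ (mem_image_of_mem _ ⟨ht.1, ht.2.le⟩))) (by simp [hc, hw])
  exact ⟨fun t ht => congrArg Prod.fst (this ht), fun t ht => congrArg Prod.snd (this ht)⟩

end Uniqueness

/-! ### The diffeomorphism `(x, v) ↦ (x, exp_x v)` and its inverse. -/

section SprayChart

variable {E : Type} [NormedAddCommGroup E] [NormedSpace ℝ E]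

/-- The map `(x, v) ↦ (x, exp_x v)` of a spray, as a diffeomorphism of a product of balls around
`(x₀, 0)` onto a neighbourhood of `(x₀, x₀)`, with values of `exp` in `V`. -/
structure SprayChart (Γ : E → E →L[ℝ] E →L[ℝ] E) (x₀ : E) (V : Set E) where
  /-- the radius of the balls -/
  ρ : ℝ
  ρ_pos : 0 < ρ
  /-- the map `(x, v) ↦ (x, exp_x v)` -/
  Θ : OpenPartialHomeomorph (E × E) (E × E)
  source_eq : Θ.source = Metric.ball x₀ ρ ×ˢ Metric.ball 0 ρ
  fst_eq : ∀ z ∈ Θ.source, (Θ z).1 = z.1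
  contDiffOn : ContDiffOn ℝ ∞ Θ Θ.source
  contDiffOn_symm : ContDiffOn ℝ ∞ Θ.symm Θ.target
  map_zero : ∀ x ∈ Metric.ball x₀ ρ, Θ (x, 0) = (x, x)
  sol : ∀ x ∈ Metric.ball x₀ ρ, ∀ v ∈ Metric.ball (0 : E) ρ,
    ∃ w : ℝ → E, w 0 = v ∧ IsSpraySolution Γ (fun t => (Θ (x, t • v)).2) w
  mem : ∀ z ∈ Θ.source, (Θ z).2 ∈ V

/-- The linear automorphism `(a, b) ↦ (a, a + b)`. -/
def shearEquiv (E : Type) [NormedAddCommGroup E] [NormedSpace ℝ E] : (E × E) ≃L[ℝ] (E × E) :=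
  ContinuousLinearEquiv.equivOfInverse
    ((ContinuousLinearMap.fst ℝ E E).prod
      (ContinuousLinearMap.fst ℝ E E + ContinuousLinearMap.snd ℝ E E))
    ((ContinuousLinearMap.fst ℝ E E).prod
      (ContinuousLinearMap.snd ℝ E E - ContinuousLinearMap.fst ℝ E E))
    (fun z => by simp) (fun z => by simp)

/-- Since `exp_x 0 = x` and `t ↦ exp_x (t v)` starts with velocity `v`, the derivative at `(x₀, 0)`
is the shear `(a, b) ↦ (a, a + b)`, which is invertible. -/
theorem nonempty_sprayChart [CompleteSpace E] {Γ : E → E →L[ℝ] E →L[ℝ] E} (hΓ : ContDiff ℝ ∞ Γ)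
    (x₀ : E) {V : Set E} (hV : V ∈ 𝓝 x₀) : Nonempty (SprayChart Γ x₀ V) := by
  obtain ⟨ρ, hρ, e, hes, he⟩ := exists_spray_exp hΓ x₀
  set U := Metric.ball x₀ ρ ×ˢ Metric.ball (0 : E) ρ with hUdef
  have hU : IsOpen U := Metric.isOpen_ball.prod Metric.isOpen_ball
  have hxU : (x₀, (0 : E)) ∈ U := ⟨Metric.mem_ball_self hρ, Metric.mem_ball_self hρ⟩
  have hed : HasFDerivAt e (fderiv ℝ e (x₀, 0)) (x₀, 0) :=
    ((hes.contDiffAt (hU.mem_nhds hxU)).differentiableAt (by simp)).hasFDerivAt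
  have h1 : ∀ a, fderiv ℝ e (x₀, 0) (a, 0) = a := by
    intro a
    have hl : HasDerivAt (fun t : ℝ => (x₀ + t • a, (0 : E))) (a, 0) 0 := by
      have : HasDerivAt (fun t : ℝ => x₀ + t • a) a 0 := by
        simpa using ((hasDerivAt_id (0 : ℝ)).smul_const a).const_add x₀
      exact this.prodMk (hasDerivAt_const _ _)
    have hc : HasDerivAt (fun t : ℝ => e (x₀ + t • a, 0)) (fderiv ℝ e (x₀, 0) (a, 0)) 0 :=
      HasFDerivAt.comp_hasDerivAt (f := fun t : ℝ => (x₀ + t • a, (0 : E))) (0 : ℝ)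
        (by simpa using hed) hl
    have hc' : HasDerivAt (fun t : ℝ => x₀ + t • a) a 0 := by
      simpa using ((hasDerivAt_id (0 : ℝ)).smul_const a).const_add x₀
    refine hc.unique (hc'.congr_of_eventuallyEq ?_)
    have : ∀ᶠ t in 𝓝 (0 : ℝ), x₀ + t • a ∈ Metric.ball x₀ ρ :=
      hc'.continuousAt.eventually (by
        simp only [zero_smul, add_zero]; exact Metric.ball_mem_nhds x₀ hρ)
    filter_upwards [this] with t ht
    exact (he _ ht 0 (Metric.mem_ball_self hρ)).1
  have h2' : ∀ b ∈ Metric.ball (0 : E) ρ, fderiv ℝ e (x₀, 0) (0, b) = b := by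
    intro b hb
    obtain ⟨w, hw0, hw⟩ := (he x₀ (Metric.mem_ball_self hρ) b hb).2
    have h := (hw 0 (left_mem_Icc.2 zero_le_one)).1
    rw [hw0] at h
    have hl : HasDerivAt (fun t : ℝ => (x₀, t • b)) (0, b) 0 :=
      (hasDerivAt_const _ _).prodMk (by simpa using (hasDerivAt_id (0 : ℝ)).smul_const b)
    have hc : HasDerivAt (fun t : ℝ => e (x₀, t • b)) (fderiv ℝ e (x₀, 0) (0, b)) 0 :=
      HasFDerivAt.comp_hasDerivAt (f := fun t : ℝ => (x₀, t • b)) (0 : ℝ) (by simpa using hed) hl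
    exact eq_of_hasDerivWithinAt_Icc (left_mem_Icc.2 zero_le_one) hc.hasDerivWithinAt h
  -- Solutions are available only for small initial velocities; linearity removes the restriction.
  have h2 : ∀ b, fderiv ℝ e (x₀, 0) (0, b) = b := by
    intro b
    obtain ⟨s, hs, hsb⟩ : ∃ s : ℝ, s ≠ 0 ∧ s • b ∈ Metric.ball (0 : E) ρ := by
      refine ⟨ρ / (2 * (‖b‖ + 1)), by positivity, ?_⟩
      rw [mem_ball_zero_iff, norm_smul, Real.norm_eq_abs, abs_of_pos (by positivity),
        div_mul_eq_mul_div,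
        div_lt_iff₀ (by positivity)]
      nlinarith [norm_nonneg b]
    have h := h2' _ hsb
    have e1 : ((0 : E), s • b) = s • ((0 : E), b) := by simp
    rw [e1, map_smul] at h
    exact smul_right_injective E hs h
  have hd : HasFDerivAt (fun z : E × E => (z.1, e z)) (shearEquiv E : E × E →L[ℝ] E × E)
      (x₀, 0) := by
    refine ((hasFDerivAt_fst (𝕜 := ℝ)).prodMk hed).congr_fderiv ?_
    refine ContinuousLinearMap.ext fun z => ?_
    have hz : z = (z.1, 0) + (0, z.2) := by simp
    have : fderiv ℝ e (x₀, 0) z = z.1 + z.2 := by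
      conv_lhs => rw [hz, map_add, h1, h2]
    simp [shearEquiv, this]
  obtain ⟨Φ, hmem, hsub, hEq, hsymm⟩ := exists_openPartialHomeomorph_contDiffOn hU
    (contDiffOn_fst.prodMk hes) hxU _ hd
  have he0 : e (x₀, 0) = x₀ := (he x₀ hxU.1 0 hxU.2).1
  have hVe : ∀ᶠ z in 𝓝 (x₀, (0 : E)), e z ∈ V :=
    hed.continuousAt.eventually (by rw [he0]; exact hV)
  obtain ⟨r, hr, hb⟩ := Metric.eventually_nhds_iff_ball.1
    ((Φ.open_source.eventually_mem hmem).and hVe)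
  rw [← ball_prod_same] at hb
  set S := Metric.ball x₀ r ×ˢ Metric.ball (0 : E) r with hS
  have hSo : IsOpen S := Metric.isOpen_ball.prod Metric.isOpen_ball
  have hSU : S ⊆ U := fun z hz => hsub (hb z hz).1
  have hsrc : (Φ.restrOpen S hSo).source = S := by
    rw [Φ.restrOpen_source]; exact inter_eq_right.2 fun z hz => (hb z hz).1
  have hval : ∀ z ∈ S, Φ.restrOpen S hSo z = (z.1, e z) := fun z hz => hEq (hb z hz).1
  have h0r : (0 : E) ∈ Metric.ball (0 : E) r := Metric.mem_ball_self hr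
  refine ⟨⟨r, hr, Φ.restrOpen S hSo, hsrc, ?_, ?_, ?_, ?_, ?_, ?_⟩⟩
  · intro z hz
    rw [hsrc] at hz
    rw [hval z hz]
  · rw [hsrc]
    exact ((contDiffOn_fst.prodMk hes).mono hSU).congr hval
  · exact hsymm.mono fun y hy => hy.1
  · intro x hx
    have hxU : (x, (0 : E)) ∈ U := hSU ⟨hx, h0r⟩
    rw [hval _ ⟨hx, h0r⟩, (he x hxU.1 0 hxU.2).1]
  · intro x hx v hv
    have hxU : (x, v) ∈ U := hSU ⟨hx, hv⟩
    obtain ⟨w, hw0, hw⟩ := (he x hxU.1 v hxU.2).2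
    refine ⟨w, hw0, fun t ht => ?_⟩
    have hE : ∀ t ∈ Icc (0 : ℝ) 1, (Φ.restrOpen S hSo (x, t • v)).2 = e (x, t • v) := by
      intro t ht
      rw [hval _ ⟨hx, ?_⟩]
      rw [mem_ball_zero_iff] at hv ⊢
      rw [norm_smul, Real.norm_eq_abs, abs_of_nonneg ht.1]
      exact (mul_le_of_le_one_left (norm_nonneg _) ht.2).trans_lt hv
    have h := hw t ht
    simp only at h ⊢
    rw [hE t ht]
    exact ⟨h.1.congr hE (hE t ht), h.2⟩
  · intro z hz
    rw [hsrc] at hz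
    rw [hval z hz]
    exact (hb z hz).2

namespace SprayChart

variable {Γ : E → E →L[ℝ] E →L[ℝ] E} {x₀ : E} {V : Set E} (D : SprayChart Γ x₀ V)

/-- The exponential map at `x`. -/
def exp (x v : E) : E := (D.Θ (x, v)).2

/-- The inverse of the exponential map at `x`. -/
def log (x y : E) : E := (D.Θ.symm (x, y)).2

variable {x v y : E}

theorem mem_source (hx : x ∈ Metric.ball x₀ D.ρ) (hv : v ∈ Metric.ball (0 : E) D.ρ) :
    (x, v) ∈ D.Θ.source := by rw [D.source_eq]; exact ⟨hx, hv⟩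

theorem apply_eq (hx : x ∈ Metric.ball x₀ D.ρ) (hv : v ∈ Metric.ball (0 : E) D.ρ) :
    D.Θ (x, v) = (x, D.exp x v) :=
  Prod.ext (D.fst_eq _ (D.mem_source hx hv)) rfl

theorem mem_target (hx : x ∈ Metric.ball x₀ D.ρ) (hv : v ∈ Metric.ball (0 : E) D.ρ) :
    (x, D.exp x v) ∈ D.Θ.target := by
  rw [← D.apply_eq hx hv]; exact D.Θ.map_source (D.mem_source hx hv)

theorem log_exp (hx : x ∈ Metric.ball x₀ D.ρ) (hv : v ∈ Metric.ball (0 : E) D.ρ) :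
    D.log x (D.exp x v) = v := by
  have := D.Θ.left_inv (D.mem_source hx hv)
  rw [D.apply_eq hx hv] at this
  exact congrArg Prod.snd this

theorem symm_eq (h : (x, y) ∈ D.Θ.target) : D.Θ.symm (x, y) = (x, D.log x y) := by
  refine Prod.ext ?_ rfl
  have h1 := D.fst_eq _ (D.Θ.map_target h)
  rw [D.Θ.right_inv h] at h1
  exact h1.symm

theorem mem_ball_of_mem_target (h : (x, y) ∈ D.Θ.target) :
    x ∈ Metric.ball x₀ D.ρ ∧ D.log x y ∈ Metric.ball (0 : E) D.ρ := by
  have := D.Θ.map_target h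
  rw [D.symm_eq h, D.source_eq] at this
  exact this

theorem exp_log (h : (x, y) ∈ D.Θ.target) : D.exp x (D.log x y) = y := by
  have := D.Θ.right_inv h
  rw [D.symm_eq h] at this
  exact congrArg Prod.snd this

theorem exp_zero (hx : x ∈ Metric.ball x₀ D.ρ) : D.exp x 0 = x := by
  rw [exp, D.map_zero x hx]

theorem smul_mem_ball (hv : v ∈ Metric.ball (0 : E) D.ρ) {t : ℝ} (ht : t ∈ Icc (0 : ℝ) 1) :
    t • v ∈ Metric.ball (0 : E) D.ρ := by
  rw [mem_ball_zero_iff] at hv ⊢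
  rw [norm_smul, Real.norm_eq_abs, abs_of_nonneg ht.1]
  exact (mul_le_of_le_one_left (norm_nonneg _) ht.2).trans_lt hv

theorem exp_mem (hx : x ∈ Metric.ball x₀ D.ρ) (hv : v ∈ Metric.ball (0 : E) D.ρ) :
    D.exp x v ∈ V := D.mem _ (D.mem_source hx hv)

theorem contDiffOn_exp (hx : x ∈ Metric.ball x₀ D.ρ) :
    ContDiffOn ℝ ∞ (D.exp x) (Metric.ball 0 D.ρ) :=
  contDiff_snd.comp_contDiffOn (D.contDiffOn.comp
    (contDiff_const.prodMk contDiff_id).contDiffOn fun _ hv => D.mem_source hx hv)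

theorem contDiffOn_log (x : E) : ContDiffOn ℝ ∞ (D.log x) {y | (x, y) ∈ D.Θ.target} :=
  contDiff_snd.comp_contDiffOn (D.contDiffOn_symm.comp
    (contDiff_const.prodMk contDiff_id).contDiffOn fun _ hv => hv)

theorem isOpen_log_domain (x : E) : IsOpen {y | (x, y) ∈ D.Θ.target} :=
  D.Θ.open_target.preimage (by fun_prop : Continuous fun y : E => (x, y))

theorem hasFDerivAt_exp (hx : x ∈ Metric.ball x₀ D.ρ) (hv : v ∈ Metric.ball (0 : E) D.ρ) :
    HasFDerivAt (D.exp x) (fderiv ℝ (D.exp x) v) v :=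
  (((D.contDiffOn_exp hx).contDiffAt (Metric.isOpen_ball.mem_nhds hv)).differentiableAt
    (by simp)).hasFDerivAt

theorem hasFDerivAt_fderiv_exp (hx : x ∈ Metric.ball x₀ D.ρ)
    (hv : v ∈ Metric.ball (0 : E) D.ρ) :
    HasFDerivAt (fderiv ℝ (D.exp x)) (fderiv ℝ (fderiv ℝ (D.exp x)) v) v := by
  have h := (D.contDiffOn_exp hx).fderiv_of_isOpen Metric.isOpen_ball (m := ∞) (by simp)
  exact ((h.contDiffAt (Metric.isOpen_ball.mem_nhds hv)).differentiableAt (by simp)).hasFDerivAt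

theorem hasDerivAt_smul (v : E) (t : ℝ) : HasDerivAt (fun t : ℝ => t • v) v t := by
  simpa using (hasDerivAt_id t).smul_const v

theorem hasDerivAt_exp_smul (hx : x ∈ Metric.ball x₀ D.ρ) (hv : v ∈ Metric.ball (0 : E) D.ρ)
    {t : ℝ} (ht : t ∈ Icc (0 : ℝ) 1) :
    HasDerivAt (fun t : ℝ => D.exp x (t • v)) (fderiv ℝ (D.exp x) (t • v) v) t :=
  HasFDerivAt.comp_hasDerivAt (f := fun t : ℝ => t • v) t
    (D.hasFDerivAt_exp hx (D.smul_mem_ball hv ht)) (hasDerivAt_smul v t)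

theorem hasDerivAt_fderiv_exp_smul (hx : x ∈ Metric.ball x₀ D.ρ)
    (hv : v ∈ Metric.ball (0 : E) D.ρ) {t : ℝ} (ht : t ∈ Icc (0 : ℝ) 1) :
    HasDerivAt (fun t : ℝ => fderiv ℝ (D.exp x) (t • v))
      (fderiv ℝ (fderiv ℝ (D.exp x)) (t • v) v) t :=
  (D.hasFDerivAt_fderiv_exp hx (D.smul_mem_ball hv ht)).comp_hasDerivAt t (hasDerivAt_smul v t)

/-- The field `sol` leaves the velocity curve unspecified; uniqueness of derivatives identifies it
with the derivative of `exp`. -/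
theorem isSpraySolution_exp (hx : x ∈ Metric.ball x₀ D.ρ) (hv : v ∈ Metric.ball (0 : E) D.ρ) :
    IsSpraySolution Γ (fun t => D.exp x (t • v)) (fun t => fderiv ℝ (D.exp x) (t • v) v) := by
  obtain ⟨w, -, hw⟩ := D.sol x hx v hv
  have hwe : ∀ t ∈ Icc (0 : ℝ) 1, fderiv ℝ (D.exp x) (t • v) v = w t := fun t ht =>
    eq_of_hasDerivWithinAt_Icc ht
      (D.hasDerivAt_exp_smul hx hv ht).hasDerivWithinAt (hw t ht).1
  intro t ht
  have h := hw t ht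
  simp only at h ⊢
  rw [hwe t ht]
  exact ⟨h.1, h.2.congr hwe (hwe t ht)⟩

theorem fderiv_exp_zero (hx : x ∈ Metric.ball x₀ D.ρ) (v : E) :
    fderiv ℝ (D.exp x) 0 v = v := by
  have key : ∀ v ∈ Metric.ball (0 : E) D.ρ, fderiv ℝ (D.exp x) 0 v = v := by
    intro v hv
    obtain ⟨w, hw0, hw⟩ := D.sol x hx v hv
    have h0 := left_mem_Icc.2 (zero_le_one' ℝ)
    have h := eq_of_hasDerivWithinAt_Icc h0
      (D.hasDerivAt_exp_smul hx hv h0).hasDerivWithinAt (hw 0 h0).1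
    rwa [zero_smul, hw0] at h
  obtain ⟨s, hs, hsb⟩ : ∃ s : ℝ, s ≠ 0 ∧ s • v ∈ Metric.ball (0 : E) D.ρ := by
    have := D.ρ_pos
    refine ⟨D.ρ / (2 * (‖v‖ + 1)), by positivity, ?_⟩
    rw [mem_ball_zero_iff, norm_smul, Real.norm_eq_abs, abs_of_pos (by positivity),
      div_mul_eq_mul_div, div_lt_iff₀ (by positivity)]
    nlinarith [norm_nonneg v]
  have h := key _ hsb
  rw [map_smul] at h
  exact smul_right_injective E hs h

end SprayChart

end SprayChart

/-! ### Christoffel symbols of a metric on an open set. -/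

section Christoffel

variable {E : Type} [NormedAddCommGroup E] [NormedSpace ℝ E]

/-- The Christoffel form of the first kind of a field `G` of bilinear forms. -/
def christoffelForm (G : E → E →L[ℝ] E →L[ℝ] ℝ) (y : E) : E →L[ℝ] E →L[ℝ] E →L[ℝ] ℝ :=
  let A : E →L[ℝ] E →L[ℝ] E →L[ℝ] ℝ := fderiv ℝ G y
  let B : E →L[ℝ] E →L[ℝ] E →L[ℝ] ℝ := A.flip
  let C : E →L[ℝ] E →L[ℝ] E →L[ℝ] ℝ :=
    ((ContinuousLinearMap.flipₗᵢ ℝ E E ℝ).toContinuousLinearEquiv :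
      (E →L[ℝ] E →L[ℝ] ℝ) →L[ℝ] E →L[ℝ] E →L[ℝ] ℝ).comp B
  (2⁻¹ : ℝ) • (A + B - C)

theorem christoffelForm_apply (G : E → E →L[ℝ] E →L[ℝ] ℝ) (y u v z : E) :
    christoffelForm G y u v z =
      (fderiv ℝ G y u v z + fderiv ℝ G y v u z - fderiv ℝ G y z u v) / 2 := by
  simp [christoffelForm]
  ring

theorem contDiffOn_christoffelForm {G : E → E →L[ℝ] E →L[ℝ] ℝ} {U : Set E} (hU : IsOpen U)
    (hG : ContDiffOn ℝ ∞ G U) : ContDiffOn ℝ ∞ (christoffelForm G) U := by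
  have h1 : ContDiffOn ℝ ∞ (fderiv ℝ G) U := hG.fderiv_of_isOpen hU (by simp)
  have h2 : ContDiffOn ℝ ∞ (fun y => (fderiv ℝ G y).flip) U :=
    (ContinuousLinearMap.flipₗᵢ ℝ E E (E →L[ℝ] ℝ)).contDiff.comp_contDiffOn h1
  exact contDiffOn_const (c := (2⁻¹ : ℝ)) |>.smul ((h1.add h2).sub (contDiffOn_const.clm_comp h2))

/-- `G` is a smooth Riemannian metric on the open set `V`, and `Γ` restricts there to its
Christoffel symbols of the second kind. -/
structure IsMetricSpray (G : E → E →L[ℝ] E →L[ℝ] ℝ) (Γ : E → E →L[ℝ] E →L[ℝ] E)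
    (V : Set E) : Prop where
  isOpen : IsOpen V
  contDiffOn : ContDiffOn ℝ ∞ G V
  symm : ∀ y ∈ V, ∀ v w, G y v w = G y w v
  pos : ∀ y ∈ V, ∀ v, v ≠ 0 → 0 < G y v v
  christoffel : ∀ y ∈ V, ∀ u v z, G y (Γ y u v) z = christoffelForm G y u v z

theorem exists_equiv_of_pos [FiniteDimensional ℝ E] (B : E →L[ℝ] E →L[ℝ] ℝ)
    (hB : ∀ v, v ≠ 0 → 0 < B v v) : ∃ L : E ≃L[ℝ] (E →L[ℝ] ℝ), (L : E →L[ℝ] E →L[ℝ] ℝ) = B := by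
  have hinj : Function.Injective (B : E →ₗ[ℝ] E →L[ℝ] ℝ) := by
    rw [← LinearMap.ker_eq_bot, LinearMap.ker_eq_bot']
    intro v hv
    by_contra hne
    have h := hB v hne
    have h' : B v = 0 := hv
    rw [h'] at h
    simp at h
  have hfr : Module.finrank ℝ E = Module.finrank ℝ (E →L[ℝ] ℝ) := by
    rw [← (LinearMap.toContinuousLinearMap : (E →ₗ[ℝ] ℝ) ≃ₗ[ℝ] E →L[ℝ] ℝ).finrank_eq]
    exact (Subspace.dual_finrank_eq (K := ℝ) (V := E)).symm
  refine ⟨(LinearMap.linearEquivOfInjective _ hinj hfr).toContinuousLinearEquiv, ?_⟩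
  ext v w
  rfl

/-- `Γ` is obtained from the first-kind symbols by raising the last index with the inverse of `G y`.
Inversion is smooth at invertible maps. -/
theorem exists_christoffel [FiniteDimensional ℝ E] {G : E → E →L[ℝ] E →L[ℝ] ℝ} {U : Set E}
    (hU : IsOpen U) (hG : ContDiffOn ℝ ∞ G U) (hpos : ∀ y ∈ U, ∀ v, v ≠ 0 → 0 < G y v v) :
    ∃ Γ : E → E →L[ℝ] E →L[ℝ] E, ContDiffOn ℝ ∞ Γ U ∧
      ∀ y ∈ U, ∀ u v z, G y (Γ y u v) z = christoffelForm G y u v z := by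
  refine ⟨fun y => (ContinuousLinearMap.compL ℝ E (E →L[ℝ] ℝ) E (G y).inverse).comp
    (christoffelForm G y), ?_, ?_⟩
  · have hinv : ContDiffOn ℝ ∞ (fun y => (G y).inverse) U := by
      intro y hy
      obtain ⟨L, hL⟩ := exists_equiv_of_pos (G y) (hpos y hy)
      have h1 : ContDiffAt ℝ ∞ ContinuousLinearMap.inverse (G y) := by
        rw [← hL]; exact contDiffAt_map_inverse L
      exact h1.comp_contDiffWithinAt y (hG y hy)
    exact ((ContinuousLinearMap.compL ℝ E (E →L[ℝ] ℝ) E).contDiff.comp_contDiffOn hinv).clm_comp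
      (contDiffOn_christoffelForm hU hG)
  · intro y hy u v z
    obtain ⟨L, hL⟩ := exists_equiv_of_pos (G y) (hpos y hy)
    have : G y ((G y).inverse (christoffelForm G y u v)) = christoffelForm G y u v := by
      rw [← hL, ContinuousLinearMap.inverse_equiv]
      simp
    simp [this]

/-- A smooth metric near `x₀` has, on a smaller neighbourhood, the Christoffel symbols of a globally
defined smooth spray. -/
theorem exists_isMetricSpray [FiniteDimensional ℝ E] {G : E → E →L[ℝ] E →L[ℝ] ℝ} {U : Set E}
    (hU : IsOpen U) (hG : ContDiffOn ℝ ∞ G U) (hsymm : ∀ y ∈ U, ∀ v w, G y v w = G y w v)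
    (hpos : ∀ y ∈ U, ∀ v, v ≠ 0 → 0 < G y v v) {x₀ : E} (hx₀ : x₀ ∈ U) :
    ∃ Γ : E → E →L[ℝ] E →L[ℝ] E, ContDiff ℝ ∞ Γ ∧ ∃ V : Set E, x₀ ∈ V ∧ V ⊆ U ∧
      IsMetricSpray G Γ V := by
  obtain ⟨Γ₀, hΓ₀, hΓ₀c⟩ := exists_christoffel hU hG hpos
  -- The superposition argument requires a `Γ` smooth on all of `E`; only its values on `V` have
  -- geometric meaning.
  obtain ⟨Γ, hΓ, hEq⟩ := exists_contDiff_eventuallyEq hU hΓ₀ hx₀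
  obtain ⟨V, hV, hVo, hxV⟩ := eventually_nhds_iff.1 (hEq.and (hU.mem_nhds hx₀))
  have hVU : V ⊆ U := fun y hy => (hV y hy).2
  refine ⟨Γ, hΓ, V, hxV, hVU, ⟨hVo, hG.mono hVU, fun y hy => hsymm y (hVU hy),
    fun y hy => hpos y (hVU hy), fun y hy u v z => ?_⟩⟩
  rw [(hV y hy).1]
  exact hΓ₀c y (hVU hy) u v z

end Christoffel

/-! ### Constant speed and the Gauss lemma. -/

section Gauss

variable {E : Type} [NormedAddCommGroup E] [NormedSpace ℝ E]
  {G : E → E →L[ℝ] E →L[ℝ] ℝ} {Γ : E → E →L[ℝ] E →L[ℝ] E} {V : Set E}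

theorem hasDerivWithinAt_bilin {c a b : ℝ → E} {c' a' b' : E} {s : Set ℝ} {t : ℝ}
    {G' : E →L[ℝ] E →L[ℝ] E →L[ℝ] ℝ}
    (hG : HasFDerivAt G G' (c t)) (hc : HasDerivWithinAt c c' s t)
    (ha : HasDerivWithinAt a a' s t) (hb : HasDerivWithinAt b b' s t) :
    HasDerivWithinAt (fun t => G (c t) (a t) (b t))
      (G' c' (a t) (b t) + G (c t) a' (b t) + G (c t) (a t) b') s t := by
  have h := ((hG.comp_hasDerivWithinAt t hc).clm_apply ha).clm_apply hb
  simpa using h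

namespace IsMetricSpray

theorem hasFDerivAt (hM : IsMetricSpray G Γ V) {y : E} (hy : y ∈ V) :
    HasFDerivAt G (fderiv ℝ G y) y :=
  ((hM.contDiffOn.contDiffAt (hM.isOpen.mem_nhds hy)).differentiableAt (by simp)).hasFDerivAt

theorem nonneg (hM : IsMetricSpray G Γ V) {y : E} (hy : y ∈ V) (v : E) : 0 ≤ G y v v := by
  rcases eq_or_ne v 0 with rfl | h
  · simp
  · exact (hM.pos y hy v h).le

/-- Solutions of the geodesic equation have constant speed. -/
theorem speed_const (hM : IsMetricSpray G Γ V) {c w : ℝ → E} (h : IsSpraySolution Γ c w)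
    (hc : ∀ t ∈ Icc (0 : ℝ) 1, c t ∈ V) {t : ℝ} (ht : t ∈ Icc (0 : ℝ) 1) :
    G (c t) (w t) (w t) = G (c 0) (w 0) (w 0) := by
  have hd : ∀ t ∈ Icc (0 : ℝ) 1, HasDerivWithinAt (fun t => G (c t) (w t) (w t)) 0 (Icc 0 1) t := by
    intro t ht
    have h1 := hasDerivWithinAt_bilin (hM.hasFDerivAt (hc t ht)) (h t ht).1 (h t ht).2 (h t ht).2
    refine h1.congr_deriv ?_
    -- The two acceleration terms are each `-½ ∂_w G(w, w)`, so they cancel the derivative of the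
    -- metric along the path.
    rw [hM.symm _ (hc t ht) (w t) (-_)]
    simp only [map_neg, neg_apply, hM.christoffel _ (hc t ht), christoffelForm_apply]
    ring
  exact constant_of_derivWithin_zero (fun t ht => (hd t ht).differentiableWithinAt)
    (fun t ht => (hd t ⟨ht.1, ht.2.le⟩).derivWithin
      (uniqueDiffOn_Icc zero_lt_one t ⟨ht.1, ht.2.le⟩)) t ht

variable {x₀ : E} (D : SprayChart Γ x₀ V) {x v : E}

theorem speed_exp (hM : IsMetricSpray G Γ V) (hx : x ∈ Metric.ball x₀ D.ρ)
    (hv : v ∈ Metric.ball (0 : E) D.ρ) {t : ℝ} (ht : t ∈ Icc (0 : ℝ) 1) :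
    G (D.exp x (t • v)) (fderiv ℝ (D.exp x) (t • v) v) (fderiv ℝ (D.exp x) (t • v) v)
      = G x v v := by
  have h := hM.speed_const (D.isSpraySolution_exp hx hv)
    (fun t ht => D.exp_mem hx (D.smul_mem_ball hv ht)) ht
  simpa [D.exp_zero hx, D.fderiv_exp_zero hx] using h

/-- The Gauss lemma. -/
theorem gauss (hM : IsMetricSpray G Γ V) (hx : x ∈ Metric.ball x₀ D.ρ)
    (hv : v ∈ Metric.ball (0 : E) D.ρ) (w : E) :
    G (D.exp x v) (fderiv ℝ (D.exp x) v v) (fderiv ℝ (D.exp x) v w) = G x v w := by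
  have h0ρ : (0 : E) ∈ Metric.ball (0 : E) D.ρ := Metric.mem_ball_self D.ρ_pos
  have hxV : x ∈ V := by simpa [D.exp_zero hx] using D.exp_mem hx h0ρ
  set DE := fderiv ℝ (D.exp x) with hDE
  set D2 := fderiv ℝ DE with hD2
  -- First variation of the squared speed: the geodesics with initial velocity `v + s w` have
  -- squared speed `G x (v + s w) (v + s w)` at every time `t`. Both expressions are differentiated
  -- at `s = 0`.
  have hvar : ∀ t ∈ Icc (0 : ℝ) 1,
      fderiv ℝ G (D.exp x (t • v)) (DE (t • v) (t • w)) (DE (t • v) v) (DE (t • v) v)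
        + 2 * G (D.exp x (t • v)) (DE (t • v) v) (D2 (t • v) (t • w) v + DE (t • v) w)
        = 2 * G x v w := by
    intro t ht
    have htv := D.smul_mem_ball hv ht
    have hyV := D.exp_mem hx htv
    have hl : HasDerivAt (fun s : ℝ => v + s • w) w 0 := by
      simpa using ((hasDerivAt_id (0 : ℝ)).smul_const w).const_add v
    have hlt : HasDerivAt (fun s : ℝ => t • (v + s • w)) (t • w) 0 := hl.const_smul t
    have e0 : t • (v + (0 : ℝ) • w) = t • v := by simp
    have hc : HasDerivAt (fun s : ℝ => D.exp x (t • (v + s • w))) (DE (t • v) (t • w)) 0 :=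
      HasFDerivAt.comp_hasDerivAt (l := D.exp x) (f := fun s : ℝ => t • (v + s • w)) (0 : ℝ)
        (by rw [e0]; exact D.hasFDerivAt_exp hx htv) hlt
    have hA : HasDerivAt (fun s : ℝ => DE (t • (v + s • w))) (D2 (t • v) (t • w)) 0 :=
      HasFDerivAt.comp_hasDerivAt (f := fun s : ℝ => t • (v + s • w)) (0 : ℝ)
        (by rw [e0]; exact D.hasFDerivAt_fderiv_exp hx htv) hlt
    have ha : HasDerivAt (fun s : ℝ => DE (t • (v + s • w)) (v + s • w))
        (D2 (t • v) (t • w) v + DE (t • v) w) 0 := by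
      simpa using hA.clm_apply hl
    have hS := hasDerivWithinAt_bilin (s := univ) (G := G) (t := 0)
      (c := fun s : ℝ => D.exp x (t • (v + s • w)))
      (by simp only [e0]; exact hM.hasFDerivAt hyV) hc.hasDerivWithinAt
      ha.hasDerivWithinAt ha.hasDerivWithinAt
    have hS' : HasDerivWithinAt (fun s : ℝ => G x (v + s • w) (v + s • w))
        (G x w v + G x v w) univ 0 := by
      have h := ((hasDerivAt_const (0 : ℝ) (G x)).clm_apply hl).clm_apply hl
      have h' : HasDerivAt (fun s : ℝ => G x (v + s • w) (v + s • w)) (G x w v + G x v w) 0 := by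
        simpa using h
      exact h'.hasDerivWithinAt
    have hev : (fun s : ℝ => G x (v + s • w) (v + s • w)) =ᶠ[𝓝 0]
        fun s => G (D.exp x (t • (v + s • w))) (DE (t • (v + s • w)) (v + s • w))
          (DE (t • (v + s • w)) (v + s • w)) := by
      have : ∀ᶠ s in 𝓝 (0 : ℝ), v + s • w ∈ Metric.ball (0 : E) D.ρ :=
        hl.continuousAt.eventually (by
          simp only [zero_smul, add_zero]; exact Metric.isOpen_ball.mem_nhds hv)
      filter_upwards [this] with s hs
      exact (hM.speed_exp D hx hs ht).symm
    rw [hasDerivWithinAt_univ] at hS hS'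
    have := (hS.congr_of_eventuallyEq hev).unique hS'
    simp only [zero_smul, add_zero] at this
    rw [hM.symm _ hyV (D2 (t • v) (t • w) v + DE (t • v) w), hM.symm x hxV w v] at this
    linarith
  -- The pairing of the geodesic velocity with the variation field `J(t) = D exp (t v) (t w)` grows
  -- at rate `G x v w` and starts at `0`; its value at `t = 1` is the claim.
  have hf : ∀ t ∈ Icc (0 : ℝ) 1, HasDerivWithinAt
      (fun t : ℝ => G (D.exp x (t • v)) (DE (t • v) v) (DE (t • v) (t • w)) - t * G x v w)
      0 (Icc 0 1) t := by
    intro t ht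
    have htv := D.smul_mem_ball hv ht
    have hyV := D.exp_mem hx htv
    have hJ : HasDerivAt (fun t : ℝ => DE (t • v) (t • w))
        (D2 (t • v) v (t • w) + DE (t • v) w) t :=
      (D.hasDerivAt_fderiv_exp_smul hx hv ht).clm_apply (SprayChart.hasDerivAt_smul w t)
    have hsol := D.isSpraySolution_exp hx hv t ht
    have h1 := hasDerivWithinAt_bilin (hM.hasFDerivAt hyV) hsol.1 hsol.2 hJ.hasDerivWithinAt
    have h2 : HasDerivWithinAt (fun t : ℝ => t * G x v w) (G x v w) (Icc 0 1) t := by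
      simpa using (hasDerivWithinAt_id t (Icc 0 1)).mul_const (G x v w)
    refine (h1.sub h2).congr_deriv ?_
    -- Equality of mixed derivatives identifies the time derivative of `J` with the variation of the
    -- velocity occurring in `hvar`.
    have hsym : D2 (t • v) v (t • w) = D2 (t • v) (t • w) v := by
      have : IsSymmSndFDerivAt ℝ (D.exp x) (t • v) :=
        ((D.contDiffOn_exp hx).contDiffAt (Metric.isOpen_ball.mem_nhds htv)).isSymmSndFDerivAt
          (by simpa using WithTop.coe_le_coe.2 (le_top : (2 : ℕ∞) ≤ ⊤))
      exact this _ _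
    have hv' := hvar t ht
    rw [hsym]
    simp only [map_neg, neg_apply, hM.christoffel _ hyV, christoffelForm_apply] at hv' ⊢
    linarith
  have hconst := constant_of_derivWithin_zero (fun t ht => (hf t ht).differentiableWithinAt)
    (fun t ht => (hf t ⟨ht.1, ht.2.le⟩).derivWithin
      (uniqueDiffOn_Icc zero_lt_one t ⟨ht.1, ht.2.le⟩)) 1 (right_mem_Icc.2 zero_le_one)
  simp only [one_smul, zero_smul, one_mul, zero_mul, map_zero, sub_zero] at hconst
  linarith

end IsMetricSpray

end Gauss

/-! ### Linear equations with small coefficients. -/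

section LinearODE

variable {E : Type} [NormedAddCommGroup E] [NormedSpace ℝ E]

/-- The propagator of a linear equation with small coefficients exists on `[0, 1]` and is close to
the identity. -/
theorem exists_propagator [CompleteSpace E] {A : ℝ → E →L[ℝ] E} {ε : ℝ} (hε : ε ≤ 1 / 2)
    (hA : ContinuousOn A (Icc 0 1)) (hAε : ∀ t ∈ Icc (0 : ℝ) 1, ‖A t‖ ≤ ε) :
    ∃ P : ℝ → E →L[ℝ] E, P 0 = ContinuousLinearMap.id ℝ E ∧
      (∀ t ∈ Icc (0 : ℝ) 1, HasDerivWithinAt P ((A t).comp (P t)) (Icc 0 1) t) ∧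
      ‖P 1 - ContinuousLinearMap.id ℝ E‖ ≤ 2 * ε := by
  have hε0 : 0 ≤ ε := (norm_nonneg _).trans (hAε 0 (left_mem_Icc.2 zero_le_one))
  set I := ContinuousLinearMap.id ℝ E
  have hI : ‖I‖ ≤ 1 := ContinuousLinearMap.norm_id_le
  -- On the unit ball around the identity `‖P‖ ≤ 2`, so `‖A t‖ ≤ 1/2` bounds the right-hand side by
  -- `1`. Solutions therefore exist for the whole unit time.
  have hPL : IsPicardLindelof (fun t (P : E →L[ℝ] E) => (A t).comp P)
      (⟨0, left_mem_Icc.2 zero_le_one⟩ : Icc (0 : ℝ) 1) I 1 0 1 1 := by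
    refine ⟨fun t ht => ?_, fun P _ => ?_, fun t ht P hP => ?_, ?_⟩
    · refine LipschitzOnWith.of_dist_le_mul fun P _ Q _ => ?_
      rw [dist_eq_norm, dist_eq_norm, ← ContinuousLinearMap.comp_sub]
      refine (ContinuousLinearMap.opNorm_comp_le _ _).trans ?_
      exact mul_le_mul_of_nonneg_right ((hAε t ht).trans (hε.trans (by norm_num))) (norm_nonneg _)
    · exact hA.clm_comp continuousOn_const
    · have h1 : ‖P‖ ≤ 2 := by
        have h2 : ‖P - I‖ ≤ 1 := by simpa [dist_eq_norm] using hP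
        calc ‖P‖ = ‖(P - I) + I‖ := by simp
          _ ≤ _ := (norm_add_le _ _).trans (by linarith)
      calc ‖(A t).comp P‖ ≤ ‖A t‖ * ‖P‖ := ContinuousLinearMap.opNorm_comp_le _ _
        _ ≤ 1 / 2 * 2 := mul_le_mul ((hAε t ht).trans hε) h1 (norm_nonneg _) (by norm_num)
        _ = ((1 : ℝ≥0) : ℝ) := by norm_num
    · simp
  obtain ⟨P, hP0, hP⟩ := hPL.exists_eq_forall_mem_Icc_hasDerivWithinAt₀
  refine ⟨P, hP0, hP, ?_⟩
  -- `P - I` satisfies `f' = A f + A`. With constant `K = 1`, Grönwall gives `ε (e - 1) ≤ 2 ε`.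
  have hg := norm_le_gronwallBound_of_norm_deriv_right_le (f := fun t => P t - I)
    (f' := fun t => (A t).comp (P t)) (δ := 0) (K := 1) (ε := ε) (a := 0) (b := 1)
    (fun t ht => ((hP t ht).continuousWithinAt.sub continuousWithinAt_const))
    (fun t ht => (HasDerivWithinAt.Ici_of_Icc_zero_one ht (hP t ⟨ht.1, ht.2.le⟩)).sub_const I)
    (by simpa using hP0 ▸ (by simp))
    (fun t ht => by
      have h1 : (A t).comp (P t) = (A t).comp (P t - I) + A t := by
        ext; simp [I]
      rw [h1]
      refine (norm_add_le _ _).trans (add_le_add ?_ (hAε t ⟨ht.1, ht.2.le⟩))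
      exact (ContinuousLinearMap.opNorm_comp_le _ _).trans (mul_le_mul_of_nonneg_right
        ((hAε t ⟨ht.1, ht.2.le⟩).trans (hε.trans (by norm_num))) (norm_nonneg _)))
    1 (right_mem_Icc.2 zero_le_one)
  refine hg.trans ?_
  rw [gronwallBound_of_K_ne_0 one_ne_zero]
  have := Real.exp_one_lt_d9
  norm_num
  nlinarith

theorem linear_solution_unique {A : ℝ → E →L[ℝ] E} (hA : ContinuousOn A (Icc 0 1))
    {f g : ℝ → E} (hf : ∀ t ∈ Icc (0 : ℝ) 1, HasDerivWithinAt f (A t (f t)) (Icc 0 1) t)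
    (hg : ∀ t ∈ Icc (0 : ℝ) 1, HasDerivWithinAt g (A t (g t)) (Icc 0 1) t) (h0 : f 0 = g 0) :
    EqOn f g (Icc 0 1) := by
  obtain ⟨R, hR⟩ := isCompact_Icc.exists_bound_of_continuousOn hA
  refine ODE_solution_unique_of_mem_Icc_right (v := fun t => A t) (K := R.toNNReal)
    (s := fun _ => univ) (fun t ht => ?_)
    (fun t ht => (hf t ht).continuousWithinAt)
    (fun t ht => HasDerivWithinAt.Ici_of_Icc_zero_one ht (hf t ⟨ht.1, ht.2.le⟩))
    (fun _ _ => mem_univ _)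
    (fun t ht => (hg t ht).continuousWithinAt)
    (fun t ht => HasDerivWithinAt.Ici_of_Icc_zero_one ht (hg t ⟨ht.1, ht.2.le⟩))
    (fun _ _ => mem_univ _) h0
  refine ((A t).lipschitz.weaken ?_).lipschitzOnWith
  have := hR t ⟨ht.1, ht.2.le⟩
  exact NNReal.le_toNNReal_of_coe_le this

end LinearODE

/-! ### Positive definite forms. -/

section Forms

variable {E : Type} [NormedAddCommGroup E] [NormedSpace ℝ E]

/-- Evaluating the form on `B w w • v - B v w • w` gives `B w w` times `B v v * B w w - (B v w)²`.
-/
theorem bilin_cauchy_schwarz {B : E →L[ℝ] E →L[ℝ] ℝ} (hs : ∀ v w, B v w = B w v)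
    (hpos : ∀ v, v ≠ 0 → 0 < B v v) (v w : E) : |B v w| ≤ √(B v v) * √(B w w) := by
  rcases eq_or_ne w 0 with rfl | hw
  · simp
  have hw' := hpos w hw
  have hnn : ∀ v, 0 ≤ B v v := fun v => by
    rcases eq_or_ne v 0 with rfl | h
    · simp
    · exact (hpos v h).le
  have h := hnn (B w w • v - B v w • w)
  simp only [map_sub, map_smul, sub_apply, smul_apply, smul_eq_mul, hs w v] at h
  have h2 : B v w ^ 2 ≤ B v v * B w w := by
    have : 0 ≤ B w w * (B v v * B w w - B v w ^ 2) := by nlinarith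
    have := nonneg_of_mul_nonneg_right this hw'
    linarith
  rw [← Real.sqrt_mul (hnn v), ← Real.sqrt_sq_eq_abs]
  exact Real.sqrt_le_sqrt h2

/-- A quadratic function depending continuously on a parameter is uniformly positive definite near
a parameter where it is positive definite. -/
theorem eventually_quadratic_ge [FiniteDimensional ℝ E] {X : Type*} [TopologicalSpace X]
    {Q : X → E → ℝ} {x₀ : X}
    (hc : ∀ v, ContinuousAt (fun z : X × E => Q z.1 z.2) (x₀, v))
    (hQ : ∀ x v, ∀ r : ℝ, Q x (r • v) = r ^ 2 * Q x v) (hpos : ∀ v, v ≠ 0 → 0 < Q x₀ v) :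
    ∃ κ > 0, ∀ᶠ x in 𝓝 x₀, ∀ v, κ * ‖v‖ ^ 2 ≤ Q x v := by
  have hK : IsCompact (Metric.sphere (0 : E) 1) := isCompact_sphere _ _
  have hc0 : ContinuousOn (Q x₀) (Metric.sphere (0 : E) 1) := fun v _ =>
    (ContinuousAt.comp (f := fun v => (x₀, v)) (hc v)
      (by fun_prop : ContinuousAt (fun v : E => (x₀, v)) v)).continuousWithinAt
  have hne : ∀ v ∈ Metric.sphere (0 : E) 1, v ≠ 0 := fun v hv h => by simp [h] at hv
  obtain ⟨κ, hκ, hκQ⟩ : ∃ κ > 0, ∀ v ∈ Metric.sphere (0 : E) 1, κ < Q x₀ v := by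
    rcases (Metric.sphere (0 : E) 1).eq_empty_or_nonempty with h | h
    · exact ⟨1, one_pos, by simp [h]⟩
    · obtain ⟨v, hv, hmin⟩ := hK.exists_isMinOn h hc0
      have := hpos v (hne v hv)
      exact ⟨Q x₀ v / 2, by positivity, fun w hw => by
        have : Q x₀ v ≤ Q x₀ w := hmin hw
        linarith⟩
  refine ⟨κ, hκ, ?_⟩
  -- Tube lemma over the compact unit sphere; homogeneity then covers all vectors.
  have := hK.eventually_forall_of_forall_eventually (x₀ := x₀) (P := fun x v => κ < Q x v)
    (fun v hv => (hc v).eventually (lt_mem_nhds (hκQ v hv)))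
  filter_upwards [this] with x hx v
  rcases eq_or_ne v 0 with rfl | hv
  · have := hQ x 0 0
    simp at this
    simp [this]
  · have hn : 0 < ‖v‖ := norm_pos_iff.2 hv
    have h1 := hx (‖v‖⁻¹ • v) (by simp [norm_smul, hn.ne'])
    rw [hQ] at h1
    have h2 : Q x v = ‖v‖ ^ 2 * (‖v‖⁻¹ ^ 2 * Q x v) := by
      field_simp
    rw [h2, mul_comm]
    exact mul_le_mul_of_nonneg_left h1.le (by positivity)

end Forms

/-! ### Radial distance and lengths of curves. -/

section Radial

variable {E : Type} [NormedAddCommGroup E] [NormedSpace ℝ E]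
  {G : E → E →L[ℝ] E →L[ℝ] ℝ} {Γ : E → E →L[ℝ] E →L[ℝ] E} {V : Set E} {x₀ : E}

namespace SprayChart

variable (D : SprayChart Γ x₀ V) {x y v : E}

theorem hasFDerivAt_log (h : (x, y) ∈ D.Θ.target) :
    HasFDerivAt (D.log x) (fderiv ℝ (D.log x) y) y :=
  (((D.contDiffOn_log x).contDiffAt ((D.isOpen_log_domain x).mem_nhds h)).differentiableAt
    (by simp)).hasFDerivAt

theorem hasFDerivAt_fderiv_log (h : (x, y) ∈ D.Θ.target) :
    HasFDerivAt (fderiv ℝ (D.log x)) (fderiv ℝ (fderiv ℝ (D.log x)) y) y := by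
  have h1 := (D.contDiffOn_log x).fderiv_of_isOpen (D.isOpen_log_domain x) (m := ∞) (by simp)
  exact ((h1.contDiffAt ((D.isOpen_log_domain x).mem_nhds h)).differentiableAt
    (by simp)).hasFDerivAt

theorem continuousAt_fderiv_fderiv_log (h : (x, y) ∈ D.Θ.target) :
    ContinuousAt (fderiv ℝ (fderiv ℝ (D.log x))) y := by
  have h1 := (D.contDiffOn_log x).fderiv_of_isOpen (D.isOpen_log_domain x) (m := ∞) (by simp)
  have h2 := h1.fderiv_of_isOpen (D.isOpen_log_domain x) (m := ∞) (by simp)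
  exact (h2.contDiffAt ((D.isOpen_log_domain x).mem_nhds h)).continuousAt

theorem fderiv_exp_fderiv_log (h : (x, y) ∈ D.Θ.target) (ξ : E) :
    fderiv ℝ (D.exp x) (D.log x y) (fderiv ℝ (D.log x) y ξ) = ξ := by
  obtain ⟨hx, hl⟩ := D.mem_ball_of_mem_target h
  have h1 := (D.hasFDerivAt_exp hx hl).comp y (D.hasFDerivAt_log h)
  have h2 : D.exp x ∘ D.log x =ᶠ[𝓝 y] id := by
    filter_upwards [(D.isOpen_log_domain x).mem_nhds h] with z hz using D.exp_log hz
  exact DFunLike.congr_fun (h1.unique ((hasFDerivAt_id y).congr_of_eventuallyEq h2)) ξ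

theorem self_mem_target (hx : x ∈ Metric.ball x₀ D.ρ) : (x, x) ∈ D.Θ.target := by
  have := D.mem_target hx (Metric.mem_ball_self D.ρ_pos)
  rwa [D.exp_zero hx] at this

theorem log_self (hx : x ∈ Metric.ball x₀ D.ρ) : D.log x x = 0 := by
  have := D.log_exp hx (Metric.mem_ball_self D.ρ_pos)
  rwa [D.exp_zero hx] at this

theorem fderiv_log_self (hx : x ∈ Metric.ball x₀ D.ρ) (ξ : E) :
    fderiv ℝ (D.log x) x ξ = ξ := by
  have := D.fderiv_exp_fderiv_log (D.self_mem_target hx) ξ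
  rwa [D.log_self hx, D.fderiv_exp_zero hx] at this

end SprayChart

namespace IsMetricSpray

variable (D : SprayChart Γ x₀ V) {x y v : E}

theorem mem_of_mem_ball (hx : x ∈ Metric.ball x₀ D.ρ) : x ∈ V := by
  have := D.exp_mem hx (Metric.mem_ball_self D.ρ_pos)
  rwa [D.exp_zero hx] at this

theorem mem_of_mem_target (h : (x, y) ∈ D.Θ.target) : y ∈ V := by
  obtain ⟨hx, hl⟩ := D.mem_ball_of_mem_target h
  have := D.exp_mem hx hl
  rwa [D.exp_log h] at this

/-- The radial distance from `x` is 1-Lipschitz in infinitesimal form. -/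
theorem abs_metric_log_le (hM : IsMetricSpray G Γ V) (h : (x, y) ∈ D.Θ.target) (ξ : E) :
    |G x (D.log x y) (fderiv ℝ (D.log x) y ξ)| ≤
      √(G x (D.log x y) (D.log x y)) * √(G y ξ ξ) := by
  obtain ⟨hx, hl⟩ := D.mem_ball_of_mem_target h
  have hy := mem_of_mem_target D h
  -- The Gauss lemma turns the pairing at `x` into the pairing at `y` of `ξ` with the radial
  -- velocity, and shows that this velocity has the norm of `log`. Cauchy–Schwarz at `y` finishes.
  have h1 := hM.gauss D hx hl (fderiv ℝ (D.log x) y ξ)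
  have h2 := hM.gauss D hx hl (D.log x y)
  rw [D.exp_log h] at h1 h2
  rw [D.fderiv_exp_fderiv_log h] at h1
  rw [← h1, ← h2]
  exact bilin_cauchy_schwarz (hM.symm y hy) (hM.pos y hy) _ _

/-- A curve starting at `x` is at least as long as the radial distance it covers. -/
theorem ofReal_sqrt_metric_log_le (hM : IsMetricSpray G Γ V) {c : ℝ → E} {a b : ℝ} (hab : a ≤ b)
    (hc : ContDiffOn ℝ 1 c (Icc a b)) (ha : c a = x) (hx : x ∈ Metric.ball x₀ D.ρ)
    (hT : ∀ t ∈ Icc a b, (x, c t) ∈ D.Θ.target) :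
    ENNReal.ofReal (√(G x (D.log x (c b)) (D.log x (c b)))) ≤
      ∫⁻ t in Icc a b, ENNReal.ofReal
        (√(G (c t) (derivWithin c (Icc a b) t) (derivWithin c (Icc a b) t))) := by
  rcases hab.eq_or_lt with rfl | hab'
  · simp [ha, D.log_self hx]
  have hxV := mem_of_mem_ball D hx
  have key : ∀ ε : ℝ, 0 < ε → ENNReal.ofReal (√(G x (D.log x (c b)) (D.log x (c b))) - ε) ≤
      ∫⁻ t in Icc a b, ENNReal.ofReal
        (√(G (c t) (derivWithin c (Icc a b) t) (derivWithin c (Icc a b) t))) := by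
    intro ε hε
    -- The radial distance `√φ` need not be differentiable where `φ = 0`, in particular at the
    -- starting point. Using `√(φ + ε²)` costs at most `ε` in the estimate.
    set φ : ℝ → ℝ := fun t => G x (D.log x (c t)) (D.log x (c t)) with hφ
    have hφ0 : ∀ t, 0 ≤ φ t := fun t => hM.nonneg hxV _
    have hφp : ∀ t, 0 < φ t + ε ^ 2 := fun t => by have := hφ0 t; positivity
    have hl : ContDiffOn ℝ 1 (fun t => D.log x (c t)) (Icc a b) :=
      ((D.contDiffOn_log x).of_le (by simp)).comp hc hT
    have hφs : ContDiffOn ℝ 1 φ (Icc a b) := (contDiffOn_const.clm_apply hl).clm_apply hl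
    have hf : ContDiffOn ℝ 1 (fun t => √(φ t + ε ^ 2)) (Icc a b) :=
      (hφs.add contDiffOn_const).sqrt fun t _ => (hφp t).ne'
    have h1 := enorm_sub_le_lintegral_derivWithin_Icc_of_contDiffOn_Icc hf hab
    have hb : √(φ b) - ε ≤ √(φ b + ε ^ 2) - √(φ a + ε ^ 2) := by
      have e1 : φ a = 0 := by simp [hφ, ha, D.log_self hx]
      rw [e1, zero_add, Real.sqrt_sq hε.le]
      have : √(φ b) ≤ √(φ b + ε ^ 2) := Real.sqrt_le_sqrt (by nlinarith)
      linarith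
    refine (ENNReal.ofReal_le_ofReal (hb.trans (le_abs_self _))).trans ?_
    rw [← Real.norm_eq_abs, ofReal_norm]
    refine h1.trans (MeasureTheory.setLIntegral_mono' measurableSet_Icc fun t ht => ?_)
    rw [← ofReal_norm]
    refine ENNReal.ofReal_le_ofReal ?_
    have hct := ((hc t ht).differentiableWithinAt one_ne_zero).hasDerivWithinAt
    set c' := derivWithin c (Icc a b) t
    have hlt : HasDerivWithinAt (fun t => D.log x (c t)) (fderiv ℝ (D.log x) (c t) c')
        (Icc a b) t := (D.hasFDerivAt_log (hT t ht)).comp_hasDerivWithinAt t hct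
    have hφt : HasDerivWithinAt φ (2 * G x (D.log x (c t)) (fderiv ℝ (D.log x) (c t) c'))
        (Icc a b) t := by
      have := ((hasDerivWithinAt_const t (Icc a b) (G x)).clm_apply hlt).clm_apply hlt
      refine this.congr_deriv ?_
      rw [hM.symm x hxV (D.log x (c t))]
      simp
      ring
    have hd := ((hφt.add_const (ε ^ 2)).sqrt (hφp t).ne').derivWithin
      (uniqueDiffOn_Icc hab' t ht)
    rw [hd, mul_div_mul_left _ _ (two_ne_zero' ℝ), Real.norm_eq_abs, abs_div,
      abs_of_pos (Real.sqrt_pos.2 (hφp t)), div_le_iff₀ (Real.sqrt_pos.2 (hφp t)),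
      mul_comm (√(G (c t) c' c'))]
    refine (hM.abs_metric_log_le D (hT t ht) c').trans
      (mul_le_mul_of_nonneg_right (Real.sqrt_le_sqrt ?_) (Real.sqrt_nonneg _))
    simp only [hφ]
    nlinarith
  refine le_of_forall_lt fun r hr => ?_
  obtain ⟨ε, hε, hrε⟩ : ∃ ε > 0, r < ENNReal.ofReal
      (√(G x (D.log x (c b)) (D.log x (c b))) - ε) := by
    have hcont : Tendsto (fun ε : ℝ => ENNReal.ofReal
        (√(G x (D.log x (c b)) (D.log x (c b))) - ε)) (𝓝[>] 0)
        (𝓝 (ENNReal.ofReal (√(G x (D.log x (c b)) (D.log x (c b))) - 0))) :=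
      ((ENNReal.continuous_ofReal.comp (continuous_const.sub continuous_id)).tendsto 0).mono_left
        nhdsWithin_le_nhds
    rw [sub_zero] at hcont
    obtain ⟨ε, h1, h2⟩ := ((hcont.eventually (lt_mem_nhds hr)).and self_mem_nhdsWithin).exists
    exact ⟨ε, h2, h1⟩
  exact hrε.trans_le (key ε hε)

end IsMetricSpray

end Radial

/-! ### Convexity of the squared distance. -/

section Convexity

variable {E : Type} [NormedAddCommGroup E] [NormedSpace ℝ E]
  {G : E → E →L[ℝ] E →L[ℝ] ℝ} {Γ : E → E →L[ℝ] E →L[ℝ] E} {V : Set E} {x₀ : E}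

/-- The second derivative of `G x₀ (log c) (log c)` along a geodesic `c`, as a quadratic function of
the velocity. -/
def radialHessian (G : E → E →L[ℝ] E →L[ℝ] ℝ) (D : SprayChart Γ x₀ V) (y ξ : E) : ℝ :=
  2 * (G x₀ (fderiv ℝ (D.log x₀) y ξ) (fderiv ℝ (D.log x₀) y ξ) +
    G x₀ (D.log x₀ y) (fderiv ℝ (fderiv ℝ (D.log x₀)) y ξ ξ -
      fderiv ℝ (D.log x₀) y (Γ y ξ ξ)))

namespace IsMetricSpray

theorem continuousAt (hM : IsMetricSpray G Γ V) {y : E} (hy : y ∈ V) : ContinuousAt G y :=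
  (hM.hasFDerivAt hy).continuousAt

theorem eventually_metric_ge [FiniteDimensional ℝ E] (hM : IsMetricSpray G Γ V) {y : E}
    (hy : y ∈ V) :
    ∃ κ > 0, ∀ᶠ z in 𝓝 y, ∀ v, κ * ‖v‖ ^ 2 ≤ G z v v := by
  refine eventually_quadratic_ge (Q := fun z v => G z v v) (fun v => ?_)
    (fun z v r => by simp; ring) (hM.pos y hy)
  have h1 : ContinuousAt (fun z : E × E => G z.1) (y, v) :=
    ContinuousAt.comp (f := Prod.fst) (hM.continuousAt hy) continuousAt_fst
  exact (h1.clm_apply continuousAt_snd).clm_apply continuousAt_snd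

theorem eventually_metric_le (hM : IsMetricSpray G Γ V) {y : E} (hy : y ∈ V) :
    ∃ C > 0, ∀ᶠ z in 𝓝 y, ∀ v, G z v v ≤ C * ‖v‖ ^ 2 := by
  refine ⟨‖G y‖ + 1, by positivity, ?_⟩
  have h := (hM.continuousAt hy).norm.eventually (gt_mem_nhds (lt_add_one ‖G y‖))
  filter_upwards [h] with z hz v
  calc G z v v ≤ ‖G z v v‖ := le_abs_self _
    _ ≤ ‖G z‖ * ‖v‖ * ‖v‖ := (G z).le_opNorm₂ v v
    _ ≤ (‖G y‖ + 1) * ‖v‖ ^ 2 := by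
      rw [mul_assoc, pow_two]
      exact mul_le_mul_of_nonneg_right hz.le (by positivity)

/-- At `x₀` itself `log` vanishes and has derivative the identity, so the Hessian is `2 G`. The
excess over `G` is positive definite there, hence nearby. -/
theorem eventually_metric_le_radialHessian [FiniteDimensional ℝ E] (hM : IsMetricSpray G Γ V)
    (hΓ : ContDiff ℝ ∞ Γ)
    (D : SprayChart Γ x₀ V) : ∀ᶠ y in 𝓝 x₀, ∀ ξ, G y ξ ξ ≤ radialHessian G D y ξ := by
  have hx₀ : x₀ ∈ Metric.ball x₀ D.ρ := Metric.mem_ball_self D.ρ_pos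
  have hT := D.self_mem_target hx₀
  have hV := mem_of_mem_ball D hx₀
  have hc : ∀ v, ContinuousAt (fun z : E × E => radialHessian G D z.1 z.2 - G z.1 z.2 z.2)
      (x₀, v) := by
    intro v
    have fst : ContinuousAt (Prod.fst : E × E → E) (x₀, v) := continuousAt_fst
    have snd : ContinuousAt (Prod.snd : E × E → E) (x₀, v) := continuousAt_snd
    have h1 : ContinuousAt (fun z : E × E => D.log x₀ z.1) (x₀, v) :=
      ContinuousAt.comp (g := D.log x₀) (f := Prod.fst) (D.hasFDerivAt_log hT).continuousAt fst
    have h2 : ContinuousAt (fun z : E × E => fderiv ℝ (D.log x₀) z.1) (x₀, v) :=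
      ContinuousAt.comp (f := Prod.fst) (D.hasFDerivAt_fderiv_log hT).continuousAt fst
    have h3 : ContinuousAt (fun z : E × E => fderiv ℝ (fderiv ℝ (D.log x₀)) z.1) (x₀, v) :=
      ContinuousAt.comp (f := Prod.fst) (D.continuousAt_fderiv_fderiv_log hT) fst
    have h4 : ContinuousAt (fun z : E × E => Γ z.1) (x₀, v) :=
      ContinuousAt.comp (f := Prod.fst) hΓ.continuous.continuousAt fst
    have h5 : ContinuousAt (fun z : E × E => G z.1) (x₀, v) :=
      ContinuousAt.comp (f := Prod.fst) (hM.continuousAt hV) fst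
    have c0 : ContinuousAt (fun _ : E × E => G x₀) (x₀, v) := continuousAt_const
    have h6 := h2.clm_apply snd
    refine ContinuousAt.sub (continuousAt_const.mul (ContinuousAt.add ?_ ?_))
      ((h5.clm_apply snd).clm_apply snd)
    · exact (c0.clm_apply h6).clm_apply h6
    · exact (c0.clm_apply h1).clm_apply (((h3.clm_apply snd).clm_apply snd).sub
        (h2.clm_apply ((h4.clm_apply snd).clm_apply snd)))
  have hh : ∀ y ξ, ∀ r : ℝ, radialHessian G D y (r • ξ) - G y (r • ξ) (r • ξ) =
      r ^ 2 * (radialHessian G D y ξ - G y ξ ξ) := by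
    intro y ξ r
    simp only [radialHessian, map_smul, smul_apply, smul_eq_mul, ← smul_sub]
    ring
  have hp : ∀ ξ, ξ ≠ 0 → 0 < radialHessian G D x₀ ξ - G x₀ ξ ξ := by
    intro ξ hξ
    have := hM.pos x₀ hV ξ hξ
    simp only [radialHessian, D.log_self hx₀, D.fderiv_log_self hx₀, map_zero, zero_apply]
    linarith
  obtain ⟨κ, hκ, h⟩ := eventually_quadratic_ge
    (Q := fun y ξ => radialHessian G D y ξ - G y ξ ξ) hc hh hp
  filter_upwards [h] with y hy ξ
  have := hy ξ
  have h2 : 0 ≤ κ * ‖ξ‖ ^ 2 := by positivity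
  linarith

/-- Strict convexity of the squared distance from `x₀` along geodesics near `x₀`. -/
theorem radial_convex (hM : IsMetricSpray G Γ V) (D : SprayChart Γ x₀ V) {c w : ℝ → E}
    (h : IsSpraySolution Γ c w)
    (hT : ∀ t ∈ Icc (0 : ℝ) 1, (x₀, c t) ∈ D.Θ.target)
    (hH : ∀ t ∈ Icc (0 : ℝ) 1, ∀ ξ, G (c t) ξ ξ ≤ radialHessian G D (c t) ξ)
    {t : ℝ} (ht : t ∈ Icc (0 : ℝ) 1) :
    G x₀ (D.log x₀ (c t)) (D.log x₀ (c t)) ≤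
      (1 - t) * G x₀ (D.log x₀ (c 0)) (D.log x₀ (c 0)) +
      t * G x₀ (D.log x₀ (c 1)) (D.log x₀ (c 1)) - G (c 0) (w 0) (w 0) * (t * (1 - t) / 2) := by
  have hV := mem_of_mem_ball D (Metric.mem_ball_self (x := x₀) D.ρ_pos)
  set s := G (c 0) (w 0) (w 0) with hs
  set l : ℝ → E := fun t => D.log x₀ (c t) with hl
  set l' : ℝ → E := fun t => fderiv ℝ (D.log x₀) (c t) (w t) with hl'
  have hld : ∀ t ∈ Icc (0 : ℝ) 1, HasDerivWithinAt l (l' t) (Icc 0 1) t := fun t ht =>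
    (D.hasFDerivAt_log (hT t ht)).comp_hasDerivWithinAt t (h t ht).1
  have hld' : ∀ t ∈ Icc (0 : ℝ) 1, HasDerivWithinAt l' (fderiv ℝ (fderiv ℝ (D.log x₀)) (c t) (w t)
      (w t) + fderiv ℝ (D.log x₀) (c t) (-Γ (c t) (w t) (w t))) (Icc 0 1) t := fun t ht =>
    ((D.hasFDerivAt_fderiv_log (hT t ht)).comp_hasDerivWithinAt t (h t ht).1).clm_apply (h t ht).2
  -- The squared speed `s` is constant, so the second derivative of `f` is `radialHessian - s ≥ 0`.
  -- Convexity of `f` yields the quadratic gain `s t (1 - t) / 2`.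
  set f : ℝ → ℝ := fun t => G x₀ (l t) (l t) - s * (t * t / 2) with hf
  set f' : ℝ → ℝ := fun t => 2 * G x₀ (l t) (l' t) - s * t with hf'
  have hfd : ∀ t ∈ Icc (0 : ℝ) 1, HasDerivWithinAt f (f' t) (Icc 0 1) t := by
    intro t ht
    have h1 := ((hasDerivWithinAt_const t (Icc (0 : ℝ) 1) (G x₀)).clm_apply
      (hld t ht)).clm_apply (hld t ht)
    have h2 : HasDerivWithinAt (fun t : ℝ => s * (t * t / 2)) (s * t) (Icc 0 1) t := by
      have := (((hasDerivWithinAt_id t (Icc (0 : ℝ) 1)).mul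
        (hasDerivWithinAt_id t (Icc (0 : ℝ) 1))).div_const 2).const_mul s
      refine this.congr_deriv ?_
      simp
    refine (h1.sub h2).congr_deriv ?_
    rw [hM.symm x₀ hV (l t) (l' t)]
    simp only [zero_apply, zero_add, hf', hM.symm x₀ hV (l t) (l' t)]
    ring
  have hfd' : ∀ t ∈ Icc (0 : ℝ) 1,
      HasDerivWithinAt f' (radialHessian G D (c t) (w t) - s) (Icc 0 1) t := by
    intro t ht
    have h1 := (((hasDerivWithinAt_const t (Icc (0 : ℝ) 1) (G x₀)).clm_apply
      (hld t ht)).clm_apply (hld' t ht)).const_mul 2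
    have h2 : HasDerivWithinAt (fun t : ℝ => s * t) s (Icc 0 1) t := by
      simpa using (hasDerivWithinAt_id t (Icc (0 : ℝ) 1)).const_mul s
    refine (h1.sub h2).congr_deriv ?_
    simp only [zero_apply, zero_add, radialHessian, map_neg, sub_eq_add_neg]
    rfl
  have hIcc : interior (Icc (0 : ℝ) 1) ⊆ Icc 0 1 := interior_subset
  have hconv : ConvexOn ℝ (Icc (0 : ℝ) 1) f :=
    convexOn_of_hasDerivWithinAt2_nonneg (convex_Icc 0 1)
      (fun t ht => (hfd t ht).continuousWithinAt)
      (fun t ht => (hfd t (hIcc ht)).mono hIcc) (fun t ht => (hfd' t (hIcc ht)).mono hIcc)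
      (fun t ht => by
        have h1 := hH t (hIcc ht) (w t)
        rw [hM.speed_const h (fun t ht => mem_of_mem_target D (hT t ht)) (hIcc ht)] at h1
        linarith)
  have h2 := hconv.2 (left_mem_Icc.2 zero_le_one) (right_mem_Icc.2 zero_le_one)
    (sub_nonneg.2 ht.2) ht.1 (by ring)
  simp only [smul_eq_mul, mul_zero, mul_one, zero_add, hf] at h2
  linarith

end IsMetricSpray

end Convexity

/-! ### The metric in manifold charts. -/

section ChartCalculus

variable {m : ℕ} {M : Type*} [EMetricSpace M] [ChartedSpace (EuclideanSpace ℝ (Fin m)) M]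

/-- The differential of the chart at `p₀`. -/
def chartD (p₀ x : M) : TangentSpace (𝓡 m) x →L[ℝ] EuclideanSpace ℝ (Fin m) :=
  mfderiv (𝓡 m) 𝓘(ℝ, EuclideanSpace ℝ (Fin m)) (extChartAt (𝓡 m) p₀) x

/-- The differential of the inverse of the chart at `p₀`. -/
def chartDSymm (p₀ : M) (y : EuclideanSpace ℝ (Fin m)) :
    EuclideanSpace ℝ (Fin m) →L[ℝ] TangentSpace (𝓡 m) ((extChartAt (𝓡 m) p₀).symm y) :=
  mfderiv 𝓘(ℝ, EuclideanSpace ℝ (Fin m)) (𝓡 m) (extChartAt (𝓡 m) p₀).symm y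

theorem isOpen_target (p₀ : M) : IsOpen (extChartAt (𝓡 m) p₀).target := isOpen_extChartAt_target p₀

theorem isOpen_source (p₀ : M) : IsOpen (extChartAt (𝓡 m) p₀).source := isOpen_extChartAt_source p₀

variable [IsManifold (𝓡 m) ∞ M]

theorem mdifferentiableAt_symm {p₀ : M} {y : EuclideanSpace ℝ (Fin m)}
    (hy : y ∈ (extChartAt (𝓡 m) p₀).target) :
    MDifferentiableAt 𝓘(ℝ, EuclideanSpace ℝ (Fin m)) (𝓡 m) (extChartAt (𝓡 m) p₀).symm y := by
  have h := mdifferentiableWithinAt_extChartAt_symm (I := 𝓡 m) hy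
  exact h.mdifferentiableAt (by simp)

theorem chartD_chartDSymm {p₀ : M} {y : EuclideanSpace ℝ (Fin m)}
    (hy : y ∈ (extChartAt (𝓡 m) p₀).target) (v : EuclideanSpace ℝ (Fin m)) :
    chartD p₀ ((extChartAt (𝓡 m) p₀).symm y) (chartDSymm p₀ y v) = v := by
  have h := mfderiv_extChartAt_comp_mfderivWithin_extChartAt_symm (I := 𝓡 m) hy
  simp only [modelWithCornersSelf_coe, range_id, mfderivWithin_univ] at h
  exact DFunLike.congr_fun h v

theorem chartDSymm_chartD {p₀ : M} {y : EuclideanSpace ℝ (Fin m)}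
    (hy : y ∈ (extChartAt (𝓡 m) p₀).target)
    (v : TangentSpace (𝓡 m) ((extChartAt (𝓡 m) p₀).symm y)) :
    chartDSymm p₀ y (chartD p₀ ((extChartAt (𝓡 m) p₀).symm y) v) = v := by
  have h := mfderivWithin_extChartAt_symm_comp_mfderiv_extChartAt (I := 𝓡 m) hy
  simp only [modelWithCornersSelf_coe, range_id, mfderivWithin_univ] at h
  exact DFunLike.congr_fun h v

variable [RiemannianBundle (fun x : M => TangentSpace (𝓡 m) x)]

/-- `chartMetric` as a continuous bilinear form. -/
def metricForm (p₀ : M) (y : EuclideanSpace ℝ (Fin m)) :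
    EuclideanSpace ℝ (Fin m) →L[ℝ] EuclideanSpace ℝ (Fin m) →L[ℝ] ℝ :=
  (innerSL ℝ).bilinearComp (chartDSymm p₀ y) (chartDSymm p₀ y)

theorem metricForm_apply (p₀ : M) (y v w : EuclideanSpace ℝ (Fin m)) :
    metricForm p₀ y v w = chartMetric p₀ y v w := rfl

theorem inner_eq_metricForm {p₀ x : M} (hx : x ∈ (extChartAt (𝓡 m) p₀).source)
    (u v : TangentSpace (𝓡 m) x) :
    inner ℝ u v = metricForm p₀ (extChartAt (𝓡 m) p₀ x) (chartD p₀ x u) (chartD p₀ x v) := by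
  obtain ⟨y, hy, rfl⟩ : ∃ y ∈ (extChartAt (𝓡 m) p₀).target, (extChartAt (𝓡 m) p₀).symm y = x :=
    ⟨_, (extChartAt (𝓡 m) p₀).map_source hx, (extChartAt (𝓡 m) p₀).left_inv hx⟩
  rw [(extChartAt (𝓡 m) p₀).right_inv hy]
  change _ = inner ℝ (chartDSymm p₀ y _) (chartDSymm p₀ y _)
  rw [chartDSymm_chartD hy, chartDSymm_chartD hy]

theorem metricForm_symm (p₀ : M) (y v w : EuclideanSpace ℝ (Fin m)) :
    metricForm p₀ y v w = metricForm p₀ y w v := by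
  change inner ℝ (chartDSymm p₀ y v) (chartDSymm p₀ y w) =
    inner ℝ (chartDSymm p₀ y w) (chartDSymm p₀ y v)
  exact real_inner_comm _ _

theorem metricForm_pos {p₀ : M} {y : EuclideanSpace ℝ (Fin m)}
    (hy : y ∈ (extChartAt (𝓡 m) p₀).target) {v : EuclideanSpace ℝ (Fin m)} (hv : v ≠ 0) :
    0 < metricForm p₀ y v v := by
  change 0 < inner ℝ (chartDSymm p₀ y v) (chartDSymm p₀ y v)
  refine real_inner_self_pos.2 fun h' => hv ?_
  rw [← chartD_chartDSymm hy v, h', map_zero]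

/-- Coordinate vector fields are smooth sections, being images of constant fields under the tangent
map of the inverse chart. The entries of the form are their inner products. -/
theorem contDiffOn_metricForm [IsContMDiffRiemannianBundle (𝓡 m) ∞ (EuclideanSpace ℝ (Fin m))
      (fun x : M => TangentSpace (𝓡 m) x)] (p₀ : M) :
    ContDiffOn ℝ ∞ (metricForm p₀) (extChartAt (𝓡 m) p₀).target := by
  have hsec : ∀ v : EuclideanSpace ℝ (Fin m), ContMDiffOn 𝓘(ℝ, EuclideanSpace ℝ (Fin m))
      (𝓡 m).tangent ∞ (fun y => (⟨(extChartAt (𝓡 m) p₀).symm y, chartDSymm p₀ y v⟩ :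
        TangentBundle (𝓡 m) M)) (extChartAt (𝓡 m) p₀).target := by
    intro v
    have h1 : ContMDiffOn 𝓘(ℝ, EuclideanSpace ℝ (Fin m)) (𝓡 m) ∞ (extChartAt (𝓡 m) p₀).symm
      (extChartAt (𝓡 m) p₀).target := contMDiffOn_extChartAt_symm p₀
    have h2 := h1.contMDiffOn_tangentMapWithin (m := ∞) (by simp)
      (isOpen_target p₀).uniqueMDiffOn
    have h3 : ContMDiffOn 𝓘(ℝ, EuclideanSpace ℝ (Fin m))
        (𝓘(ℝ, EuclideanSpace ℝ (Fin m))).tangent ∞ (fun y => (⟨y, v⟩ :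
          TangentBundle 𝓘(ℝ, EuclideanSpace ℝ (Fin m)) (EuclideanSpace ℝ (Fin m))))
        (extChartAt (𝓡 m) p₀).target :=
      contMDiffOn_vectorSpace_iff_contDiffOn.2 contDiffOn_const
    have h4 := h2.comp h3 (fun y hy => hy)
    refine h4.congr fun y hy => ?_
    simp only [Function.comp_apply, tangentMapWithin, chartDSymm]
    rw [mfderivWithin_of_isOpen (isOpen_target p₀) hy]
    rfl
  refine contDiffOn_clm_apply.2 fun v => contDiffOn_clm_apply.2 fun w => ?_
  rw [← contMDiffOn_iff_contDiffOn]
  exact (hsec v).inner_bundle (hsec w)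

end ChartCalculus

/-! ### Change of charts for Christoffel symbols and parallel fields. -/

section Transform

variable {E : Type} [NormedAddCommGroup E] [NormedSpace ℝ E]

/-- Transformation law of the Christoffel symbols of the first kind. -/
theorem christoffelForm_transform {G₀ G₁ : E → E →L[ℝ] E →L[ℝ] ℝ} {τ : E → E} {y : E}
    (hτ : ContDiffAt ℝ ∞ τ y) (hG₀ : DifferentiableAt ℝ G₀ y) (hG₁ : DifferentiableAt ℝ G₁ (τ y))
    (hsymm : ∀ v w, G₁ (τ y) v w = G₁ (τ y) w v)
    (h : ∀ᶠ y' in 𝓝 y, ∀ v w, G₀ y' v w = G₁ (τ y') (fderiv ℝ τ y' v) (fderiv ℝ τ y' w))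
    (u v z : E) :
    christoffelForm G₀ y u v z =
      christoffelForm G₁ (τ y) (fderiv ℝ τ y u) (fderiv ℝ τ y v) (fderiv ℝ τ y z) +
        G₁ (τ y) (fderiv ℝ (fderiv ℝ τ) y u v) (fderiv ℝ τ y z) := by
  have hτd : HasFDerivAt τ (fderiv ℝ τ y) y := (hτ.differentiableAt (by simp)).hasFDerivAt
  have hDτ : HasFDerivAt (fderiv ℝ τ) (fderiv ℝ (fderiv ℝ τ) y) y :=
    ((hτ.fderiv_right (m := ∞) (by simp)).differentiableAt (by simp)).hasFDerivAt
  have hD2 : ∀ a b, fderiv ℝ (fderiv ℝ τ) y a b = fderiv ℝ (fderiv ℝ τ) y b a := fun a b =>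
    (hτ.isSymmSndFDerivAt (by simpa using WithTop.coe_le_coe.2 (le_top : (2 : ℕ∞) ≤ ⊤))).eq a b
  have key : ∀ a v w, fderiv ℝ G₀ y a v w =
      fderiv ℝ G₁ (τ y) (fderiv ℝ τ y a) (fderiv ℝ τ y v) (fderiv ℝ τ y w) +
        G₁ (τ y) (fderiv ℝ (fderiv ℝ τ) y a v) (fderiv ℝ τ y w) +
        G₁ (τ y) (fderiv ℝ τ y v) (fderiv ℝ (fderiv ℝ τ) y a w) := by
    intro a v w
    have h1 := (hG₀.hasFDerivAt.clm_apply (hasFDerivAt_const v y)).clm_apply (hasFDerivAt_const w y)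
    have h2 := ((HasFDerivAt.comp y hG₁.hasFDerivAt hτd).clm_apply
      (hDτ.clm_apply (hasFDerivAt_const v y))).clm_apply (hDτ.clm_apply (hasFDerivAt_const w y))
    have h3 := h1.unique (h2.congr_of_eventuallyEq (h.mono fun y' hy' => hy' v w))
    have h4 := DFunLike.congr_fun h3 a
    simp at h4
    rw [h4]
    ring
  -- Of the six terms containing second derivatives of `τ`, symmetry cancels four and makes the
  -- other two equal.
  simp only [christoffelForm_apply, key]
  rw [hD2 v u, hD2 z u, hD2 z v, hsymm (fderiv ℝ (fderiv ℝ τ) y u z)]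
  ring

end Transform

section Charts

variable {m : ℕ} {M : Type*} [EMetricSpace M] [ChartedSpace (EuclideanSpace ℝ (Fin m)) M]
  [IsManifold (𝓡 m) ∞ M]

theorem mdifferentiableAt_chart {p₀ x : M} (hx : x ∈ (extChartAt (𝓡 m) p₀).source) :
    MDifferentiableAt (𝓡 m) 𝓘(ℝ, EuclideanSpace ℝ (Fin m)) (extChartAt (𝓡 m) p₀) x :=
  mdifferentiableAt_extChartAt (by rwa [extChartAt_source] at hx)

theorem chartDSymm_surjective {p₀ : M} {y : EuclideanSpace ℝ (Fin m)}
    (hy : y ∈ (extChartAt (𝓡 m) p₀).target) : Function.Surjective (chartDSymm p₀ y) :=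
  fun v => ⟨_, chartDSymm_chartD hy v⟩

theorem chartD_surjective {p₀ x : M} (hx : x ∈ (extChartAt (𝓡 m) p₀).source) :
    Function.Surjective (chartD (m := m) p₀ x) := by
  obtain ⟨y, hy, rfl⟩ : ∃ y ∈ (extChartAt (𝓡 m) p₀).target, (extChartAt (𝓡 m) p₀).symm y = x :=
    ⟨_, (extChartAt (𝓡 m) p₀).map_source hx, (extChartAt (𝓡 m) p₀).left_inv hx⟩
  exact fun v => ⟨_, chartD_chartDSymm hy v⟩

theorem chartD_injective {p₀ x : M} (hx : x ∈ (extChartAt (𝓡 m) p₀).source) :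
    Function.Injective (chartD (m := m) p₀ x) := by
  obtain ⟨y, hy, rfl⟩ : ∃ y ∈ (extChartAt (𝓡 m) p₀).target, (extChartAt (𝓡 m) p₀).symm y = x :=
    ⟨_, (extChartAt (𝓡 m) p₀).map_source hx, (extChartAt (𝓡 m) p₀).left_inv hx⟩
  intro u v h
  rw [← chartDSymm_chartD hy u, h, chartDSymm_chartD hy v]

/-- The transition map from the chart at `p₀` to the chart at `p₁`. -/
def transition (p₀ p₁ : M) (y : EuclideanSpace ℝ (Fin m)) : EuclideanSpace ℝ (Fin m) :=
  extChartAt (𝓡 m) p₁ ((extChartAt (𝓡 m) p₀).symm y)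

theorem isOpen_transition_source (p₀ p₁ : M) :
    IsOpen ((extChartAt (𝓡 m) p₀).target ∩
      (extChartAt (𝓡 m) p₀).symm ⁻¹' (extChartAt (𝓡 m) p₁).source) :=
  (continuousOn_extChartAt_symm p₀).isOpen_inter_preimage (isOpen_target p₀) (isOpen_source p₁)

theorem contDiffAt_transition {p₀ p₁ : M} {y : EuclideanSpace ℝ (Fin m)}
    (hy : y ∈ (extChartAt (𝓡 m) p₀).target)
    (hy' : (extChartAt (𝓡 m) p₀).symm y ∈ (extChartAt (𝓡 m) p₁).source) :
    ContDiffAt ℝ ∞ (transition p₀ p₁) y := by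
  rw [← contMDiffAt_iff_contDiffAt]
  have h1 : ContMDiffAt 𝓘(ℝ, EuclideanSpace ℝ (Fin m)) (𝓡 m) ∞ (extChartAt (𝓡 m) p₀).symm y :=
    (contMDiffOn_extChartAt_symm p₀).contMDiffAt ((isOpen_target p₀).mem_nhds hy)
  have h2 : ContMDiffAt (𝓡 m) 𝓘(ℝ, EuclideanSpace ℝ (Fin m)) ∞ (extChartAt (𝓡 m) p₁)
      ((extChartAt (𝓡 m) p₀).symm y) :=
    contMDiffAt_extChartAt' (by rwa [extChartAt_source] at hy')
  exact h2.comp y h1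

theorem fderiv_transition {p₀ p₁ : M} {y : EuclideanSpace ℝ (Fin m)}
    (hy : y ∈ (extChartAt (𝓡 m) p₀).target)
    (hy' : (extChartAt (𝓡 m) p₀).symm y ∈ (extChartAt (𝓡 m) p₁).source)
    (v : EuclideanSpace ℝ (Fin m)) :
    fderiv ℝ (transition p₀ p₁) y v =
      chartD p₁ ((extChartAt (𝓡 m) p₀).symm y) (chartDSymm p₀ y v) := by
  have h := mfderiv_comp y (mdifferentiableAt_chart hy') (mdifferentiableAt_symm hy)
  rw [← mfderiv_eq_fderiv]
  exact DFunLike.congr_fun h v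

variable [RiemannianBundle (fun x : M => TangentSpace (𝓡 m) x)]

theorem metricForm_transition {p₀ p₁ : M} {y : EuclideanSpace ℝ (Fin m)}
    (hy : y ∈ (extChartAt (𝓡 m) p₀).target)
    (hy' : (extChartAt (𝓡 m) p₀).symm y ∈ (extChartAt (𝓡 m) p₁).source)
    (v w : EuclideanSpace ℝ (Fin m)) :
    metricForm p₀ y v w = metricForm p₁ (transition p₀ p₁ y)
      (fderiv ℝ (transition p₀ p₁) y v) (fderiv ℝ (transition p₀ p₁) y w) := by
  rw [fderiv_transition hy hy', fderiv_transition hy hy', transition, ← inner_eq_metricForm hy']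
  rfl

variable [IsContMDiffRiemannianBundle (𝓡 m) ∞ (EuclideanSpace ℝ (Fin m))
      (fun x : M => TangentSpace (𝓡 m) x)]

theorem differentiableAt_metricForm {p₀ : M} {y : EuclideanSpace ℝ (Fin m)}
    (hy : y ∈ (extChartAt (𝓡 m) p₀).target) : DifferentiableAt ℝ (metricForm p₀) y :=
  ((contDiffOn_metricForm p₀).contDiffAt ((isOpen_target p₀).mem_nhds hy)).differentiableAt
    (by simp)

theorem christoffelFirst_eq {p₀ : M} {y : EuclideanSpace ℝ (Fin m)}
    (hy : y ∈ (extChartAt (𝓡 m) p₀).target) (u v z : EuclideanSpace ℝ (Fin m)) :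
    christoffelFirst p₀ y u v z = christoffelForm (metricForm p₀) y u v z := by
  have key : ∀ a v w, fderiv ℝ (fun y' => chartMetric p₀ y' v w) y a =
      fderiv ℝ (metricForm p₀) y a v w := by
    intro a v w
    have h1 := ((differentiableAt_metricForm hy).hasFDerivAt.clm_apply
      (hasFDerivAt_const v y)).clm_apply (hasFDerivAt_const w y)
    have h2 : HasFDerivAt (fun y' => chartMetric p₀ y' v w) _ y := h1
    rw [h2.fderiv]
    simp
  rw [christoffelForm_apply, christoffelFirst, key, key, key]

/-- A solution of the equation of parallel transport in one chart is parallel in all charts. -/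
theorem isParallel_of_chart (p₀ : M) {c c' V V' : ℝ → EuclideanSpace ℝ (Fin m)}
    (hc : ∀ t ∈ Icc (0 : ℝ) 1, c t ∈ (extChartAt (𝓡 m) p₀).target)
    (hcd : ∀ t ∈ Icc (0 : ℝ) 1, HasDerivWithinAt c (c' t) (Icc 0 1) t)
    (hVd : ∀ t ∈ Icc (0 : ℝ) 1, HasDerivWithinAt V (V' t) (Icc 0 1) t)
    (heq : ∀ t ∈ Icc (0 : ℝ) 1, ∀ z, metricForm p₀ (c t) (V' t) z +
      christoffelForm (metricForm p₀) (c t) (c' t) (V t) z = 0)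
    {X : ℝ → TangentBundle (𝓡 m) M}
    (hX : ∀ t ∈ Icc (0 : ℝ) 1,
      X t = ⟨(extChartAt (𝓡 m) p₀).symm (c t), chartDSymm p₀ (c t) (V t)⟩) :
    IsParallel X := by
  intro p₁ t ht hsrc
  have hy := hc t ht
  have hy' : (extChartAt (𝓡 m) p₀).symm (c t) ∈ (extChartAt (𝓡 m) p₁).source := by
    rw [hX t ht] at hsrc; exact hsrc
  have hev : ∀ᶠ y in 𝓝 (c t), y ∈ (extChartAt (𝓡 m) p₀).target ∩
      (extChartAt (𝓡 m) p₀).symm ⁻¹' (extChartAt (𝓡 m) p₁).source :=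
    (isOpen_transition_source p₀ p₁).mem_nhds ⟨hy, hy'⟩
  have hτ := contDiffAt_transition hy hy'
  have hτd : HasFDerivAt (transition p₀ p₁) (fderiv ℝ (transition p₀ p₁) (c t)) (c t) :=
    (hτ.differentiableAt (by simp)).hasFDerivAt
  have hDτ : HasFDerivAt (fderiv ℝ (transition p₀ p₁))
      (fderiv ℝ (fderiv ℝ (transition p₀ p₁)) (c t)) (c t) :=
    ((hτ.fderiv_right (m := ∞) (by simp)).differentiableAt
      (by simp)).hasFDerivAt
  have hpt : ∀ s ∈ Icc (0 : ℝ) 1, chartPoint p₁ (X s) = transition p₀ p₁ (c s) := by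
    intro s hs; rw [hX s hs]; rfl
  have hvec : ∀ s ∈ Icc (0 : ℝ) 1, c s ∈ (extChartAt (𝓡 m) p₀).target ∩
      (extChartAt (𝓡 m) p₀).symm ⁻¹' (extChartAt (𝓡 m) p₁).source →
      chartVector p₁ (X s) = fderiv ℝ (transition p₀ p₁) (c s) (V s) := by
    intro s hs h
    rw [hX s hs, fderiv_transition h.1 h.2]; rfl
  have hcp : HasDerivWithinAt (fun s => chartPoint p₁ (X s))
      (fderiv ℝ (transition p₀ p₁) (c t) (c' t)) (Icc 0 1) t :=
    (hτd.comp_hasDerivWithinAt t (hcd t ht)).congr hpt (hpt t ht)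
  have hcv : HasDerivWithinAt (fun s => chartVector p₁ (X s))
      (fderiv ℝ (fderiv ℝ (transition p₀ p₁)) (c t) (c' t) (V t) +
        fderiv ℝ (transition p₀ p₁) (c t) (V' t)) (Icc 0 1) t := by
    refine ((hDτ.comp_hasDerivWithinAt t (hcd t ht)).clm_apply (hVd t ht)).congr_of_eventuallyEq
      ?_ (hvec t ht ⟨hy, hy'⟩)
    filter_upwards [(hcd t ht).continuousWithinAt.eventually hev, self_mem_nhdsWithin] with s h1 h2
    exact hvec s h2 h1
  have hu : UniqueDiffWithinAt ℝ (Icc (0 : ℝ) 1) t := uniqueDiffOn_Icc zero_lt_one t ht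
  refine ⟨hcv.differentiableWithinAt, fun z => ?_⟩
  rw [hcv.derivWithin hu, hcp.derivWithin hu, hpt t ht, hvec t ht ⟨hy, hy'⟩,
    ← metricForm_apply]
  have htgt : transition p₀ p₁ (c t) ∈ (extChartAt (𝓡 m) p₁).target :=
    (extChartAt (𝓡 m) p₁).map_source hy'
  rw [christoffelFirst_eq htgt]
  obtain ⟨z', rfl⟩ : ∃ z', fderiv ℝ (transition p₀ p₁) (c t) z' = z := by
    obtain ⟨a, rfl⟩ := chartD_surjective hy' z
    obtain ⟨b, rfl⟩ := chartDSymm_surjective hy a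
    exact ⟨b, fderiv_transition hy hy' b⟩
  -- The inhomogeneous term `D²τ(c', V)` in the law for `Γ` is exactly the one produced by
  -- differentiating `Dτ(V)` along the curve, so the equation is chart independent.
  have h1 := christoffelForm_transform hτ (differentiableAt_metricForm hy)
    (differentiableAt_metricForm htgt) (metricForm_symm p₁ _)
    (hev.mono fun y h => metricForm_transition h.1 h.2) (c' t) (V t) z'
  have h2 := heq t ht z'
  rw [h1, metricForm_transition hy hy'] at h2
  rw [map_add, add_apply]
  linarith

end Charts

/-! ### Geodesics of the manifold and spray solutions in a chart. -/

section Geodesics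

variable {m : ℕ} {M : Type*} [EMetricSpace M] [ChartedSpace (EuclideanSpace ℝ (Fin m)) M]
  [IsManifold (𝓡 m) ∞ M]

theorem velocity_symm_comp {p : M} {c : ℝ → EuclideanSpace ℝ (Fin m)}
    {w : EuclideanSpace ℝ (Fin m)} {t : ℝ} (ht : t ∈ Icc (0 : ℝ) 1)
    (hct : c t ∈ (extChartAt (𝓡 m) p).target) (hc : HasDerivWithinAt c w (Icc 0 1) t) :
    velocity (m := m) ((extChartAt (𝓡 m) p).symm ∘ c) t =
      ⟨(extChartAt (𝓡 m) p).symm (c t), chartDSymm p (c t) w⟩ := by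
  have hu : UniqueDiffWithinAt ℝ (Icc (0 : ℝ) 1) t := uniqueDiffOn_Icc zero_lt_one t ht
  have h := mfderiv_comp_mfderivWithin (I := 𝓘(ℝ, ℝ)) t (mdifferentiableAt_symm hct)
    hc.differentiableWithinAt.mdifferentiableWithinAt hu.uniqueMDiffWithinAt
  unfold velocity
  congr 1
  rw [h]
  change chartDSymm p (c t) (mfderivWithin _ _ c (Icc 0 1) t 1) = _
  rw [mfderivWithin_eq_fderivWithin]
  congr 1
  exact hc.derivWithin hu

/-- The chain rule for a curve read in a chart. -/
theorem hasDerivWithinAt_chart_comp {p : M} {γ : ℝ → M} {s : Set ℝ} {t : ℝ}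
    (hγ : MDifferentiableWithinAt 𝓘(ℝ, ℝ) (𝓡 m) γ s t) (hu : UniqueDiffWithinAt ℝ s t)
    (hsrc : γ t ∈ (extChartAt (𝓡 m) p).source) :
    HasDerivWithinAt (extChartAt (𝓡 m) p ∘ γ)
      (chartD p (γ t) (mfderivWithin 𝓘(ℝ, ℝ) (𝓡 m) γ s t (1 : ℝ))) s t := by
  have h1 := (mdifferentiableAt_chart hsrc).comp_mdifferentiableWithinAt t hγ
  have h2 := mfderiv_comp_mfderivWithin (I := 𝓘(ℝ, ℝ)) t (mdifferentiableAt_chart hsrc) hγ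
    hu.uniqueMDiffWithinAt
  rw [mdifferentiableWithinAt_iff_differentiableWithinAt] at h1
  have h3 := h1.hasDerivWithinAt
  refine h3.congr_deriv ?_
  rw [mfderivWithin_eq_fderivWithin] at h2
  exact DFunLike.congr_fun h2 (1 : ℝ)

variable [RiemannianBundle (fun x : M => TangentSpace (𝓡 m) x)]

theorem norm_eq_metricForm {p x : M} (hx : x ∈ (extChartAt (𝓡 m) p).source)
    (v : TangentSpace (𝓡 m) x) :
    ‖v‖ = √(metricForm p (extChartAt (𝓡 m) p x) (chartD p x v) (chartD p x v)) := by
  rw [← inner_eq_metricForm hx, norm_eq_sqrt_real_inner]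

theorem pathELength_eq_metricForm {p : M} {γ : ℝ → M} {a b : ℝ} (hab : a < b)
    (hγ : ContMDiffOn 𝓘(ℝ, ℝ) (𝓡 m) 1 γ (Icc a b))
    (hsrc : ∀ t ∈ Icc a b, γ t ∈ (extChartAt (𝓡 m) p).source) :
    Manifold.pathELength (𝓡 m) γ a b = ∫⁻ t in Icc a b, ENNReal.ofReal
      (√(metricForm p (extChartAt (𝓡 m) p (γ t))
        (derivWithin (extChartAt (𝓡 m) p ∘ γ) (Icc a b) t)
        (derivWithin (extChartAt (𝓡 m) p ∘ γ) (Icc a b) t))) := by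
  rw [Manifold.pathELength_eq_lintegral_mfderivWithin_Icc]
  refine MeasureTheory.setLIntegral_congr_fun measurableSet_Icc fun t ht => ?_
  have hu : UniqueDiffWithinAt ℝ (Icc a b) t := uniqueDiffOn_Icc hab t ht
  have h := hasDerivWithinAt_chart_comp ((hγ t ht).mdifferentiableWithinAt (by simp)) hu (hsrc t ht)
  rw [h.derivWithin hu, ← norm_eq_metricForm (hsrc t ht), ofReal_norm]
  rfl

variable [IsContMDiffRiemannianBundle (𝓡 m) ∞ (EuclideanSpace ℝ (Fin m))
      (fun x : M => TangentSpace (𝓡 m) x)]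

variable (m) in
/-- A neighbourhood of `p` in its chart on which the exponential maps are defined. -/
structure NormalChart (p : M) where
  /-- the Christoffel symbols, extended to the whole space -/
  Γ : EuclideanSpace ℝ (Fin m) → EuclideanSpace ℝ (Fin m) →L[ℝ] EuclideanSpace ℝ (Fin m) →L[ℝ]
    EuclideanSpace ℝ (Fin m)
  contDiff : ContDiff ℝ ∞ Γ
  /-- the neighbourhood on which `Γ` is the Christoffel symbol -/
  V : Set (EuclideanSpace ℝ (Fin m))
  subset : V ⊆ (extChartAt (𝓡 m) p).target
  metric : IsMetricSpray (metricForm p) Γ V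
  /-- the exponential maps -/
  D : SprayChart Γ (extChartAt (𝓡 m) p p) V

theorem nonempty_normalChart (p : M) : Nonempty (NormalChart m p) := by
  obtain ⟨Γ, hΓ, V, hxV, hVt, hM⟩ := exists_isMetricSpray (isOpen_target p)
    (contDiffOn_metricForm p) (fun y _ => metricForm_symm p y) (fun y hy v => metricForm_pos hy)
    (mem_extChartAt_target (I := 𝓡 m) p)
  obtain ⟨D⟩ := nonempty_sprayChart hΓ (extChartAt (𝓡 m) p p) (hM.isOpen.mem_nhds hxV)
  exact ⟨⟨Γ, hΓ, V, hVt, hM, D⟩⟩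

namespace NormalChart

variable {p : M} (C : NormalChart m p)

theorem isGeodesic_of_spray {c w : ℝ → EuclideanSpace ℝ (Fin m)} (h : IsSpraySolution C.Γ c w)
    (hc : ContDiffOn ℝ ∞ c (Icc 0 1)) (hV : ∀ t ∈ Icc (0 : ℝ) 1, c t ∈ C.V) :
    IsGeodesic m ((extChartAt (𝓡 m) p).symm ∘ c) := by
  refine ⟨(contMDiffOn_extChartAt_symm p).comp (contMDiffOn_iff_contDiffOn.2 hc)
    fun t ht => C.subset (hV t ht), ?_⟩
  refine isParallel_of_chart p (c := c) (c' := w) (V := w)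
    (V' := fun t => -C.Γ (c t) (w t) (w t)) (fun t ht => C.subset (hV t ht))
    (fun t ht => (h t ht).1) (fun t ht => (h t ht).2) (fun t ht z => ?_)
    (fun t ht => velocity_symm_comp ht (C.subset (hV t ht)) (h t ht).1)
  rw [map_neg, neg_apply, C.metric.christoffel _ (hV t ht)]
  simp

theorem eq_of_metricForm_eq {y a b : EuclideanSpace ℝ (Fin m)} (hy : y ∈ C.V)
    (h : ∀ z, metricForm p y a z = metricForm p y b z) : a = b := by
  by_contra hne
  have h1 := C.metric.pos y hy (a - b) (sub_ne_zero.2 hne)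
  have h2 : metricForm p y (a - b) = metricForm p y a - metricForm p y b := map_sub _ _ _
  rw [h2, sub_apply, h, sub_self] at h1
  exact h1.false

/-- A parallel field in the chart. -/
theorem hasDerivWithinAt_of_isParallel {X : ℝ → TangentBundle (𝓡 m) M} (hX : IsParallel X)
    {t : ℝ} (ht : t ∈ Icc (0 : ℝ) 1) (hs : (X t).proj ∈ (extChartAt (𝓡 m) p).source)
    (hV : extChartAt (𝓡 m) p (X t).proj ∈ C.V) {c' : EuclideanSpace ℝ (Fin m)}
    (hc : HasDerivWithinAt (fun s => extChartAt (𝓡 m) p (X s).proj) c' (Icc 0 1) t) :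
    HasDerivWithinAt (fun s => chartVector p (X s))
      (-C.Γ (extChartAt (𝓡 m) p (X t).proj) c' (chartVector p (X t))) (Icc 0 1) t := by
  obtain ⟨h1, h2⟩ := hX p t ht hs
  have hu : UniqueDiffWithinAt ℝ (Icc (0 : ℝ) 1) t := uniqueDiffOn_Icc zero_lt_one t ht
  refine h1.hasDerivWithinAt.congr_deriv (C.eq_of_metricForm_eq hV fun z => ?_)
  have h3 := h2 z
  have h4 : HasDerivWithinAt (fun s => chartPoint p (X s)) c' (Icc 0 1) t := hc
  rw [h4.derivWithin hu, christoffelFirst_eq (show chartPoint p (X t) ∈ _ from C.subset hV),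
    ← metricForm_apply] at h3
  rw [map_neg, neg_apply, C.metric.christoffel _ hV]
  change metricForm p (chartPoint p (X t)) _ z = -christoffelForm _ (chartPoint p (X t)) _ _ _
  linarith

/-- A geodesic in the chart solves the spray equation. -/
theorem spray_of_isGeodesic {γ : ℝ → M} (hγ : IsGeodesic m γ) {t : ℝ} (ht : t ∈ Icc (0 : ℝ) 1)
    (hs : γ t ∈ (extChartAt (𝓡 m) p).source) (hV : extChartAt (𝓡 m) p (γ t) ∈ C.V) :
    HasDerivWithinAt (extChartAt (𝓡 m) p ∘ γ) (chartVector p (velocity (m := m) γ t)) (Icc 0 1) t ∧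
    HasDerivWithinAt (fun s => chartVector p (velocity (m := m) γ s))
      (-C.Γ (extChartAt (𝓡 m) p (γ t)) (chartVector p (velocity (m := m) γ t))
        (chartVector p (velocity (m := m) γ t))) (Icc 0 1) t := by
  have hu : UniqueDiffWithinAt ℝ (Icc (0 : ℝ) 1) t := uniqueDiffOn_Icc zero_lt_one t ht
  have h1 := hasDerivWithinAt_chart_comp ((hγ.1 t ht).mdifferentiableWithinAt (by simp)) hu hs
  exact ⟨h1, C.hasDerivWithinAt_of_isParallel hγ.2 ht hs hV h1⟩

end NormalChart

end Geodesics

/-! ### Normal balls. -/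

section NormalBalls

variable {m : ℕ} {M : Type*} [EMetricSpace M] [ChartedSpace (EuclideanSpace ℝ (Fin m)) M]
  [IsManifold (𝓡 m) ∞ M] [RiemannianBundle (fun x : M => TangentSpace (𝓡 m) x)]
  [IsContMDiffRiemannianBundle (𝓡 m) ∞ (EuclideanSpace ℝ (Fin m))
      (fun x : M => TangentSpace (𝓡 m) x)]

namespace NormalChart

variable {p : M} (C : NormalChart m p)

/-- The geodesic through the point with coordinates `x`, with initial velocity `v`. -/
def geodesic (x v : EuclideanSpace ℝ (Fin m)) (t : ℝ) : M :=
  (extChartAt (𝓡 m) p).symm (C.D.exp x (t • v))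

variable {x v : EuclideanSpace ℝ (Fin m)}

theorem exp_smul_mem (hx : x ∈ Metric.ball (extChartAt (𝓡 m) p p) C.D.ρ)
    (hv : v ∈ Metric.ball 0 C.D.ρ) {t : ℝ} (ht : t ∈ Icc (0 : ℝ) 1) :
    C.D.exp x (t • v) ∈ C.V := C.D.exp_mem hx (C.D.smul_mem_ball hv ht)

theorem contDiffOn_exp_smul (hx : x ∈ Metric.ball (extChartAt (𝓡 m) p p) C.D.ρ)
    (hv : v ∈ Metric.ball 0 C.D.ρ) :
    ContDiffOn ℝ ∞ (fun t : ℝ => C.D.exp x (t • v)) (Icc 0 1) :=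
  (C.D.contDiffOn_exp hx).comp (contDiff_id.smul contDiff_const).contDiffOn
    fun _ ht => C.D.smul_mem_ball hv ht

theorem isGeodesic_geodesic (hx : x ∈ Metric.ball (extChartAt (𝓡 m) p p) C.D.ρ)
    (hv : v ∈ Metric.ball 0 C.D.ρ) : IsGeodesic m (C.geodesic x v) :=
  C.isGeodesic_of_spray (C.D.isSpraySolution_exp hx hv) (C.contDiffOn_exp_smul hx hv)
    fun _ ht => C.exp_smul_mem hx hv ht

theorem geodesic_zero (hx : x ∈ Metric.ball (extChartAt (𝓡 m) p p) C.D.ρ) :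
    C.geodesic x v 0 = (extChartAt (𝓡 m) p).symm x := by
  rw [geodesic, zero_smul, C.D.exp_zero hx]

theorem geodesic_one : C.geodesic x v 1 = (extChartAt (𝓡 m) p).symm (C.D.exp x v) := by
  rw [geodesic, one_smul]

theorem velocity_geodesic_zero (hx : x ∈ Metric.ball (extChartAt (𝓡 m) p p) C.D.ρ)
    (hv : v ∈ Metric.ball 0 C.D.ρ) : velocity (m := m) (C.geodesic x v) 0 =
      ⟨(extChartAt (𝓡 m) p).symm x, chartDSymm p x v⟩ := by
  have h0 := left_mem_Icc.2 (zero_le_one' ℝ)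
  have h := velocity_symm_comp (p := p) h0 (C.subset (C.exp_smul_mem hx hv h0))
    (C.D.hasDerivAt_exp_smul hx hv h0).hasDerivWithinAt
  have e : C.D.exp x ((0 : ℝ) • v) = x := by rw [zero_smul, C.D.exp_zero hx]
  change velocity (m := m) (C.geodesic x v) 0 = _ at h
  rw [h, e, zero_smul, C.D.fderiv_exp_zero hx]

theorem geodesic_mem_source (hx : x ∈ Metric.ball (extChartAt (𝓡 m) p p) C.D.ρ)
    (hv : v ∈ Metric.ball 0 C.D.ρ) {t : ℝ} (ht : t ∈ Icc (0 : ℝ) 1) :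
    C.geodesic x v t ∈ (extChartAt (𝓡 m) p).source :=
  (extChartAt (𝓡 m) p).map_target (C.subset (C.exp_smul_mem hx hv ht))

theorem chart_geodesic (hx : x ∈ Metric.ball (extChartAt (𝓡 m) p p) C.D.ρ)
    (hv : v ∈ Metric.ball 0 C.D.ρ) {t : ℝ} (ht : t ∈ Icc (0 : ℝ) 1) :
    extChartAt (𝓡 m) p (C.geodesic x v t) = C.D.exp x (t • v) :=
  (extChartAt (𝓡 m) p).right_inv (C.subset (C.exp_smul_mem hx hv ht))

theorem pathELength_geodesic (hx : x ∈ Metric.ball (extChartAt (𝓡 m) p p) C.D.ρ)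
    (hv : v ∈ Metric.ball 0 C.D.ρ) :
    Manifold.pathELength (𝓡 m) (C.geodesic x v) 0 1 =
      ENNReal.ofReal (√(metricForm p x v v)) := by
  rw [pathELength_eq_metricForm zero_lt_one ((C.isGeodesic_geodesic hx hv).1.of_le (by simp))
    (fun t ht => C.geodesic_mem_source hx hv ht)]
  have : ∀ t ∈ Icc (0 : ℝ) 1, ENNReal.ofReal
      (√(metricForm p (extChartAt (𝓡 m) p (C.geodesic x v t))
        (derivWithin (extChartAt (𝓡 m) p ∘ C.geodesic x v) (Icc 0 1) t)
        (derivWithin (extChartAt (𝓡 m) p ∘ C.geodesic x v) (Icc 0 1) t))) =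
      ENNReal.ofReal (√(metricForm p x v v)) := by
    intro t ht
    have hd : HasDerivWithinAt (extChartAt (𝓡 m) p ∘ C.geodesic x v)
        (fderiv ℝ (C.D.exp x) (t • v) v) (Icc 0 1) t :=
      (C.D.hasDerivAt_exp_smul hx hv ht).hasDerivWithinAt.congr
        (fun s hs => C.chart_geodesic hx hv hs) (C.chart_geodesic hx hv ht)
    rw [hd.derivWithin (uniqueDiffOn_Icc zero_lt_one t ht), C.chart_geodesic hx hv ht,
      C.metric.speed_exp C.D hx hv ht]
  rw [MeasureTheory.setLIntegral_congr_fun measurableSet_Icc this]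
  simp

end NormalChart

variable [IsRiemannianManifold (𝓡 m) M]

theorem edist_le_pathELength {γ : ℝ → M} {a b : ℝ} (hab : a ≤ b)
    (hγ : ContMDiffOn 𝓘(ℝ, ℝ) (𝓡 m) 1 γ (Icc a b)) :
    edist (γ a) (γ b) ≤ Manifold.pathELength (𝓡 m) γ a b := by
  rw [IsRiemannianManifold.out (I := 𝓡 m)]
  exact Manifold.riemannianEDist_le_pathELength hγ rfl rfl hab

namespace NormalChart

variable {p : M} (C : NormalChart m p) {x v : EuclideanSpace ℝ (Fin m)}

theorem edist_exp_le (hx : x ∈ Metric.ball (extChartAt (𝓡 m) p p) C.D.ρ)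
    (hv : v ∈ Metric.ball 0 C.D.ρ) :
    edist ((extChartAt (𝓡 m) p).symm x) ((extChartAt (𝓡 m) p).symm (C.D.exp x v)) ≤
      ENNReal.ofReal (√(metricForm p x v v)) := by
  rw [← C.pathELength_geodesic hx hv, ← C.geodesic_zero (v := v) hx, ← C.geodesic_one]
  exact edist_le_pathELength zero_le_one ((C.isGeodesic_geodesic hx hv).1.of_le (by simp))

end NormalChart

/-- A curve cannot move farther from its starting point than its length; this repeatedly confines
short curves to a chart. -/
theorem mem_eball_of_pathELength_le {γ : ℝ → M} {p : M} {r s : ℝ} (hr : 0 ≤ r) (hs : 0 ≤ s)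
    (hγ : ContMDiffOn 𝓘(ℝ, ℝ) (𝓡 m) 1 γ (Icc 0 1)) (h0 : γ 0 ∈ Metric.eball p (ENNReal.ofReal r))
    (hl : Manifold.pathELength (𝓡 m) γ 0 1 ≤ ENNReal.ofReal s) {t : ℝ} (ht : t ∈ Icc (0 : ℝ) 1) :
    γ t ∈ Metric.eball p (ENNReal.ofReal (r + s)) := by
  rw [Metric.mem_eball] at h0 ⊢
  have h1 := edist_le_pathELength ht.1 (hγ.mono (Icc_subset_Icc_right ht.2))
  have h2 : Manifold.pathELength (𝓡 m) γ 0 t ≤ ENNReal.ofReal s :=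
    (Manifold.pathELength_mono le_rfl ht.2).trans hl
  rw [edist_comm] at h1
  have h3 := h1.trans h2
  calc edist (γ t) p ≤ edist (γ t) (γ 0) + edist (γ 0) p := edist_triangle _ _ _
    _ < ENNReal.ofReal s + ENNReal.ofReal r :=
        ENNReal.add_lt_add_of_le_of_lt (ne_top_of_le_ne_top ENNReal.ofReal_ne_top h3) h3 h0
    _ = ENNReal.ofReal (r + s) := by rw [add_comm, ENNReal.ofReal_add hr hs]

theorem edist_lt_of_mem_eball {p x y : M} {r s : ℝ} (hr : 0 ≤ r) (hs : 0 ≤ s)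
    (hx : x ∈ Metric.eball p (ENNReal.ofReal r)) (hy : y ∈ Metric.eball p (ENNReal.ofReal s)) :
    edist x y < ENNReal.ofReal (r + s) := by
  rw [Metric.mem_eball] at hx hy
  rw [ENNReal.ofReal_add hr hs]
  exact (edist_triangle_right _ _ p).trans_lt (ENNReal.add_lt_add hx hy)

theorem eball_ofReal_subset {p : M} {r s : ℝ} (h : r ≤ s) :
    Metric.eball p (ENNReal.ofReal r) ⊆ Metric.eball p (ENNReal.ofReal s) :=
  Metric.eball_subset_eball (ENNReal.ofReal_le_ofReal h)

/-- A ball around `p` in which the chart controls distances and geodesics. -/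
structure IsNormalBall {p : M} (C : NormalChart m p) (R : ℝ) : Prop where
  pos : 0 < R
  source : ∀ x ∈ Metric.eball p (ENNReal.ofReal R), x ∈ (extChartAt (𝓡 m) p).source
  target : ∀ x ∈ Metric.eball p (ENNReal.ofReal R), ∀ y ∈ Metric.eball p (ENNReal.ofReal R),
    (extChartAt (𝓡 m) p x, extChartAt (𝓡 m) p y) ∈ C.D.Θ.target
  small : ∀ x ∈ Metric.eball p (ENNReal.ofReal R), ∀ v,
    √(metricForm p (extChartAt (𝓡 m) p x) v v) < R → v ∈ Metric.ball 0 C.D.ρ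
  hess : ∀ x ∈ Metric.eball p (ENNReal.ofReal R), ∀ ξ,
    metricForm p (extChartAt (𝓡 m) p x) ξ ξ ≤
      radialHessian (metricForm p) C.D (extChartAt (𝓡 m) p x) ξ

theorem NormalChart.mem_V {p : M} (C : NormalChart m p) : extChartAt (𝓡 m) p p ∈ C.V :=
  IsMetricSpray.mem_of_mem_ball C.D (Metric.mem_ball_self C.D.ρ_pos)

/-- All requirements hold on a neighbourhood of `p` by continuity. The extra set `U` carries further
local conditions into the same ball. -/
theorem exists_isNormalBall {p : M} (C : NormalChart m p) {U : Set M} (hU : U ∈ 𝓝 p) :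
    ∃ R, IsNormalBall C R ∧ Metric.eball p (ENNReal.ofReal R) ⊆ U := by
  have hψ : ContinuousAt (extChartAt (𝓡 m) p) p := continuousAt_extChartAt p
  have hx₀ := Metric.mem_ball_self (x := extChartAt (𝓡 m) p p) C.D.ρ_pos
  obtain ⟨κ, hκ, h1⟩ := C.metric.eventually_metric_ge C.mem_V
  have h2 := C.metric.eventually_metric_le_radialHessian C.contDiff C.D
  have h3 : C.D.Θ.target ∈ 𝓝 (extChartAt (𝓡 m) p p) ×ˢ 𝓝 (extChartAt (𝓡 m) p p) := by
    rw [← nhds_prod_eq]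
    exact C.D.Θ.open_target.mem_nhds (C.D.self_mem_target hx₀)
  obtain ⟨W, hW, hWT⟩ := Filter.mem_prod_same_iff.1 h3
  have h4 : ∀ᶠ x in 𝓝 p, x ∈ U ∧ x ∈ (extChartAt (𝓡 m) p).source ∧ extChartAt (𝓡 m) p x ∈ W ∧
      (∀ v, κ * ‖v‖ ^ 2 ≤ metricForm p (extChartAt (𝓡 m) p x) v v) ∧
      ∀ ξ, metricForm p (extChartAt (𝓡 m) p x) ξ ξ ≤
        radialHessian (metricForm p) C.D (extChartAt (𝓡 m) p x) ξ := by
    filter_upwards [hU, extChartAt_source_mem_nhds (I := 𝓡 m) p, hψ.eventually hW,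
      hψ.eventually h1, hψ.eventually h2] with x a b c d e using ⟨a, b, c, d, e⟩
  obtain ⟨ε, hε, hball⟩ := EMetric.mem_nhds_iff.1 h4
  have hρ := C.D.ρ_pos
  -- The factor `√κ * ρ` converts a metric length below `R` into a coordinate norm below `ρ`. The
  -- minimum with `1` makes the possibly infinite radius `ε` finite.
  set R := min (√κ * C.D.ρ) (min ε 1).toReal with hR
  have hmin : min ε 1 ≠ ⊤ := (min_le_right _ _).trans_lt ENNReal.one_lt_top |>.ne
  have hRpos : 0 < R := lt_min (by positivity)
    (ENNReal.toReal_pos (lt_min hε one_pos).ne' hmin)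
  have hsub : Metric.eball p (ENNReal.ofReal R) ⊆ Metric.eball p ε := by
    refine Metric.eball_subset_eball ?_
    calc ENNReal.ofReal R ≤ ENNReal.ofReal (min ε 1).toReal :=
          ENNReal.ofReal_le_ofReal (min_le_right _ _)
      _ = min ε 1 := ENNReal.ofReal_toReal hmin
      _ ≤ ε := min_le_left _ _
  refine ⟨R, ⟨hRpos, fun x hx => (hball (hsub hx)).2.1, fun x hx y hy =>
    hWT ⟨(hball (hsub hx)).2.2.1, (hball (hsub hy)).2.2.1⟩, fun x hx v hv => ?_,
    fun x hx => (hball (hsub hx)).2.2.2.2⟩, fun x hx => (hball (hsub hx)).1⟩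
  have h5 := (hball (hsub hx)).2.2.2.1 v
  rw [mem_ball_zero_iff]
  have h6 : √κ * ‖v‖ < √κ * C.D.ρ := by
    calc √κ * ‖v‖ = √(κ * ‖v‖ ^ 2) := by
          rw [Real.sqrt_mul hκ.le, Real.sqrt_sq (norm_nonneg _)]
      _ ≤ _ := Real.sqrt_le_sqrt h5
      _ < R := hv
      _ ≤ _ := min_le_left _ _
  exact lt_of_mul_lt_mul_left h6 (Real.sqrt_nonneg _)

namespace IsNormalBall

variable {p : M} {C : NormalChart m p} {R : ℝ}

theorem mono (hR : IsNormalBall C R) {R' : ℝ} (h0 : 0 < R') (h : R' ≤ R) : IsNormalBall C R' where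
  pos := h0
  source x hx := hR.source x (eball_ofReal_subset h hx)
  target x hx y hy := hR.target x (eball_ofReal_subset h hx) y (eball_ofReal_subset h hy)
  small x hx v hv := hR.small x (eball_ofReal_subset h hx) v (hv.trans_le h)
  hess x hx := hR.hess x (eball_ofReal_subset h hx)

end IsNormalBall

end NormalBalls

/-! ### Distances and minimal geodesics in a normal ball. -/

section NormalBallGeodesics

variable {m : ℕ} {M : Type*} [EMetricSpace M] [ChartedSpace (EuclideanSpace ℝ (Fin m)) M]
  [IsManifold (𝓡 m) ∞ M] [RiemannianBundle (fun x : M => TangentSpace (𝓡 m) x)]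
  [IsContMDiffRiemannianBundle (𝓡 m) ∞ (EuclideanSpace ℝ (Fin m))
      (fun x : M => TangentSpace (𝓡 m) x)]
  [IsRiemannianManifold (𝓡 m) M]

namespace IsNormalBall

variable {p : M} {C : NormalChart m p} {R : ℝ} {x y : M}

theorem center_mem (hR : IsNormalBall C R) : p ∈ Metric.eball p (ENNReal.ofReal R) :=
  Metric.mem_eball_self (ENNReal.ofReal_pos.2 hR.pos)

theorem mem_ball (hR : IsNormalBall C R) (hx : x ∈ Metric.eball p (ENNReal.ofReal R)) :
    extChartAt (𝓡 m) p x ∈ Metric.ball (extChartAt (𝓡 m) p p) C.D.ρ :=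
  (C.D.mem_ball_of_mem_target (hR.target x hx x hx)).1

theorem mem_V (hR : IsNormalBall C R) (hx : x ∈ Metric.eball p (ENNReal.ofReal R)) :
    extChartAt (𝓡 m) p x ∈ C.V :=
  IsMetricSpray.mem_of_mem_ball C.D (hR.mem_ball hx)

theorem log_mem (hR : IsNormalBall C R) (hx : x ∈ Metric.eball p (ENNReal.ofReal R))
    (hy : y ∈ Metric.eball p (ENNReal.ofReal R)) :
    C.D.log (extChartAt (𝓡 m) p x) (extChartAt (𝓡 m) p y) ∈ Metric.ball 0 C.D.ρ :=
  (C.D.mem_ball_of_mem_target (hR.target x hx y hy)).2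

theorem exp_log (hR : IsNormalBall C R) (hx : x ∈ Metric.eball p (ENNReal.ofReal R))
    (hy : y ∈ Metric.eball p (ENNReal.ofReal R)) :
    C.D.exp (extChartAt (𝓡 m) p x)
      (C.D.log (extChartAt (𝓡 m) p x) (extChartAt (𝓡 m) p y)) = extChartAt (𝓡 m) p y :=
  C.D.exp_log (hR.target x hx y hy)

theorem symm_chart (hR : IsNormalBall C R) (hx : x ∈ Metric.eball p (ENNReal.ofReal R)) :
    (extChartAt (𝓡 m) p).symm (extChartAt (𝓡 m) p x) = x :=
  (extChartAt (𝓡 m) p).left_inv (hR.source x hx)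

/-- The radial geodesic gives the upper bound. For the lower bound only curves shorter than `R / 2`
compete; starting within `R / 4` of `p`, they stay in the `R`-ball, where the Gauss lemma bounds
their length below. -/
theorem edist_eq (hR : IsNormalBall C R) (hx : x ∈ Metric.eball p (ENNReal.ofReal (R / 4)))
    (hy : y ∈ Metric.eball p (ENNReal.ofReal (R / 4))) :
    edist x y = ENNReal.ofReal (√(metricForm p (extChartAt (𝓡 m) p x)
      (C.D.log (extChartAt (𝓡 m) p x) (extChartAt (𝓡 m) p y))
      (C.D.log (extChartAt (𝓡 m) p x) (extChartAt (𝓡 m) p y)))) := by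
  have hRp := hR.pos
  have hx' := eball_ofReal_subset (by linarith : R / 4 ≤ R) hx
  have hy' := eball_ofReal_subset (by linarith : R / 4 ≤ R) hy
  refine le_antisymm ?_ (le_of_forall_gt fun r hr => ?_)
  · have h := C.edist_exp_le (hR.mem_ball hx') (hR.log_mem hx' hy')
    rwa [hR.exp_log hx' hy', hR.symm_chart hx', hR.symm_chart hy'] at h
  · have h1 : edist x y < min r (ENNReal.ofReal (R / 2)) := by
      refine lt_min hr ?_
      have := edist_lt_of_mem_eball (by linarith) (by linarith) hx hy
      rwa [show R / 4 + R / 4 = R / 2 by ring] at this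
    rw [IsRiemannianManifold.out (I := 𝓡 m)] at h1
    obtain ⟨γ, h0, h1', hγ, hl⟩ := Manifold.exists_lt_of_riemannianEDist_lt h1
    obtain ⟨hlr, hlR⟩ := lt_min_iff.1 hl
    have hmem : ∀ t ∈ Icc (0 : ℝ) 1, γ t ∈ Metric.eball p (ENNReal.ofReal R) := fun t ht =>
      eball_ofReal_subset (by linarith : R / 4 + R / 2 ≤ R)
        (mem_eball_of_pathELength_le (by linarith) (by linarith) hγ (h0 ▸ hx) hlR.le ht)
    have hc : ContDiffOn ℝ 1 (extChartAt (𝓡 m) p ∘ γ) (Icc 0 1) := by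
      rw [← contMDiffOn_iff_contDiffOn]
      refine ContMDiffOn.comp (t := (extChartAt (𝓡 m) p).source) ?_ hγ
        fun t ht => hR.source _ (hmem t ht)
      rw [extChartAt_source]
      exact contMDiffOn_extChartAt
    have h2 := C.metric.ofReal_sqrt_metric_log_le C.D zero_le_one hc
      (x := extChartAt (𝓡 m) p x) (by simp [h0]) (hR.mem_ball hx')
      (fun t ht => hR.target _ hx' _ (hmem t ht))
    simp only [Function.comp_apply, h1'] at h2
    refine h2.trans_lt ?_
    rw [pathELength_eq_metricForm zero_lt_one hγ fun t ht => hR.source _ (hmem t ht)] at hlr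
    exact hlr

theorem isSpraySolution (hR : IsNormalBall C R) {γ : ℝ → M} (hγ : IsGeodesic m γ)
    (hmem : ∀ t ∈ Icc (0 : ℝ) 1, γ t ∈ Metric.eball p (ENNReal.ofReal R)) :
    IsSpraySolution C.Γ (extChartAt (𝓡 m) p ∘ γ)
      (fun s => chartVector p (velocity (m := m) γ s)) := fun t ht =>
  C.spray_of_isGeodesic hγ ht (hR.source _ (hmem t ht)) (hR.mem_V (hmem t ht))

/-- Uniqueness makes the curve an exponential curve, and the speed bound places its initial velocity
where `log` inverts `exp`. The endpoint thus determines the curve. -/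
theorem eqOn_geodesic (hR : IsNormalBall C R) {γ : ℝ → M} (hγ : IsGeodesic m γ)
    (hmem : ∀ t ∈ Icc (0 : ℝ) 1, γ t ∈ Metric.eball p (ENNReal.ofReal R))
    (hs : √(metricForm p (extChartAt (𝓡 m) p (γ 0)) (chartVector p (velocity (m := m) γ 0))
      (chartVector p (velocity (m := m) γ 0))) < R) :
    EqOn γ (C.geodesic (extChartAt (𝓡 m) p (γ 0))
      (C.D.log (extChartAt (𝓡 m) p (γ 0)) (extChartAt (𝓡 m) p (γ 1)))) (Icc 0 1) := by
  have h0 := left_mem_Icc.2 (zero_le_one' ℝ)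
  have h1 := right_mem_Icc.2 (zero_le_one' ℝ)
  have hb := hR.mem_ball (hmem 0 h0)
  have hw := hR.small _ (hmem 0 h0) _ hs
  have h := (spray_solution_unique C.contDiff h1 (hR.isSpraySolution hγ hmem)
    (C.D.isSpraySolution_exp hb hw) (by rw [zero_smul, C.D.exp_zero hb]; rfl)
    (by rw [zero_smul, C.D.fderiv_exp_zero hb])).1
  have h' : extChartAt (𝓡 m) p (γ 1) = _ := h h1
  simp only [one_smul] at h'
  intro t ht
  have h'' : extChartAt (𝓡 m) p (γ t) = _ := h ht
  simp only at h''
  rw [h', C.D.log_exp hb hw, NormalChart.geodesic, ← h'']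
  exact (hR.symm_chart (hmem t ht)).symm

theorem pathELength_eq (hR : IsNormalBall C R) {γ : ℝ → M} (hγ : IsGeodesic m γ)
    (hmem : ∀ t ∈ Icc (0 : ℝ) 1, γ t ∈ Metric.eball p (ENNReal.ofReal R)) :
    Manifold.pathELength (𝓡 m) γ 0 1 = ENNReal.ofReal (√(metricForm p (extChartAt (𝓡 m) p (γ 0))
      (chartVector p (velocity (m := m) γ 0)) (chartVector p (velocity (m := m) γ 0)))) := by
  rw [pathELength_eq_metricForm zero_lt_one (hγ.1.of_le (by simp))
    fun t ht => hR.source _ (hmem t ht)]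
  have h := hR.isSpraySolution hγ hmem
  have : ∀ t ∈ Icc (0 : ℝ) 1, ENNReal.ofReal
      (√(metricForm p (extChartAt (𝓡 m) p (γ t))
        (derivWithin (extChartAt (𝓡 m) p ∘ γ) (Icc 0 1) t)
        (derivWithin (extChartAt (𝓡 m) p ∘ γ) (Icc 0 1) t))) =
      ENNReal.ofReal (√(metricForm p (extChartAt (𝓡 m) p (γ 0))
      (chartVector p (velocity (m := m) γ 0)) (chartVector p (velocity (m := m) γ 0)))) := by
    intro t ht
    rw [(h t ht).1.derivWithin (uniqueDiffOn_Icc zero_lt_one t ht)]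
    have := C.metric.speed_const h (fun t ht => hR.mem_V (hmem t ht)) ht
    simp only [Function.comp_apply] at this
    rw [this]
  rw [MeasureTheory.setLIntegral_congr_fun measurableSet_Icc this]
  simp

theorem isMinimalGeodesic (hR : IsNormalBall C R)
    (hx : x ∈ Metric.eball p (ENNReal.ofReal (R / 4)))
    (hy : y ∈ Metric.eball p (ENNReal.ofReal (R / 4))) :
    IsMinimalGeodesic m x y (C.geodesic (extChartAt (𝓡 m) p x)
      (C.D.log (extChartAt (𝓡 m) p x) (extChartAt (𝓡 m) p y))) := by
  have hRp := hR.pos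
  have hx' := eball_ofReal_subset (by linarith : R / 4 ≤ R) hx
  have hy' := eball_ofReal_subset (by linarith : R / 4 ≤ R) hy
  refine ⟨C.isGeodesic_geodesic (hR.mem_ball hx') (hR.log_mem hx' hy'), ?_, ?_, ?_⟩
  · rw [C.geodesic_zero (hR.mem_ball hx'), hR.symm_chart hx']
  · rw [C.geodesic_one, hR.exp_log hx' hy', hR.symm_chart hy']
  · rw [C.pathELength_geodesic (hR.mem_ball hx') (hR.log_mem hx' hy'), hR.edist_eq hx hy]

theorem mem_of_isMinimalGeodesic (hR : IsNormalBall C R)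
    (hx : x ∈ Metric.eball p (ENNReal.ofReal (R / 4)))
    (hy : y ∈ Metric.eball p (ENNReal.ofReal (R / 4))) {γ : ℝ → M}
    (hγ : IsMinimalGeodesic m x y γ) {t : ℝ} (ht : t ∈ Icc (0 : ℝ) 1) :
    γ t ∈ Metric.eball p (ENNReal.ofReal R) := by
  have hRp := hR.pos
  obtain ⟨h1, h2, h3, h4⟩ := hγ
  have h5 := edist_lt_of_mem_eball (by linarith) (by linarith) hx hy
  exact eball_ofReal_subset (by linarith : R / 4 + (R / 4 + R / 4) ≤ R)
    (mem_eball_of_pathELength_le (by linarith) (by linarith) (h1.1.of_le (by simp)) (h2 ▸ hx)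
      (h4.trans_lt h5).le ht)

/-- A minimal geodesic has length below `R / 2`, so it stays in the ball; constant speed converts
this length bound into the speed bound of `eqOn_geodesic`. -/
theorem eqOn_of_isMinimalGeodesic (hR : IsNormalBall C R)
    (hx : x ∈ Metric.eball p (ENNReal.ofReal (R / 4)))
    (hy : y ∈ Metric.eball p (ENNReal.ofReal (R / 4))) {γ : ℝ → M}
    (hγ : IsMinimalGeodesic m x y γ) :
    EqOn γ (C.geodesic (extChartAt (𝓡 m) p x)
      (C.D.log (extChartAt (𝓡 m) p x) (extChartAt (𝓡 m) p y))) (Icc 0 1) := by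
  have hRp := hR.pos
  have hmem := fun t => hR.mem_of_isMinimalGeodesic hx hy hγ (t := t)
  obtain ⟨h1, h2, h3, h4⟩ := hγ
  have h5 := edist_lt_of_mem_eball (by linarith) (by linarith) hx hy
  rw [← h4, hR.pathELength_eq h1 hmem, ENNReal.ofReal_lt_ofReal_iff (by linarith)] at h5
  have h6 := hR.eqOn_geodesic h1 hmem (by linarith)
  rwa [h2, h3] at h6

theorem hasUniqueMinimalGeodesic (hR : IsNormalBall C R)
    (hx : x ∈ Metric.eball p (ENNReal.ofReal (R / 4)))
    (hy : y ∈ Metric.eball p (ENNReal.ofReal (R / 4))) : HasUniqueMinimalGeodesic m x y :=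
  ⟨_, hR.isMinimalGeodesic hx hy, fun _ h => hR.eqOn_of_isMinimalGeodesic hx hy h⟩

/-- Squared distance from the center. -/
theorem mem_eball_iff (hR : IsNormalBall C R) (hx : x ∈ Metric.eball p (ENNReal.ofReal (R / 4)))
    {α : ℝ} (hα : 0 < α) : x ∈ Metric.eball p (ENNReal.ofReal α) ↔
      metricForm p (extChartAt (𝓡 m) p p)
        (C.D.log (extChartAt (𝓡 m) p p) (extChartAt (𝓡 m) p x))
        (C.D.log (extChartAt (𝓡 m) p p) (extChartAt (𝓡 m) p x)) < α ^ 2 := by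
  have hp : p ∈ Metric.eball p (ENNReal.ofReal (R / 4)) :=
    Metric.mem_eball_self (ENNReal.ofReal_pos.2 (by linarith [hR.pos]))
  rw [Metric.mem_eball, edist_comm, hR.edist_eq hp hx, ENNReal.ofReal_lt_ofReal_iff hα,
    Real.sqrt_lt' hα]

theorem metric_log_le (hR : IsNormalBall C R) (hx : x ∈ Metric.eball p (ENNReal.ofReal (R / 4)))
    {α : ℝ} (hα : 0 < α) (h : edist x p ≤ ENNReal.ofReal α) :
      metricForm p (extChartAt (𝓡 m) p p)
        (C.D.log (extChartAt (𝓡 m) p p) (extChartAt (𝓡 m) p x))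
        (C.D.log (extChartAt (𝓡 m) p p) (extChartAt (𝓡 m) p x)) ≤ α ^ 2 := by
  have hp : p ∈ Metric.eball p (ENNReal.ofReal (R / 4)) :=
    Metric.mem_eball_self (ENNReal.ofReal_pos.2 (by linarith [hR.pos]))
  rwa [edist_comm, hR.edist_eq hp hx, ENNReal.ofReal_le_ofReal_iff hα.le,
    Real.sqrt_le_left hα.le] at h

end IsNormalBall

end NormalBallGeodesics

/-! ### Strong convexity of small balls. -/

section StrongConvexity

variable {m : ℕ} {M : Type*} [EMetricSpace M] [ChartedSpace (EuclideanSpace ℝ (Fin m)) M]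
  [IsManifold (𝓡 m) ∞ M] [RiemannianBundle (fun x : M => TangentSpace (𝓡 m) x)]
  [IsContMDiffRiemannianBundle (𝓡 m) ∞ (EuclideanSpace ℝ (Fin m))
      (fun x : M => TangentSpace (𝓡 m) x)]
  [IsRiemannianManifold (𝓡 m) M]

namespace IsNormalBall

variable {p : M} {C : NormalChart m p} {R α : ℝ} {x y : M}

theorem metric_log_geodesic_le (hR : IsNormalBall C R) (hα : 0 < α) {γ : ℝ → M}
    (hγ : IsGeodesic m γ)
    (hmem : ∀ t ∈ Icc (0 : ℝ) 1, γ t ∈ Metric.eball p (ENNReal.ofReal (R / 4)))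
    (h0 : edist (γ 0) p ≤ ENNReal.ofReal α) (h1 : edist (γ 1) p ≤ ENNReal.ofReal α)
    {t : ℝ} (ht : t ∈ Icc (0 : ℝ) 1) :
    metricForm p (extChartAt (𝓡 m) p p)
        (C.D.log (extChartAt (𝓡 m) p p) (extChartAt (𝓡 m) p (γ t)))
        (C.D.log (extChartAt (𝓡 m) p p) (extChartAt (𝓡 m) p (γ t))) ≤
      α ^ 2 - metricForm p (extChartAt (𝓡 m) p (γ 0)) (chartVector p (velocity (m := m) γ 0))
        (chartVector p (velocity (m := m) γ 0)) * (t * (1 - t) / 2) := by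
  have hRp := hR.pos
  have hmem' : ∀ t ∈ Icc (0 : ℝ) 1, γ t ∈ Metric.eball p (ENNReal.ofReal R) := fun t ht =>
    eball_ofReal_subset (by linarith) (hmem t ht)
  have h := C.metric.radial_convex C.D (hR.isSpraySolution hγ hmem')
    (fun t ht => hR.target _ hR.center_mem _ (hmem' t ht)) (fun t ht => hR.hess _ (hmem' t ht)) ht
  have h2 := hR.metric_log_le (hmem 0 (left_mem_Icc.2 zero_le_one)) hα h0
  have h3 := hR.metric_log_le (hmem 1 (right_mem_Icc.2 zero_le_one)) hα h1
  simp only [Function.comp_apply] at h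
  have h4 := mul_le_mul_of_nonneg_left h2 (sub_nonneg.2 ht.2)
  have h5 := mul_le_mul_of_nonneg_left h3 ht.1
  linarith

/-- Strict convexity of the squared distance pushes the interior of a nonconstant geodesic with
endpoints in the closed ball into the open ball. It also bounds the speed of any competitor, so
`eqOn_geodesic` gives uniqueness. -/
theorem isStronglyConvexBall (hR : IsNormalBall C R) (hα : 0 < α) (hαR : α ≤ R / 32) :
    IsStronglyConvexBall m p α := by
  have hRp := hR.pos
  have hcl : ∀ x ∈ closure (Metric.eball p (ENNReal.ofReal α)), edist x p ≤ ENNReal.ofReal α :=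
    fun x hx => Metric.isClosed_closedEBall.closure_subset_iff.2 Metric.eball_subset_closedEBall hx
  have hcl2 : ∀ x, edist x p ≤ ENNReal.ofReal α →
      x ∈ Metric.eball p (ENNReal.ofReal (2 * α)) := fun x hx =>
    Metric.mem_eball.2 (hx.trans_lt ((ENNReal.ofReal_lt_ofReal_iff (by linarith)).2 (by linarith)))
  intro q hq q' hq' hqq
  have hq1 := hcl q hq
  have hq1' := hcl q' hq'
  have hq2 := hcl2 q hq1
  have hq2' := hcl2 q' hq1'
  have hq3 := eball_ofReal_subset (by linarith : 2 * α ≤ R / 4) hq2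
  have hq3' := eball_ofReal_subset (by linarith : 2 * α ≤ R / 4) hq2'
  have hmin := hR.isMinimalGeodesic hq3 hq3'
  set γ := C.geodesic (extChartAt (𝓡 m) p q)
    (C.D.log (extChartAt (𝓡 m) p q) (extChartAt (𝓡 m) p q')) with hγdef
  obtain ⟨hγ, hγ0, hγ1, hγl⟩ := hmin
  have hγ' : ContMDiffOn 𝓘(ℝ, ℝ) (𝓡 m) 1 γ (Icc 0 1) := hγ.1.of_le (by simp)
  -- The endpoints lie within `2α` of `p` and the length is below `4α`, so the geodesic stays within
  -- `6α ≤ R / 4`.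
  have hmem : ∀ t ∈ Icc (0 : ℝ) 1, γ t ∈ Metric.eball p (ENNReal.ofReal (R / 4)) := fun t ht =>
    eball_ofReal_subset (by linarith : 2 * α + (2 * α + 2 * α) ≤ R / 4)
      (mem_eball_of_pathELength_le (by linarith) (by linarith) hγ' (hγ0 ▸ hq2)
        (hγl.trans_lt (edist_lt_of_mem_eball (by linarith) (by linarith) hq2 hq2')).le ht)
  have hmem' : ∀ t ∈ Icc (0 : ℝ) 1, γ t ∈ Metric.eball p (ENNReal.ofReal R) := fun t ht =>
    eball_ofReal_subset (by linarith) (hmem t ht)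
  refine ⟨γ, ⟨hγ, hγ0, hγ1, fun t ht => ?_⟩, fun γ' h' => ?_⟩
  · have ht' := Ioo_subset_Icc_self ht
    -- A constant geodesic gains nothing from strict convexity, which is why `q` must then lie in
    -- the open ball.
    rcases eq_or_ne q q' with rfl | hne
    · have h1 := edist_le_pathELength ht.1.le (hγ'.mono (Icc_subset_Icc_right ht.2.le))
      have h2 := h1.trans (Manifold.pathELength_mono le_rfl ht.2.le)
      rw [hγl, edist_self, nonpos_iff_eq_zero, edist_eq_zero, hγ0] at h2
      rw [← h2]
      exact hqq rfl
    · rw [hR.mem_eball_iff (hmem t ht') hα]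
      refine (hR.metric_log_geodesic_le hα hγ hmem (hγ0 ▸ hq1) (hγ1 ▸ hq1') ht').trans_lt ?_
      have h1 : 0 < edist q q' := edist_pos.2 hne
      rw [← hγl, hR.pathELength_eq hγ hmem', ENNReal.ofReal_pos, Real.sqrt_pos] at h1
      have h2 : 0 < t * (1 - t) / 2 := by
        have := mul_pos ht.1 (sub_pos.2 ht.2)
        linarith
      linarith [mul_pos h1 h2]
  · obtain ⟨hg, hg0, hg1, hgm⟩ := h'
    have hle : ∀ t ∈ Icc (0 : ℝ) 1, edist (γ' t) p ≤ ENNReal.ofReal α := by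
      intro t ht
      rcases eq_endpoints_or_mem_Ioo_of_mem_Icc ht with rfl | rfl | h
      · rwa [hg0]
      · rwa [hg1]
      · exact (Metric.mem_eball.1 (hgm h)).le
    have hm : ∀ t ∈ Icc (0 : ℝ) 1, γ' t ∈ Metric.eball p (ENNReal.ofReal (R / 4)) := fun t ht =>
      eball_ofReal_subset (by linarith) (hcl2 _ (hle t ht))
    -- At the midpoint the gain is `speed² / 8`. The squared distance there is nonnegative, so
    -- `speed² ≤ 8α² < R²`.
    have h1 := hR.metric_log_geodesic_le hα hg hm (hle 0 (left_mem_Icc.2 zero_le_one))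
      (hle 1 (right_mem_Icc.2 zero_le_one)) (t := 1 / 2) ⟨by norm_num, by norm_num⟩
    have h2 := C.metric.nonneg C.mem_V
      (C.D.log (extChartAt (𝓡 m) p p) (extChartAt (𝓡 m) p (γ' (1 / 2))))
    have h3 := hR.eqOn_geodesic hg (fun t ht => eball_ofReal_subset (by linarith) (hm t ht)) (by
      rw [Real.sqrt_lt' hRp]
      nlinarith)
    rwa [hg0, hg1] at h3

end IsNormalBall

end StrongConvexity

/-! ### The inverse differential of a chart. -/

section ChartInverse

variable {m : ℕ} {M : Type*} [EMetricSpace M] [ChartedSpace (EuclideanSpace ℝ (Fin m)) M]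
  [IsManifold (𝓡 m) ∞ M]

variable (m) in
/-- The inverse of the differential at `x` of the chart at `p`. -/
def chartInv (p x : M) : EuclideanSpace ℝ (Fin m) →L[ℝ] TangentSpace (𝓡 m) x :=
  (chartD p x).inverse

variable {p x : M}

theorem chartD_chartInv (hx : x ∈ (extChartAt (𝓡 m) p).source) (v : EuclideanSpace ℝ (Fin m)) :
    chartD p x (chartInv m p x v) = v := by
  have h : (chartD (m := m) p x).IsInvertible := isInvertible_mfderiv_extChartAt hx
  obtain ⟨L, hL⟩ := h
  rw [chartInv, ← hL, ContinuousLinearMap.inverse_equiv]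
  exact L.apply_symm_apply v

theorem chartInv_chartD (hx : x ∈ (extChartAt (𝓡 m) p).source) (u : TangentSpace (𝓡 m) x) :
    chartInv m p x (chartD p x u) = u :=
  chartD_injective hx (chartD_chartInv hx _)

theorem mk_chartDSymm (hx : x ∈ (extChartAt (𝓡 m) p).source) (u : TangentSpace (𝓡 m) x) :
    (⟨(extChartAt (𝓡 m) p).symm (extChartAt (𝓡 m) p x),
      chartDSymm p (extChartAt (𝓡 m) p x) (chartD p x u)⟩ : TangentBundle (𝓡 m) M) = ⟨x, u⟩ := by
  obtain ⟨y, hy, rfl⟩ : ∃ y ∈ (extChartAt (𝓡 m) p).target, (extChartAt (𝓡 m) p).symm y = x :=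
    ⟨_, (extChartAt (𝓡 m) p).map_source hx, (extChartAt (𝓡 m) p).left_inv hx⟩
  rw [(extChartAt (𝓡 m) p).right_inv hy, chartDSymm_chartD hy]

end ChartInverse

/-! ### The exponential map as a diffeomorphism onto a ball. -/

section ExpDiffeo

variable {m : ℕ} {M : Type*} [EMetricSpace M] [ChartedSpace (EuclideanSpace ℝ (Fin m)) M]
  [IsManifold (𝓡 m) ∞ M] [RiemannianBundle (fun x : M => TangentSpace (𝓡 m) x)]
  [IsContMDiffRiemannianBundle (𝓡 m) ∞ (EuclideanSpace ℝ (Fin m))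
      (fun x : M => TangentSpace (𝓡 m) x)]
  [IsRiemannianManifold (𝓡 m) M]

namespace IsNormalBall

variable {p : M} {C : NormalChart m p} {R α : ℝ} {x y : M}

theorem chartD_mem (hR : IsNormalBall C R) (hαR : α ≤ R) {v : TangentSpace (𝓡 m) p}
    (hv : ‖v‖ < α) : chartD p p v ∈ Metric.ball 0 C.D.ρ := by
  refine hR.small p hR.center_mem _ ?_
  rw [← norm_eq_metricForm (mem_extChartAt_source (I := 𝓡 m) p)]
  linarith

theorem exp_chartD_mem_eball (hR : IsNormalBall C R) (hα : 0 < α) (hαR : α ≤ R)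
    {v : TangentSpace (𝓡 m) p} (hv : ‖v‖ < α) :
    (extChartAt (𝓡 m) p).symm (C.D.exp (extChartAt (𝓡 m) p p) (chartD p p v)) ∈
      Metric.eball p (ENNReal.ofReal α) := by
  have h := C.edist_exp_le (hR.mem_ball hR.center_mem) (hR.chartD_mem hαR hv)
  rw [← norm_eq_metricForm (mem_extChartAt_source (I := 𝓡 m) p), hR.symm_chart hR.center_mem,
    edist_comm] at h
  exact Metric.mem_eball.2 (h.trans_lt ((ENNReal.ofReal_lt_ofReal_iff hα).2 hv))

/-- A geodesic with the given initial velocity is not assumed to remain in the chart. Agreement with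
the model geodesic `g` is propagated along `[0, 1]`: it is a closed condition, and wherever `γ`
agrees with `g` it lies in the open ball and so stays in the chart a little longer. -/
theorem isExp_iff (hR : IsNormalBall C R) (hα : 0 < α) (hαR : α ≤ R)
    {v : TangentSpace (𝓡 m) p} (hv : ‖v‖ < α) (y : M) :
    IsExp p v y ↔
      y = (extChartAt (𝓡 m) p).symm (C.D.exp (extChartAt (𝓡 m) p p) (chartD p p v)) := by
  have hb := hR.mem_ball hR.center_mem
  have hvm := hR.chartD_mem hαR hv
  have hsrc := mem_extChartAt_source (I := 𝓡 m) p
  have h0 := left_mem_Icc.2 (zero_le_one' ℝ)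
  set g := C.geodesic (extChartAt (𝓡 m) p p) (chartD p p v) with hg
  have hgeo := C.isGeodesic_geodesic hb hvm
  constructor
  · rintro ⟨γ, hγ, hγv, rfl⟩
    have hγ0 : γ 0 = p := congrArg Bundle.TotalSpace.proj hγv
    have hgm : ∀ t ∈ Icc (0 : ℝ) 1, g t ∈ Metric.eball p (ENNReal.ofReal α) := by
      intro t ht
      have h1 : ‖t • v‖ < α := by
        rw [norm_smul, Real.norm_eq_abs, abs_of_nonneg ht.1]
        exact (mul_le_of_le_one_left (norm_nonneg _) ht.2).trans_lt hv
      have h2 := hR.exp_chartD_mem_eball hα hαR h1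
      rwa [map_smul] at h2
    have hall : Icc (0 : ℝ) 1 ⊆ {t | γ t = g t} := by
      refine IsClosed.Icc_subset_of_forall_mem_nhdsGT_of_Icc_subset ?_ ?_ fun t ht hsub => ?_
      · have h1 := (hγ.1.continuousOn.prodMk hgeo.1.continuousOn).preimage_isClosed_of_isClosed
          isClosed_Icc isClosed_diagonal
        rwa [inter_comm] at h1
      · change γ 0 = g 0
        rw [hγ0, hg, C.geodesic_zero hb, hR.symm_chart hR.center_mem]
      · have ht' : t ∈ Icc (0 : ℝ) 1 := Ico_subset_Icc_self ht
        have h1 : γ t ∈ Metric.eball p (ENNReal.ofReal α) := by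
          rw [show γ t = g t from hsub (right_mem_Icc.2 ht.1)]
          exact hgm t ht'
        have h2 : ∀ᶠ s in 𝓝[≥] t, s ≤ 1 ∧ γ s ∈ Metric.eball p (ENNReal.ofReal α) := by
          have h3 := (hγ.1.continuousOn t ht').eventually (Metric.isOpen_eball.mem_nhds h1)
          have h4 : 𝓝[≥] t ≤ 𝓝[Icc 0 1] t :=
            nhdsWithin_le_iff.2 (mem_of_superset (Icc_mem_nhdsGE ht.2) (Icc_subset_Icc_left ht.1))
          filter_upwards [h4 h3, Icc_mem_nhdsGE ht.2] with s a b using ⟨b.2, a⟩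
        obtain ⟨T, hT, hTs⟩ := mem_nhdsGE_iff_exists_Icc_subset.1 h2
        refine mem_of_superset (Ioc_mem_nhdsGT hT) fun s hs => ?_
        have hs1 : s ≤ 1 := (hTs ⟨hs.1.le, hs.2⟩).1
        have hs0 : 0 ≤ s := ht.1.trans hs.1.le
        have hm : ∀ r ∈ Icc 0 s, γ r ∈ Metric.eball p (ENNReal.ofReal R) := by
          intro r hr
          refine eball_ofReal_subset hαR ?_
          rcases le_total r t with h | h
          · rw [show γ r = g r from hsub ⟨hr.1, h⟩]
            exact hgm r ⟨hr.1, hr.2.trans hs1⟩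
          · exact (hTs ⟨h, hr.2.trans hs.2⟩).2
        have h5 := (spray_solution_unique C.contDiff ⟨hs0, hs1⟩
          (fun r hr => C.spray_of_isGeodesic hγ ⟨hr.1, hr.2.trans hs1⟩ (hR.source _ (hm r hr))
            (hR.mem_V (hm r hr)))
          (fun r hr => C.D.isSpraySolution_exp hb hvm r ⟨hr.1, hr.2.trans hs1⟩)
          (by rw [zero_smul, C.D.exp_zero hb, ← hγ0]; rfl)
          (by rw [zero_smul, C.D.fderiv_exp_zero hb, hγv]; rfl)).1
        have h6 : extChartAt (𝓡 m) p (γ s) = C.D.exp (extChartAt (𝓡 m) p p) (s • chartD p p v) :=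
          h5 ⟨hs0, le_rfl⟩
        change γ s = g s
        rw [hg, NormalChart.geodesic, ← h6, hR.symm_chart (hm s ⟨hs0, le_rfl⟩)]
    rw [show γ 1 = g 1 from hall (right_mem_Icc.2 zero_le_one), hg, C.geodesic_one]
  · rintro rfl
    refine ⟨g, hgeo, ?_, C.geodesic_one⟩
    rw [hg, C.velocity_geodesic_zero hb hvm, mk_chartDSymm hsrc]

/-- The inverse is `log` at `p`. Its image is the right ball because the norm of `log` is the
distance from `p`. -/
theorem isExpDiffeoBall (hR : IsNormalBall C R) (hα : 0 < α) (hαR : α ≤ R / 4) :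
    IsExpDiffeoBall m p α := by
  have hRp := hR.pos
  have hαR' : α ≤ R := by linarith
  have hsrc := mem_extChartAt_source (I := 𝓡 m) p
  have hb := hR.mem_ball hR.center_mem
  let e : PartialEquiv (TangentSpace (𝓡 m) p) M :=
    { toFun := fun v => (extChartAt (𝓡 m) p).symm (C.D.exp (extChartAt (𝓡 m) p p) (chartD p p v))
      invFun := fun y => chartInv m p p (C.D.log (extChartAt (𝓡 m) p p) (extChartAt (𝓡 m) p y))
      source := Metric.ball 0 α
      target := Metric.eball p (ENNReal.ofReal α)
      map_source' := fun v hv => hR.exp_chartD_mem_eball hα hαR' (mem_ball_zero_iff.1 hv)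
      map_target' := fun y hy => by
        rw [mem_ball_zero_iff, norm_eq_metricForm hsrc, chartD_chartInv hsrc, Real.sqrt_lt' hα]
        exact (hR.mem_eball_iff (eball_ofReal_subset hαR hy) hα).1 hy
      left_inv' := fun v hv => by
        have hv' := hR.chartD_mem hαR' (mem_ball_zero_iff.1 hv)
        rw [(extChartAt (𝓡 m) p).right_inv (C.subset (C.D.exp_mem hb hv')), C.D.log_exp hb hv',
          chartInv_chartD hsrc]
      right_inv' := fun y hy => by
        have hy' := eball_ofReal_subset hαR' hy
        rw [chartD_chartInv hsrc, hR.exp_log hR.center_mem hy', hR.symm_chart hy'] }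
  refine ⟨⟨e, Metric.isOpen_ball, Metric.isOpen_eball, ?_, ?_⟩, rfl, rfl,
    fun v hv y => hR.isExp_iff hα hαR' (mem_ball_zero_iff.1 hv) y⟩
  · have h1 : ContMDiffOn 𝓘(ℝ, TangentSpace (𝓡 m) p) 𝓘(ℝ, EuclideanSpace ℝ (Fin m)) ∞
        (fun v : TangentSpace (𝓡 m) p => C.D.exp (extChartAt (𝓡 m) p p) (chartD p p v))
        (Metric.ball 0 α) :=
      contMDiffOn_iff_contDiffOn.2 ((C.D.contDiffOn_exp hb).comp
        (chartD (m := m) p p).contDiff.contDiffOn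
        fun v hv => hR.chartD_mem hαR' (mem_ball_zero_iff.1 hv))
    exact (contMDiffOn_extChartAt_symm p).comp h1 fun v hv =>
      C.subset (C.D.exp_mem hb (hR.chartD_mem hαR' (mem_ball_zero_iff.1 hv)))
  · have h1 : ContMDiffOn 𝓘(ℝ, EuclideanSpace ℝ (Fin m)) 𝓘(ℝ, TangentSpace (𝓡 m) p) ∞
        (fun z => chartInv m p p (C.D.log (extChartAt (𝓡 m) p p) z))
        {z | (extChartAt (𝓡 m) p p, z) ∈ C.D.Θ.target} :=
      contMDiffOn_iff_contDiffOn.2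
        ((chartInv m p p).contDiff.comp_contDiffOn (C.D.contDiffOn_log _))
    refine h1.comp (?_ : ContMDiffOn (𝓡 m) 𝓘(ℝ, EuclideanSpace ℝ (Fin m)) ∞
      (extChartAt (𝓡 m) p) _) fun y hy => hR.target _ hR.center_mem _
        (eball_ofReal_subset hαR' hy)
    refine (contMDiffOn_extChartAt (x := p)).mono fun y hy => ?_
    have := hR.source y (eball_ofReal_subset hαR' hy)
    rwa [extChartAt_source] at this

end IsNormalBall

end ExpDiffeo

/-! ### Parallel translation is close to the identity. -/

section ParallelTranslation

variable {m : ℕ} {M : Type*} [EMetricSpace M] [ChartedSpace (EuclideanSpace ℝ (Fin m)) M]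
  [IsManifold (𝓡 m) ∞ M] [RiemannianBundle (fun x : M => TangentSpace (𝓡 m) x)]
  [IsContMDiffRiemannianBundle (𝓡 m) ∞ (EuclideanSpace ℝ (Fin m))
      (fun x : M => TangentSpace (𝓡 m) x)]
  [IsRiemannianManifold (𝓡 m) M]

theorem mk_chartDSymm_of_eq {p x : M} (hx : x ∈ (extChartAt (𝓡 m) p).source)
    {u : TangentSpace (𝓡 m) x} {y v : EuclideanSpace ℝ (Fin m)} (hy : y = extChartAt (𝓡 m) p x)
    (hv : v = chartD p x u) :
    (⟨(extChartAt (𝓡 m) p).symm y, chartDSymm p y v⟩ : TangentBundle (𝓡 m) M) = ⟨x, u⟩ := by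
  subst hy hv
  exact mk_chartDSymm hx u

/-- Along the geodesic the coordinate velocity is at most `R / κ`, by constant speed, so the
coefficient `-Γ(c')` of the transport equation has norm at most `B R / κ`. -/
theorem IsNormalBall.exists_propagator_parallelTranslation {p : M} {C : NormalChart m p}
    {R κ B ε : ℝ} {x y : M} (hR : IsNormalBall C R) (hκ : 0 < κ) (hB : 0 ≤ B)
    (hge : ∀ x ∈ Metric.eball p (ENNReal.ofReal R), ∀ v,
      κ ^ 2 * ‖v‖ ^ 2 ≤ metricForm p (extChartAt (𝓡 m) p x) v v)
    (hle : ∀ x ∈ Metric.eball p (ENNReal.ofReal R), ‖C.Γ (extChartAt (𝓡 m) p x)‖ ≤ B)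
    (hε : B * (R / κ) ≤ ε) (hε' : ε ≤ 1 / 2)
    (hx : x ∈ Metric.eball p (ENNReal.ofReal (R / 4)))
    (hy : y ∈ Metric.eball p (ENNReal.ofReal (R / 4))) :
    ∃ P : EuclideanSpace ℝ (Fin m) →L[ℝ] EuclideanSpace ℝ (Fin m),
      ‖P - ContinuousLinearMap.id ℝ _‖ ≤ 2 * ε ∧ ∀ u : TangentSpace (𝓡 m) x,
        chartD p y (parallelTranslation m x y u) = P (chartD p x u) := by
  have hRp := hR.pos
  have h0I := left_mem_Icc.2 (zero_le_one' ℝ)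
  have h1I := right_mem_Icc.2 (zero_le_one' ℝ)
  have hx' := eball_ofReal_subset (by linarith : R / 4 ≤ R) hx
  have hy' := eball_ofReal_subset (by linarith : R / 4 ≤ R) hy
  have hmin := hR.isMinimalGeodesic hx hy
  have hmem := fun t => hR.mem_of_isMinimalGeodesic hx hy hmin (t := t)
  have hb := hR.mem_ball hx'
  have hl := hR.log_mem hx' hy'
  set ξ := extChartAt (𝓡 m) p x with hξ
  set l := C.D.log ξ (extChartAt (𝓡 m) p y) with hldef
  set c : ℝ → EuclideanSpace ℝ (Fin m) := fun t => C.D.exp ξ (t • l) with hc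
  set w : ℝ → EuclideanSpace ℝ (Fin m) := fun t => fderiv ℝ (C.D.exp ξ) (t • l) l with hw
  have hsol : IsSpraySolution C.Γ c w := C.D.isSpraySolution_exp hb hl
  have hcV : ∀ t ∈ Icc (0 : ℝ) 1, c t ∈ C.V := fun t ht => C.exp_smul_mem hb hl ht
  have hcg : ∀ t ∈ Icc (0 : ℝ) 1, extChartAt (𝓡 m) p (C.geodesic ξ l t) = c t := fun t ht =>
    C.chart_geodesic hb hl ht
  have hc0 : c 0 = ξ := by simp only [hc, zero_smul]; exact C.D.exp_zero hb
  have hc1 : c 1 = extChartAt (𝓡 m) p y := by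
    simp only [hc, one_smul]; exact hR.exp_log hx' hy'
  set A : ℝ → EuclideanSpace ℝ (Fin m) →L[ℝ] EuclideanSpace ℝ (Fin m) :=
    fun t => -C.Γ (c t) (w t) with hA
  have hAc : ContinuousOn A (Icc 0 1) := by
    have h1 : ContinuousOn (fun t => C.Γ (c t)) (Icc 0 1) :=
      C.contDiff.continuous.comp_continuousOn fun t ht => (hsol t ht).1.continuousWithinAt
    exact (h1.clm_apply fun t ht => (hsol t ht).2.continuousWithinAt).neg
  have hlen : √(metricForm p ξ l l) < R := by
    have h5 := edist_lt_of_mem_eball (by linarith) (by linarith) hx hy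
    rw [hR.edist_eq hx hy, ENNReal.ofReal_lt_ofReal_iff (by linarith)] at h5
    linarith
  have hAε : ∀ t ∈ Icc (0 : ℝ) 1, ‖A t‖ ≤ ε := by
    intro t ht
    have h1 := hge _ (hmem t ht) (w t)
    rw [hcg t ht, C.metric.speed_exp C.D hb hl ht] at h1
    have h2 : κ * ‖w t‖ ≤ R := by
      have h3 : κ * ‖w t‖ ≤ √(metricForm p ξ l l) := by
        refine Real.le_sqrt_of_sq_le ?_
        rwa [mul_pow]
      exact h3.trans hlen.le
    have h3 : ‖w t‖ ≤ R / κ := by rwa [le_div_iff₀ hκ, mul_comm]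
    have h4 := hle _ (hmem t ht)
    rw [hcg t ht] at h4
    calc ‖A t‖ = ‖C.Γ (c t) (w t)‖ := norm_neg _
      _ ≤ ‖C.Γ (c t)‖ * ‖w t‖ := (C.Γ (c t)).le_opNorm _
      _ ≤ B * (R / κ) := mul_le_mul h4 h3 (norm_nonneg _) hB
      _ ≤ ε := hε
  obtain ⟨P, hP0, hPd, hP1⟩ := exists_propagator hε' hAc hAε
  have hex : IsParallelTranslation x y
      ((chartInv m p y).comp ((P 1).comp (chartD p x))) := by
    intro u
    refine ⟨fun t => ⟨(extChartAt (𝓡 m) p).symm (c t), chartDSymm p (c t) (P t (chartD p x u))⟩,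
      ?_, hmin, ?_, ?_⟩
    · refine isParallel_of_chart p (c := c) (c' := w) (V := fun t => P t (chartD p x u))
        (V' := fun t => A t (P t (chartD p x u))) (fun t ht => C.subset (hcV t ht))
        (fun t ht => (hsol t ht).1) (fun t ht => ?_) (fun t ht z => ?_) (fun t _ => rfl)
      · simpa using (hPd t ht).clm_apply (hasDerivWithinAt_const t _ (chartD p x u))
      · simp only [hA, neg_apply, map_neg]
        rw [C.metric.christoffel _ (hcV t ht)]
        simp
    · exact mk_chartDSymm_of_eq (hR.source x hx') hc0 (by rw [hP0]; rfl)
    · exact mk_chartDSymm_of_eq (hR.source y hy') hc1 (chartD_chartInv (hR.source y hy') _).symm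
  -- `parallelTranslation` is a choice among maps satisfying `IsParallelTranslation`; uniqueness of
  -- the geodesic and of the linear equation identifies every such map with the propagator.
  have huniq : ∀ L : TangentSpace (𝓡 m) x →L[ℝ] TangentSpace (𝓡 m) y,
      IsParallelTranslation x y L → ∀ u, chartD p y (L u) = P 1 (chartD p x u) := by
    intro L hL u
    obtain ⟨X, hXp, hXm, hX0, hX1⟩ := hL u
    have hE := hR.eqOn_of_isMinimalGeodesic hx hy hXm
    have hE' : ∀ t ∈ Icc (0 : ℝ) 1, extChartAt (𝓡 m) p (X t).proj = c t := fun t ht => by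
      rw [← hcg t ht, ← hE ht]
    have hV : ∀ t ∈ Icc (0 : ℝ) 1, HasDerivWithinAt (fun s => chartVector p (X s))
        (A t (chartVector p (X t))) (Icc 0 1) t := by
      intro t ht
      have hm := hR.mem_of_isMinimalGeodesic hx hy hXm ht
      have h1 := C.hasDerivWithinAt_of_isParallel hXp ht (hR.source _ hm) (hR.mem_V hm)
        (c' := w t) ((hsol t ht).1.congr hE' (hE' t ht))
      rw [hE' t ht] at h1
      exact h1
    have hV' : ∀ t ∈ Icc (0 : ℝ) 1, HasDerivWithinAt (fun s => P s (chartD p x u))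
        (A t (P t (chartD p x u))) (Icc 0 1) t := fun t ht => by
      simpa using (hPd t ht).clm_apply (hasDerivWithinAt_const t _ (chartD p x u))
    have h := linear_solution_unique hAc hV hV' (by rw [hX0, hP0]; rfl) h1I
    simp only [hX1] at h
    exact h
  refine ⟨P 1, hP1, fun u => ?_⟩
  have hcond : HasUniqueMinimalGeodesic m x y ∧
      ∃ L : TangentSpace (𝓡 m) x →L[ℝ] TangentSpace (𝓡 m) y, IsParallelTranslation x y L :=
    ⟨hR.hasUniqueMinimalGeodesic hx hy, _, hex⟩
  rw [parallelTranslation, dif_pos hcond]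
  exact huniq _ hcond.2.choose_spec u

/-- In a chart, parallel translation between points near `p` is close to the identity. -/
theorem exists_nhds_parallelTranslation (p : M) {ε : ℝ} (hε : 0 < ε) :
    ∃ U ∈ 𝓝 p, U ⊆ (extChartAt (𝓡 m) p).source ∧ ∀ x ∈ U, ∀ y ∈ U,
      ∃ P : EuclideanSpace ℝ (Fin m) →L[ℝ] EuclideanSpace ℝ (Fin m),
        ‖P - ContinuousLinearMap.id ℝ _‖ ≤ ε ∧ ∀ u : TangentSpace (𝓡 m) x,
          chartD p y (parallelTranslation m x y u) = P (chartD p x u) := by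
  obtain ⟨C⟩ := nonempty_normalChart (m := m) p
  have hψ : ContinuousAt (extChartAt (𝓡 m) p) p := continuousAt_extChartAt p
  obtain ⟨κ, hκ, h1⟩ := C.metric.eventually_metric_ge C.mem_V
  set B := ‖C.Γ (extChartAt (𝓡 m) p p)‖ + 1 with hB
  have h2 : ∀ᶠ y in 𝓝 (extChartAt (𝓡 m) p p), ‖C.Γ y‖ < B :=
    C.contDiff.continuous.norm.continuousAt.eventually (gt_mem_nhds (lt_add_one _))
  obtain ⟨R₀, hR₀, hU⟩ := exists_isNormalBall C ((hψ.eventually h1).and (hψ.eventually h2))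
  have hB0 : 0 < B := by positivity
  have hsκ : 0 < √κ := Real.sqrt_pos.2 hκ
  set ε' := min (ε / 2) (1 / 2) with hε'
  have hε'0 : 0 < ε' := by positivity
  -- This radius makes the coefficient bound `B R / √κ` at most `ε'`, and the propagator then
  -- deviates from the identity by at most `2 ε' ≤ ε`.
  set R := min R₀ (ε' * √κ / B) with hRdef
  have hR : IsNormalBall C R := hR₀.mono (lt_min hR₀.pos (by positivity)) (min_le_left _ _)
  have hsub : Metric.eball p (ENNReal.ofReal R) ⊆ Metric.eball p (ENNReal.ofReal R₀) :=
    eball_ofReal_subset (min_le_left _ _)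
  have hRp := hR.pos
  refine ⟨Metric.eball p (ENNReal.ofReal (R / 4)),
    Metric.eball_mem_nhds p (ENNReal.ofReal_pos.2 (by linarith)),
    fun x hx => hR.source x (eball_ofReal_subset (by linarith) hx), fun x hx y hy => ?_⟩
  have hε'' : B * (R / √κ) ≤ ε' := by
    have : R ≤ ε' * √κ / B := min_le_right _ _
    rw [le_div_iff₀ hB0] at this
    rw [← mul_div_assoc, div_le_iff₀ hsκ]
    linarith
  obtain ⟨P, hP, hPu⟩ := hR.exists_propagator_parallelTranslation (κ := √κ) (B := B) (ε := ε')
    hsκ hB0.le (fun x hx v => by rw [Real.sq_sqrt hκ.le]; exact (hU (hsub hx)).1 v)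
    (fun x hx => (hU (hsub hx)).2.le) hε'' (min_le_right _ _) hx hy
  exact ⟨P, hP.trans (by linarith [min_le_left (ε / 2) (1 / 2)]), hPu⟩

end ParallelTranslation

/-! ### Comparison of intrinsic and coordinate norms and distances. -/

section MetricComparison

variable {m : ℕ} {M : Type*} [EMetricSpace M] [ChartedSpace (EuclideanSpace ℝ (Fin m)) M]
  [IsManifold (𝓡 m) ∞ M] [RiemannianBundle (fun x : M => TangentSpace (𝓡 m) x)]
  [IsContMDiffRiemannianBundle (𝓡 m) ∞ (EuclideanSpace ℝ (Fin m))
      (fun x : M => TangentSpace (𝓡 m) x)]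

/-- Norms of tangent vectors near `p` are uniformly comparable with those of their coordinates. -/
theorem exists_norm_chartD_comparison (p : M) : ∃ K > 0, ∀ᶠ x in 𝓝 p,
    x ∈ (extChartAt (𝓡 m) p).source ∧ ∀ v : TangentSpace (𝓡 m) x,
      ‖v‖ ≤ K * ‖chartD p x v‖ ∧ ‖chartD p x v‖ ≤ K * ‖v‖ := by
  obtain ⟨C⟩ := nonempty_normalChart (m := m) p
  have hψ : ContinuousAt (extChartAt (𝓡 m) p) p := continuousAt_extChartAt p
  have hV : extChartAt (𝓡 m) p p ∈ C.V :=
    IsMetricSpray.mem_of_mem_ball C.D (Metric.mem_ball_self C.D.ρ_pos)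
  obtain ⟨κ, hκ, h1⟩ := C.metric.eventually_metric_ge hV
  obtain ⟨B, hB, h2⟩ := C.metric.eventually_metric_le hV
  refine ⟨max (√B) (1 / √κ), lt_max_of_lt_left (Real.sqrt_pos.2 hB), ?_⟩
  filter_upwards [extChartAt_source_mem_nhds (I := 𝓡 m) p, hψ.eventually h1, hψ.eventually h2]
    with x hx h1 h2
  refine ⟨hx, fun v => ?_⟩
  rw [norm_eq_metricForm hx]
  constructor
  · refine (Real.sqrt_le_sqrt (h2 _)).trans ?_
    rw [Real.sqrt_mul hB.le, Real.sqrt_sq (norm_nonneg _)]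
    exact mul_le_mul_of_nonneg_right (le_max_left _ _) (norm_nonneg _)
  · have h3 := Real.sqrt_le_sqrt (h1 (chartD p x v))
    rw [Real.sqrt_mul hκ.le, Real.sqrt_sq (norm_nonneg _)] at h3
    have hs : 0 < √κ := Real.sqrt_pos.2 hκ
    calc ‖chartD p x v‖ = 1 / √κ * (√κ * ‖chartD p x v‖) := by field_simp
      _ ≤ 1 / √κ * _ := mul_le_mul_of_nonneg_left h3 (by positivity)
      _ ≤ _ := mul_le_mul_of_nonneg_right (le_max_right _ _) (Real.sqrt_nonneg _)

variable [IsRiemannianManifold (𝓡 m) M]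

/-- The distance near `p` is infinitesimally comparable with that of the coordinates. -/
theorem exists_edist_comparison (p : M) : ∃ K > 0, ∀ᶠ x in 𝓝 p, ∀ᶠ y in 𝓝 x,
    edist y x ≤ ENNReal.ofReal (K * ‖extChartAt (𝓡 m) p y - extChartAt (𝓡 m) p x‖) ∧
    ENNReal.ofReal ‖extChartAt (𝓡 m) p y - extChartAt (𝓡 m) p x‖ ≤
      ENNReal.ofReal K * edist y x := by
  obtain ⟨C⟩ := nonempty_normalChart (m := m) p
  have hψ : ContinuousAt (extChartAt (𝓡 m) p) p := continuousAt_extChartAt p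
  obtain ⟨κ, hκ, h1⟩ := C.metric.eventually_metric_ge C.mem_V
  obtain ⟨B, hB, h2⟩ := C.metric.eventually_metric_le C.mem_V
  obtain ⟨R, hR, hU⟩ := exists_isNormalBall C ((hψ.eventually h1).and (hψ.eventually h2))
  have hRp := hR.pos
  have hs : 0 < √κ := Real.sqrt_pos.2 hκ
  refine ⟨2 * max (√B) (1 / √κ), by positivity, ?_⟩
  have hball : Metric.eball p (ENNReal.ofReal (R / 4)) ∈ 𝓝 p :=
    Metric.eball_mem_nhds p (ENNReal.ofReal_pos.2 (by linarith))
  filter_upwards [hball] with x hx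
  have hx' := eball_ofReal_subset (by linarith : R / 4 ≤ R) hx
  have hψx : ContinuousAt (extChartAt (𝓡 m) p) x := by
    have := hR.source x hx'
    exact continuousAt_extChartAt' this
  have hb := hR.mem_ball hx'
  have hlog := C.D.hasFDerivAt_log (C.D.self_mem_target hb)
  -- To first order `log_x z` is `z - x`. A relative error of `1/2` makes the two norms comparable
  -- with factor `2`, while the neighbourhood of `x` may depend on `x`.
  have h3 : ∀ᶠ z in 𝓝 (extChartAt (𝓡 m) p x),
      ‖C.D.log (extChartAt (𝓡 m) p x) z - (z - extChartAt (𝓡 m) p x)‖ ≤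
        1 / 2 * ‖z - extChartAt (𝓡 m) p x‖ := by
    filter_upwards [hlog.isLittleO.bound (by norm_num : (0 : ℝ) < 1 / 2)] with z hz
    rwa [C.D.log_self hb, sub_zero, C.D.fderiv_log_self hb] at hz
  filter_upwards [hψx.eventually h3, Metric.isOpen_eball.mem_nhds hx] with y hy hym
  rw [edist_comm, hR.edist_eq hx hym]
  set l := C.D.log (extChartAt (𝓡 m) p x) (extChartAt (𝓡 m) p y)
  set d := extChartAt (𝓡 m) p y - extChartAt (𝓡 m) p x
  obtain ⟨hge, hle⟩ := hU hx'
  have h4 : ‖l‖ ≤ 2 * ‖d‖ := by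
    have := norm_add_le (l - d) d
    rw [sub_add_cancel] at this
    linarith [norm_nonneg d]
  have h5 : ‖d‖ ≤ 2 * ‖l‖ := by
    have := norm_sub_le l (l - d)
    rw [sub_sub_cancel] at this
    linarith [norm_nonneg d]
  have h6 := Real.sqrt_le_sqrt (hle l)
  rw [Real.sqrt_mul hB.le, Real.sqrt_sq (norm_nonneg _)] at h6
  have h7 := Real.sqrt_le_sqrt (hge l)
  rw [Real.sqrt_mul hκ.le, Real.sqrt_sq (norm_nonneg _)] at h7
  constructor
  · refine ENNReal.ofReal_le_ofReal (h6.trans ?_)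
    calc √B * ‖l‖ ≤ max (√B) (1 / √κ) * (2 * ‖d‖) :=
          mul_le_mul (le_max_left _ _) h4 (norm_nonneg _) (by positivity)
      _ = _ := by ring
  · rw [← ENNReal.ofReal_mul (by positivity)]
    refine ENNReal.ofReal_le_ofReal (h5.trans ?_)
    calc 2 * ‖l‖ = 2 * (1 / √κ) * (√κ * ‖l‖) := by field_simp
      _ ≤ 2 * (1 / √κ) * _ := mul_le_mul_of_nonneg_left h7 (by positivity)
      _ ≤ _ := by gcongr; exact le_max_right _ _

end MetricComparison

/-! ### The differential of `F` in charts. -/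

section LocalDerivative

variable {m n : ℕ} {M N : Type*}
  [EMetricSpace M] [ChartedSpace (EuclideanSpace ℝ (Fin m)) M] [IsManifold (𝓡 m) ∞ M]
  [EMetricSpace N] [ChartedSpace (EuclideanSpace ℝ (Fin n)) N] [IsManifold (𝓡 n) ∞ N]

variable (m n) in
/-- The differential of `F` at `x` in the charts at `p` and `F p`. -/
def localDeriv (F : M → N) (p x : M) : EuclideanSpace ℝ (Fin m) →L[ℝ] EuclideanSpace ℝ (Fin n) :=
  (chartD (F p) (F x)).comp ((mfderiv (𝓡 m) (𝓡 n) F x).comp (chartInv m p x))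

theorem chartInv_symm {p : M} {z : EuclideanSpace ℝ (Fin m)}
    (hz : z ∈ (extChartAt (𝓡 m) p).target) :
    chartInv m p ((extChartAt (𝓡 m) p).symm z) = chartDSymm p z := by
  ext1 v
  refine chartD_injective ((extChartAt (𝓡 m) p).map_target hz) ?_
  rw [chartD_chartInv ((extChartAt (𝓡 m) p).map_target hz), chartD_chartDSymm hz]

theorem hasFDerivAt_localDeriv {F : M → N} {p x : M} (hx : x ∈ (extChartAt (𝓡 m) p).source)
    (hFx : F x ∈ (extChartAt (𝓡 n) (F p)).source) (hF : MDifferentiableAt (𝓡 m) (𝓡 n) F x) :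
    HasFDerivAt (fun z => extChartAt (𝓡 n) (F p) (F ((extChartAt (𝓡 m) p).symm z)))
      (localDeriv m n F p x) (extChartAt (𝓡 m) p x) := by
  obtain ⟨y, hy, rfl⟩ : ∃ y ∈ (extChartAt (𝓡 m) p).target, (extChartAt (𝓡 m) p).symm y = x :=
    ⟨_, (extChartAt (𝓡 m) p).map_source hx, (extChartAt (𝓡 m) p).left_inv hx⟩
  rw [(extChartAt (𝓡 m) p).right_inv hy, localDeriv, chartInv_symm hy]
  have h := ((mdifferentiableAt_chart hFx).hasMFDerivAt.comp _ hF.hasMFDerivAt).comp y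
    (mdifferentiableAt_symm hy).hasMFDerivAt
  rw [hasMFDerivAt_iff_hasFDerivAt] at h
  exact h

variable [RiemannianBundle (fun x : M => TangentSpace (𝓡 m) x)]
  [IsContMDiffRiemannianBundle (𝓡 m) ∞ (EuclideanSpace ℝ (Fin m))
      (fun x : M => TangentSpace (𝓡 m) x)]
  [IsRiemannianManifold (𝓡 m) M]
  [RiemannianBundle (fun x : N => TangentSpace (𝓡 n) x)]
  [IsContMDiffRiemannianBundle (𝓡 n) ∞ (EuclideanSpace ℝ (Fin n))
      (fun x : N => TangentSpace (𝓡 n) x)]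
  [IsRiemannianManifold (𝓡 n) N]

/-- The Lipschitz constant of `F`, multiplied by the comparison constants of the two charts, bounds
every coordinate differential near `p`. -/
theorem exists_norm_localDeriv_le {F : M → N} (hF : LocallyLipschitz F) (p : M) :
    ∃ B, ∀ᶠ x in 𝓝 p, MDifferentiableAt (𝓡 m) (𝓡 n) F x → ‖localDeriv m n F p x‖ ≤ B := by
  obtain ⟨K₁, hK₁, h₁⟩ := exists_edist_comparison (m := m) p
  obtain ⟨K₂, hK₂, h₂⟩ := exists_edist_comparison (m := n) (F p)
  obtain ⟨K, t, ht, hK⟩ := hF p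
  have hFp := hF.continuous.continuousAt (x := p)
  refine ⟨K₂ * (K * K₁), ?_⟩
  filter_upwards [h₁, hFp.eventually h₂, eventually_eventually_nhds.2 ht,
    extChartAt_source_mem_nhds (I := 𝓡 m) p,
    hFp.eventually (extChartAt_source_mem_nhds (I := 𝓡 n) (F p))] with x h₁ h₂ ht hx hFx hd
  refine (hasFDerivAt_localDeriv hx hFx hd).le_of_lip' (by positivity) ?_
  have hsymm : ContinuousAt (extChartAt (𝓡 m) p).symm (extChartAt (𝓡 m) p x) :=
    continuousAt_extChartAt_symm'' ((extChartAt (𝓡 m) p).map_source hx)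
  have hsx := (extChartAt (𝓡 m) p).left_inv hx
  rw [ContinuousAt, hsx] at hsymm
  have hFx' := hF.continuous.continuousAt (x := x)
  filter_upwards [hsymm.eventually h₁, hsymm.eventually (hFx'.eventually h₂), hsymm.eventually ht,
    (isOpen_target p).mem_nhds ((extChartAt (𝓡 m) p).map_source hx)] with z a b c d
  rw [hsx]
  rw [(extChartAt (𝓡 m) p).right_inv d] at a
  have h3 := hK c ht.self_of_nhds
  have h4 : ENNReal.ofReal ‖extChartAt (𝓡 n) (F p) (F ((extChartAt (𝓡 m) p).symm z)) -
      extChartAt (𝓡 n) (F p) (F x)‖ ≤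
      ENNReal.ofReal (K₂ * (K * K₁) * ‖z - extChartAt (𝓡 m) p x‖) := by
    calc _ ≤ ENNReal.ofReal K₂ * edist (F ((extChartAt (𝓡 m) p).symm z)) (F x) := b.2
      _ ≤ ENNReal.ofReal K₂ * (K * ENNReal.ofReal (K₁ * ‖z - extChartAt (𝓡 m) p x‖)) := by
        gcongr
        exact h3.trans (by gcongr; exact a.1)
      _ = _ := by
        rw [← ENNReal.ofReal_coe_nnreal, ← ENNReal.ofReal_mul (by positivity),
          ← ENNReal.ofReal_mul (by positivity)]
        congr 1; ring
  exact (ENNReal.ofReal_le_ofReal_iff (by positivity)).1 h4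

end LocalDerivative

/-! ### Cluster sets and uniform separation from the origin. -/

section Separation

theorem isCompact_setOf_mapClusterPt {X E : Type*} [MetricSpace E]
    {l : Filter X} {f : X → E} {K : Set E} (hK : IsCompact K) (hf : ∀ᶠ x in l, f x ∈ K) :
    IsCompact {a | MapClusterPt a l f} := by
  refine hK.of_isClosed_subset isClosed_setOfPred_clusterPt fun a ha => ?_
  exact hK.isClosed.mem_of_mapClusterPt ha hf

/-- Values that are frequently outside the open thickening would cluster in the compact remainder of
`K`, outside the cluster set itself. -/
theorem eventually_mem_thickening_mapClusterPt {X E : Type*} [PseudoMetricSpace E]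
    {l : Filter X} {f : X → E} {K : Set E} (hK : IsCompact K) (hf : ∀ᶠ x in l, f x ∈ K)
    {ε : ℝ} (hε : 0 < ε) : ∀ᶠ x in l, f x ∈ Metric.thickening ε {a | MapClusterPt a l f} := by
  by_contra h
  have h1 : ∃ᶠ x in l, f x ∈ K \ Metric.thickening ε {a | MapClusterPt a l f} :=
    ((not_eventually.1 h).and_eventually hf).mono fun x hx => ⟨hx.2, hx.1⟩
  obtain ⟨a, ha, hc⟩ := (hK.diff Metric.isOpen_thickening).exists_mapClusterPt_of_frequently h1
  exact ha.2 (Metric.self_subset_thickening hε _ hc)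

variable {E E' : Type*} [NormedAddCommGroup E] [NormedSpace ℝ E]
  [NormedAddCommGroup E'] [InnerProductSpace ℝ E']

/-- The difference splits as `(P₂ - I) D P₁ + D (P₁ - I)`; with `‖P₁‖ ≤ 2` the two pieces contribute
`2 ε B` and `ε B`. -/
theorem norm_conj_sub_le {P₁ : E →L[ℝ] E} {P₂ : E' →L[ℝ] E'} {D : E →L[ℝ] E'} {ε B : ℝ}
    (hε : ε ≤ 1) (h₁ : ‖P₁ - ContinuousLinearMap.id ℝ E‖ ≤ ε)
    (h₂ : ‖P₂ - ContinuousLinearMap.id ℝ E'‖ ≤ ε) (hD : ‖D‖ ≤ B) :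
    ‖P₂.comp (D.comp P₁) - D‖ ≤ 3 * ε * B := by
  have hε0 : 0 ≤ ε := (norm_nonneg _).trans h₁
  have hB0 : 0 ≤ B := (norm_nonneg _).trans hD
  have e : P₂.comp (D.comp P₁) - D = (P₂ - ContinuousLinearMap.id ℝ E').comp (D.comp P₁) +
      D.comp (P₁ - ContinuousLinearMap.id ℝ E) := by
    ext v; simp
  have hP : ‖P₁‖ ≤ 2 := by
    have h3 := norm_add_le (P₁ - ContinuousLinearMap.id ℝ E) (ContinuousLinearMap.id ℝ E)
    rw [sub_add_cancel] at h3
    linarith [ContinuousLinearMap.norm_id_le (𝕜 := ℝ) (E := E)]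
  rw [e]
  refine (norm_add_le _ _).trans ?_
  have h4 : ‖(P₂ - ContinuousLinearMap.id ℝ E').comp (D.comp P₁)‖ ≤ ε * (B * 2) :=
    (ContinuousLinearMap.opNorm_comp_le _ _).trans (mul_le_mul h₂
      ((ContinuousLinearMap.opNorm_comp_le _ _).trans
        (mul_le_mul hD hP (norm_nonneg _) hB0)) (norm_nonneg _) hε0)
  have h5 : ‖D.comp (P₁ - ContinuousLinearMap.id ℝ E)‖ ≤ B * ε :=
    (ContinuousLinearMap.opNorm_comp_le _ _).trans (mul_le_mul hD h₁ (norm_nonneg _) hB0)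
  linarith

variable [FiniteDimensional ℝ E]

/-- For fixed `u` the set `{a u : a ∈ C}` is compact and convex and misses `0`; its nearest point to
`0` is normal to a separating hyperplane. The minimum of `‖a v‖` over `C` and unit vectors `v` makes
the margin uniform. -/
theorem exists_uniform_separation [Nontrivial E'] {C : Set (E →L[ℝ] E')} (hC : IsCompact C)
    (hconv : Convex ℝ C) (hinj : ∀ a ∈ C, Function.Injective a) :
    ∃ d > 0, ∀ u : E, u ≠ 0 → ∃ e : E', ‖e‖ = 1 ∧ ∀ a ∈ C, d * ‖u‖ ≤ inner ℝ e (a u) := by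
  have hne : ∀ a ∈ C, ∀ u, u ≠ 0 → a u ≠ 0 := fun a ha u hu h =>
    hu (hinj a ha (h.trans (map_zero a).symm))
  obtain ⟨d, hd, hdu⟩ : ∃ d > 0, ∀ a ∈ C, ∀ u : E, d * ‖u‖ ≤ ‖a u‖ := by
    have hK : IsCompact (C ×ˢ Metric.sphere (0 : E) 1) := hC.prod (isCompact_sphere _ _)
    have hf : Continuous fun z : (E →L[ℝ] E') × E => ‖z.1 z.2‖ :=
      (continuous_fst.clm_apply continuous_snd).norm
    have hscale : ∀ d > 0, (∀ a ∈ C, ∀ v ∈ Metric.sphere (0 : E) 1, d ≤ ‖a v‖) →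
        ∀ a ∈ C, ∀ u : E, d * ‖u‖ ≤ ‖a u‖ := by
      intro d hd h a ha u
      rcases eq_or_ne u 0 with rfl | hu
      · simp
      have hu' : 0 < ‖u‖ := norm_pos_iff.2 hu
      have h1 := h a ha (‖u‖⁻¹ • u) (by simp [norm_smul, hu'.ne'])
      rw [map_smul, norm_smul, norm_inv, norm_norm, inv_mul_eq_div, le_div_iff₀ hu'] at h1
      exact h1
    rcases (C ×ˢ Metric.sphere (0 : E) 1).eq_empty_or_nonempty with h | h
    · refine ⟨1, one_pos, hscale 1 one_pos fun a ha v hv => ?_⟩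
      have : (a, v) ∈ (∅ : Set _) := h ▸ (⟨ha, hv⟩ : (a, v) ∈ C ×ˢ Metric.sphere (0 : E) 1)
      exact this.elim
    · obtain ⟨⟨a₀, u₀⟩, ⟨ha₀, hu₀⟩, hmin⟩ := hK.exists_isMinOn h hf.continuousOn
      have hu₀' : u₀ ≠ 0 := by
        rintro rfl
        simp at hu₀
      have hpos : 0 < ‖a₀ u₀‖ := norm_pos_iff.2 (hne a₀ ha₀ u₀ hu₀')
      exact ⟨_, hpos, hscale _ hpos fun a ha v hv =>
        hmin (⟨ha, hv⟩ : (a, v) ∈ C ×ˢ Metric.sphere (0 : E) 1)⟩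
  refine ⟨d, hd, fun u hu => ?_⟩
  rcases C.eq_empty_or_nonempty with rfl | hCne
  -- If `C` is empty the bound is vacuous, but a unit vector must still be produced.
  · obtain ⟨e, he⟩ := exists_ne (0 : E')
    have he' : 0 < ‖e‖ := norm_pos_iff.2 he
    exact ⟨‖e‖⁻¹ • e, by simp [norm_smul, he'.ne'], fun a ha => ha.elim⟩
  set S : Set E' := (fun a : E →L[ℝ] E' => a u) '' C with hS
  have hSc : IsCompact S := hC.image (continuous_id.clm_apply continuous_const)
  have hSconv : Convex ℝ S := hconv.is_linear_image ⟨fun a b => rfl, fun r a => rfl⟩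
  obtain ⟨w, hwS, hw⟩ := exists_norm_eq_iInf_of_complete_convex (hCne.image _) hSc.isComplete
    hSconv 0
  -- The variational inequality at the nearest point `w` reads `⟨w, a u⟩ ≥ ‖w‖²` for all `a ∈ C`.
  have hw' := (norm_eq_iInf_iff_real_inner_le_zero hSconv hwS).1 hw
  obtain ⟨a₀, ha₀, rfl⟩ := hwS
  have hpos : 0 < ‖a₀ u‖ := norm_pos_iff.2 (hne a₀ ha₀ u hu)
  refine ⟨‖a₀ u‖⁻¹ • a₀ u, by simp [norm_smul, hpos.ne'], fun a ha => ?_⟩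
  have h1 := hw' (a u) ⟨a, ha, rfl⟩
  simp only [zero_sub, inner_neg_left, inner_sub_right, real_inner_self_eq_norm_sq] at h1
  rw [real_inner_smul_left]
  calc d * ‖u‖ ≤ ‖a₀ u‖ := hdu a₀ ha₀ u
    _ = ‖a₀ u‖⁻¹ * ‖a₀ u‖ ^ 2 := by field_simp
    _ ≤ _ := mul_le_mul_of_nonneg_left (by linarith) (by positivity)

end Separation

/-! ### Compactness of convex hulls. -/

section ConvexHull

/-- By Carathéodory, convex combinations of `finrank + 1` points suffice, so the hull is a
continuous image of a simplex times a power of `s`. -/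
theorem isCompact_convexHull_of_isCompact {E : Type*} [NormedAddCommGroup E] [NormedSpace ℝ E]
    [FiniteDimensional ℝ E] {s : Set E} (hs : IsCompact s) : IsCompact (convexHull ℝ s) := by
  set k := Module.finrank ℝ E + 1 with hk
  have hK : IsCompact (stdSimplex ℝ (Fin k) ×ˢ (univ.pi fun _ : Fin k => s)) :=
    (isCompact_stdSimplex ℝ (Fin k)).prod (isCompact_univ_pi fun _ => hs)
  have hf : Continuous fun z : (Fin k → ℝ) × (Fin k → E) => ∑ i, z.1 i • z.2 i := by fun_prop
  have himg := hK.image hf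
  refine (Set.Subset.antisymm (fun x hx => ?_) ?_ :
    convexHull ℝ s = _ '' (stdSimplex ℝ (Fin k) ×ˢ (univ.pi fun _ : Fin k => s))) ▸ himg
  · obtain ⟨ι, _, z, w, hz, hind, hw, hsum, rfl⟩ := eq_pos_convex_span_of_mem_convexHull hx
    have hcard : Fintype.card ι ≤ Fintype.card (Fin k) := by
      rw [Fintype.card_fin]
      exact hind.card_le_finrank_succ.trans (Nat.succ_le_succ (Submodule.finrank_le _))
    obtain ⟨e⟩ := Function.Embedding.nonempty_of_card_le hcard
    obtain ⟨a₀, ha₀⟩ := convexHull_nonempty_iff.1 ⟨_, hx⟩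
    have hw' : ∀ j ∉ range e, Function.extend e w 0 j = 0 := fun j hj => by
      rw [Function.extend_apply' _ _ _ fun ⟨i, hi⟩ => hj ⟨i, hi⟩]; rfl
    -- Shorter combinations are padded with zero weights at an arbitrary point `a₀` of `s`.
    refine ⟨(Function.extend e w 0, Function.extend e z fun _ => a₀), ⟨⟨fun j => ?_, ?_⟩, ?_⟩, ?_⟩
    · by_cases hj : j ∈ range e
      · obtain ⟨i, rfl⟩ := hj
        simp only [e.injective.extend_apply]
        exact (hw i).le
      · exact (hw' j hj).ge
    · rw [← hsum]
      exact (Fintype.sum_of_injective e e.injective w _ hw'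
        fun i => (e.injective.extend_apply _ _ i).symm).symm
    · intro j _
      by_cases hj : j ∈ range e
      · obtain ⟨i, rfl⟩ := hj
        simp only [e.injective.extend_apply]
        exact hz ⟨i, rfl⟩
      · simp only
        rw [Function.extend_apply' _ _ _ fun ⟨i, hi⟩ => hj ⟨i, hi⟩]
        exact ha₀
    · refine (Fintype.sum_of_injective e e.injective (fun i => w i • z i) _ (fun j hj => ?_)
        fun i => ?_).symm
      · simp only
        rw [hw' j hj, zero_smul]
      · simp only [e.injective.extend_apply]
  · rintro _ ⟨⟨w, z⟩, ⟨⟨hw, hw1⟩, hz⟩, rfl⟩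
    exact (convex_convexHull ℝ s).sum_mem (fun i _ => hw i) hw1
      fun i _ => subset_convexHull ℝ s (hz i (mem_univ i))

end ConvexHull

/-! ### Upper semicontinuity of the generalized differential. -/

section Mixture

variable {m n : ℕ} {M N : Type*}
  [EMetricSpace M] [ChartedSpace (EuclideanSpace ℝ (Fin m)) M] [IsManifold (𝓡 m) ∞ M]
  [RiemannianBundle (fun x : M => TangentSpace (𝓡 m) x)]
  [IsContMDiffRiemannianBundle (𝓡 m) ∞ (EuclideanSpace ℝ (Fin m))
      (fun x : M => TangentSpace (𝓡 m) x)]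
  [IsRiemannianManifold (𝓡 m) M]
  [EMetricSpace N] [ChartedSpace (EuclideanSpace ℝ (Fin n)) N] [IsManifold (𝓡 n) ∞ N]
  [RiemannianBundle (fun x : N => TangentSpace (𝓡 n) x)]
  [IsContMDiffRiemannianBundle (𝓡 n) ∞ (EuclideanSpace ℝ (Fin n))
      (fun x : N => TangentSpace (𝓡 n) x)]
  [IsRiemannianManifold (𝓡 n) N]

/-- The coordinates of a linear map `T_x M → T_{F x} N` in the charts at `p` and `F p`. -/
def localCoord (F : M → N) (p x : M)
    (g : TangentSpace (𝓡 m) x →L[ℝ] TangentSpace (𝓡 n) (F x)) :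
    EuclideanSpace ℝ (Fin m) →L[ℝ] EuclideanSpace ℝ (Fin n) :=
  (chartD (F p) (F x)).comp (g.comp (chartInv m p x))

/-- The differential of `F` at `y`, transported to `x`. -/
def transported (F : M → N) (x y : M) : TangentSpace (𝓡 m) x →L[ℝ] TangentSpace (𝓡 n) (F x) :=
  (parallelTranslation n (F y) (F x)).comp
    ((mfderiv (𝓡 m) (𝓡 n) F y).comp (parallelTranslation m x y))

theorem continuous_localCoord (F : M → N) (p x : M) :
    Continuous (localCoord (m := m) (n := n) F p x) :=
  continuous_const.clm_comp (continuous_id.clm_comp continuous_const)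

/-- In coordinates the transported differential is the differential at `y` conjugated by two
near-identity propagators, so it differs from it by a small multiple of its norm. -/
theorem exists_nhds_localCoord_transported {F : M → N} (hF : Continuous F) (p : M) {ε : ℝ}
    (hε : 0 < ε) : ∃ U ∈ 𝓝 p, U ⊆ (extChartAt (𝓡 m) p).source ∧
      (∀ x ∈ U, F x ∈ (extChartAt (𝓡 n) (F p)).source) ∧
      ∀ x ∈ U, ∀ y ∈ U, ∀ B, ‖localDeriv m n F p y‖ ≤ B →
        ‖localCoord (m := m) (n := n) F p x (transported F x y) - localDeriv m n F p y‖ ≤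
          ε * B := by
  obtain ⟨U₁, hU₁, hs₁, h₁⟩ := exists_nhds_parallelTranslation (m := m) p
    (ε := min (ε / 3) 1) (by positivity)
  obtain ⟨U₂, hU₂, hs₂, h₂⟩ := exists_nhds_parallelTranslation (m := n) (F p)
    (ε := min (ε / 3) 1) (by positivity)
  refine ⟨U₁ ∩ F ⁻¹' U₂, inter_mem hU₁ (hF.continuousAt hU₂), fun x hx => hs₁ hx.1,
    fun x hx => hs₂ hx.2, fun x hx y hy B hB => ?_⟩
  obtain ⟨P₁, hP₁, e₁⟩ := h₁ x hx.1 y hy.1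
  obtain ⟨P₂, hP₂, e₂⟩ := h₂ (F y) hy.2 (F x) hx.2
  have e : localCoord (m := m) (n := n) F p x (transported F x y) =
      P₂.comp ((localDeriv m n F p y).comp P₁) := by
    ext1 v
    change chartD (F p) (F x) (parallelTranslation n (F y) (F x) (mfderiv (𝓡 m) (𝓡 n) F y
      (parallelTranslation m x y (chartInv m p x v)))) =
      P₂ (chartD (F p) (F y) (mfderiv (𝓡 m) (𝓡 n) F y (chartInv m p y (P₁ v))))
    rw [e₂]
    congr 3
    refine chartD_injective (hs₁ hy.1) ?_
    rw [e₁, chartD_chartInv (hs₁ hx.1), chartD_chartInv (hs₁ hy.1)]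
  rw [e]
  refine (norm_conj_sub_le (min_le_right _ _) hP₁ hP₂ hB).trans ?_
  refine mul_le_mul_of_nonneg_right ?_ ((norm_nonneg _).trans hB)
  linarith [min_le_left (ε / 3) 1]

/-- Limits of `dF` in coordinates come from the mixture. -/
theorem exists_mem_mixture_of_mapClusterPt {F : M → N} (hF : LocallyLipschitz F) (p : M)
    {A : EuclideanSpace ℝ (Fin m) →L[ℝ] EuclideanSpace ℝ (Fin n)}
    (hA : MapClusterPt A (𝓝 p ⊓ 𝓟 {x | MDifferentiableAt (𝓡 m) (𝓡 n) F x})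
      (localDeriv m n F p)) :
    ∃ G ∈ mixture m n F p, localCoord F p p G = A := by
  have hs := mem_extChartAt_source (I := 𝓡 m) p
  have hs' := mem_extChartAt_source (I := 𝓡 n) (F p)
  set recon : (EuclideanSpace ℝ (Fin m) →L[ℝ] EuclideanSpace ℝ (Fin n)) →
    (TangentSpace (𝓡 m) p →L[ℝ] TangentSpace (𝓡 n) (F p)) :=
    fun A => (chartInv n (F p) (F p)).comp (A.comp (chartD p p)) with hrecon
  have hrc : Continuous recon :=
    continuous_const.clm_comp (continuous_id.clm_comp continuous_const)
  have hleft : ∀ T, recon (localCoord F p p T) = T := by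
    intro T
    ext1 v
    change chartInv n (F p) (F p) (chartD (F p) (F p) (T (chartInv m p p (chartD p p v)))) = T v
    rw [chartInv_chartD hs', chartInv_chartD hs]
  have hright : ∀ A, localCoord F p p (recon A) = A := by
    intro A
    ext1 v
    change chartD (F p) (F p) (chartInv n (F p) (F p) (A (chartD p p (chartInv m p p v)))) = A v
    rw [chartD_chartInv hs', chartD_chartInv hs]
  refine ⟨recon A, ?_, hright A⟩
  set l := 𝓝 p ⊓ 𝓟 {x | MDifferentiableAt (𝓡 m) (𝓡 n) F x} with hl
  -- A cluster value makes this filter nontrivial. It is countably generated, so an actual sequence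
  -- realises the cluster value.
  have hne : (l ⊓ comap (localDeriv m n F p) (𝓝 A)).NeBot := by
    rw [inf_comm]
    have : (𝓝 A ⊓ map (localDeriv m n F p) l).NeBot := hA
    rw [← Filter.push_pull'] at this
    exact (Filter.map_neBot_iff _).1 this
  obtain ⟨x, hx⟩ := Filter.exists_seq_tendsto (l ⊓ comap (localDeriv m n F p) (𝓝 A))
  obtain ⟨hxl, hxA⟩ := tendsto_inf.1 hx
  obtain ⟨hxp, hxd⟩ := tendsto_inf.1 hxl
  rw [tendsto_principal] at hxd
  rw [tendsto_comap_iff] at hxA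
  -- The mixture requires differentiability at every term, so the first `k` terms are dropped.
  obtain ⟨k, hk⟩ := eventually_atTop.1 hxd
  have hxp' : Tendsto (fun i => x (i + k)) atTop (𝓝 p) := (tendsto_add_atTop_iff_nat k).2 hxp
  have hxA' : Tendsto (fun i => localDeriv m n F p (x (i + k))) atTop (𝓝 A) :=
    (tendsto_add_atTop_iff_nat (f := localDeriv m n F p ∘ x) k).2 hxA
  refine ⟨fun i => x (i + k), fun i => hk _ (Nat.le_add_left k i), hxp', ?_⟩
  -- The convergent differentials are eventually bounded by `‖A‖ + 1`, so the transport error tends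
  -- to `0`.
  have hdiff : Tendsto (fun i => localCoord F p p (transported F p (x (i + k))) -
      localDeriv m n F p (x (i + k))) atTop (𝓝 0) := by
    rw [Metric.tendsto_nhds]
    intro ε hε
    set B := ‖A‖ + 1
    have hB : 0 < B := by positivity
    obtain ⟨U, hU, -, -, h⟩ := exists_nhds_localCoord_transported (m := m) (n := n)
      hF.continuous p (ε := ε / (2 * B)) (by positivity)
    filter_upwards [hxp' hU, hxA'.norm.eventually (gt_mem_nhds (lt_add_one ‖A‖))] with i hi hb
    rw [dist_zero_right]
    refine (h p (mem_of_mem_nhds hU) _ hi B hb.le).trans_lt ?_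
    have : ε / (2 * B) * B = ε / 2 := by field_simp
    linarith
  have hlim : Tendsto (fun i => localCoord F p p (transported F p (x (i + k)))) atTop (𝓝 A) := by
    have := hdiff.add hxA'
    simpa using this
  have := (hrc.tendsto A).comp hlim
  refine this.congr fun i => ?_
  exact hleft _

/-- Near `p` the generalized differentials are, in coordinates, close to a compact convex set of
maps that represent elements of the generalized differential at `p`. -/
theorem exists_compact_convex_generalizedDifferential {F : M → N} (hF : LocallyLipschitz F)
    (p : M) : ∃ C : Set (EuclideanSpace ℝ (Fin m) →L[ℝ] EuclideanSpace ℝ (Fin n)),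
      IsCompact C ∧ Convex ℝ C ∧
      (∀ A ∈ C, ∃ G ∈ generalizedDifferential m n F p, localCoord F p p G = A) ∧
      ∀ ε > 0, ∀ᶠ x in 𝓝 p, ∀ g ∈ generalizedDifferential m n F x,
        localCoord F p x g ∈ Metric.cthickening ε C := by
  obtain ⟨B₀, hB₀⟩ := exists_norm_localDeriv_le (m := m) (n := n) hF p
  set B := max B₀ 1 with hBdef
  have hB : 0 < B := lt_max_of_lt_right one_pos
  set l := 𝓝 p ⊓ 𝓟 {x | MDifferentiableAt (𝓡 m) (𝓡 n) F x} with hl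
  have hK : IsCompact (Metric.closedBall
    (0 : EuclideanSpace ℝ (Fin m) →L[ℝ] EuclideanSpace ℝ (Fin n)) B) := isCompact_closedBall _ _
  have hev : ∀ᶠ x in l, localDeriv m n F p x ∈ Metric.closedBall 0 B := by
    rw [hl, eventually_inf_principal]
    filter_upwards [hB₀] with x hx hd
    rw [mem_closedBall_zero_iff]
    exact (hx hd).trans (le_max_left _ _)
  set A₀ := {A | MapClusterPt A l (localDeriv m n F p)} with hA₀
  have hA₀c : IsCompact A₀ := isCompact_setOf_mapClusterPt hK hev
  have hlin : ∀ x, IsLinearMap ℝ (localCoord (m := m) (n := n) F p x) := fun x =>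
    ⟨fun a b => by ext1 v; exact map_add (chartD (F p) (F x)) _ _,
      fun r a => by ext1 v; exact map_smul (chartD (F p) (F x)) _ _⟩
  refine ⟨convexHull ℝ A₀, isCompact_convexHull_of_isCompact hA₀c, convex_convexHull ℝ _,
    fun A hA => ?_, fun ε hε => ?_⟩
  -- Cluster values come from the mixture at `p`, and passing to coordinates is linear, so their
  -- convex combinations come from its convex hull.
  · have h1 : convexHull ℝ A₀ ⊆ localCoord F p p '' generalizedDifferential m n F p := by
      refine convexHull_min (fun A hA => ?_)
        ((convex_convexHull ℝ _).is_linear_image (hlin p))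
      obtain ⟨G, hG, hGA⟩ := exists_mem_mixture_of_mapClusterPt hF p hA
      exact ⟨G, subset_convexHull ℝ _ hG, hGA⟩
    exact h1 hA
  · obtain ⟨U, hU, -, -, hUt⟩ := exists_nhds_localCoord_transported (m := m) (n := n)
      hF.continuous p (ε := ε / (2 * B)) (by positivity)
    have h1 := (eventually_mem_thickening_mapClusterPt hK hev (half_pos hε)).and hev
    rw [hl, eventually_inf_principal] at h1
    -- The mixture at `x` involves points `y` near `x`; the estimates around `p` must therefore hold
    -- on a whole neighbourhood of each `x`. Half of `ε` covers the distance of the differential at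
    -- `y` to `A₀`, half the transport error.
    have h2 := eventually_eventually_nhds.2 (h1.and hU)
    filter_upwards [h2, hU] with x hx hxU
    have hmix : ∀ G ∈ mixture m n F x, localCoord F p x G ∈
        Metric.cthickening ε (convexHull ℝ A₀) := by
      rintro G ⟨y, hyd, hyx, hyG⟩
      have h3 := ((continuous_localCoord F p x).tendsto G).comp hyG
      refine Metric.isClosed_cthickening.mem_of_tendsto h3 ?_
      filter_upwards [hyx.eventually hx] with i hi
      obtain ⟨⟨hth, hbd⟩, hiU⟩ := (⟨hi.1 (hyd i), hi.2⟩ :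
        (_ ∧ _) ∧ _)
      rw [mem_closedBall_zero_iff] at hbd
      have h4 := hUt x hxU _ hiU B hbd
      have h5 : ε / (2 * B) * B = ε / 2 := by field_simp
      rw [h5] at h4
      obtain ⟨a, ha, had⟩ := Metric.mem_thickening_iff.1 hth
      refine Metric.mem_cthickening_of_dist_le _ a _ _ (subset_convexHull ℝ _ ha) ?_
      rw [← dist_eq_norm] at h4
      have h6 := dist_triangle (localCoord F p x (transported F x (y i)))
        (localDeriv m n F p (y i)) a
      have h7 : dist (localCoord F p x (transported F x (y i))) a ≤ ε := by linarith
      exact h7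
    -- Closedness of the thickening handled the limits defining the mixture; its convexity handles
    -- the convex hull.
    have hconv : Convex ℝ (localCoord F p x ⁻¹' Metric.cthickening ε (convexHull ℝ A₀)) :=
      ((convex_convexHull ℝ A₀).cthickening ε).is_linear_preimage (hlin x)
    exact fun g hg => convexHull_min hmix hconv hg

end Mixture

/-! ### Uniform directions and nonsingularity near `p`. -/

section Nonsingular

variable {m n : ℕ} {M N : Type*}
  [EMetricSpace M] [ChartedSpace (EuclideanSpace ℝ (Fin m)) M] [IsManifold (𝓡 m) ∞ M]
  [RiemannianBundle (fun x : M => TangentSpace (𝓡 m) x)]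
  [IsContMDiffRiemannianBundle (𝓡 m) ∞ (EuclideanSpace ℝ (Fin m))
      (fun x : M => TangentSpace (𝓡 m) x)]
  [IsRiemannianManifold (𝓡 m) M]
  [EMetricSpace N] [ChartedSpace (EuclideanSpace ℝ (Fin n)) N] [IsManifold (𝓡 n) ∞ N]
  [RiemannianBundle (fun x : N => TangentSpace (𝓡 n) x)]
  [IsContMDiffRiemannianBundle (𝓡 n) ∞ (EuclideanSpace ℝ (Fin n))
      (fun x : N => TangentSpace (𝓡 n) x)]
  [IsRiemannianManifold (𝓡 n) N]

theorem finiteDimensional_tangentSpace (x : M) : FiniteDimensional ℝ (TangentSpace (𝓡 m) x) :=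
  inferInstanceAs (FiniteDimensional ℝ (EuclideanSpace ℝ (Fin m)))

theorem finrank_tangentSpace (x : M) : Module.finrank ℝ (TangentSpace (𝓡 m) x) = m :=
  finrank_euclideanSpace_fin (𝕜 := ℝ) (n := m)

theorem finrank_range_eq_iff_injective {x : M} {y : N}
    (g : TangentSpace (𝓡 m) x →L[ℝ] TangentSpace (𝓡 n) y) :
    Module.finrank ℝ (LinearMap.range g.toLinearMap) = m ↔ Function.Injective g := by
  have := finiteDimensional_tangentSpace (m := m) x
  have h := LinearMap.finrank_range_add_finrank_ker g.toLinearMap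
  rw [finrank_tangentSpace] at h
  constructor
  · intro h1
    have h2 : Module.finrank ℝ (LinearMap.ker g.toLinearMap) = 0 := by omega
    rw [Submodule.finrank_eq_zero] at h2
    exact LinearMap.ker_eq_bot.1 h2
  · intro h1
    have h2 : LinearMap.ker g.toLinearMap = ⊥ := LinearMap.ker_eq_bot.2 h1
    rw [h2, finrank_bot] at h
    omega

/-- The unit covector `⟨e, ·⟩` of the chart at `q` is, up to a bounded factor, the pairing with a
unit tangent vector. -/
theorem exists_unit_vector {q y : N} (hy : y ∈ (extChartAt (𝓡 n) q).source) {K : ℝ} (hK : 0 < K)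
    (hle : ∀ v : TangentSpace (𝓡 n) y, ‖chartD q y v‖ ≤ K * ‖v‖)
    {e : EuclideanSpace ℝ (Fin n)} (he : ‖e‖ = 1) :
    ∃ V : TangentSpace (𝓡 n) y, ‖V‖ = 1 ∧ ∀ ξ : TangentSpace (𝓡 n) y, ∀ c : ℝ, 0 ≤ c →
      c ≤ inner ℝ e (chartD q y ξ) → c / K ≤ inner ℝ ξ V := by
  have := finiteDimensional_tangentSpace (m := n) y
  have : CompleteSpace (TangentSpace (𝓡 n) y) := FiniteDimensional.complete ℝ _
  set φ : TangentSpace (𝓡 n) y →L[ℝ] ℝ := (innerSL ℝ e).comp (chartD q y) with hφ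
  have hφa : ∀ ξ, φ ξ = inner ℝ e (chartD q y ξ) := fun ξ => rfl
  have hφn : ‖φ‖ ≤ K := by
    refine φ.opNorm_le_bound hK.le fun ξ => ?_
    rw [hφa]
    refine (norm_inner_le_norm _ _).trans ?_
    rw [he, one_mul]
    exact hle ξ
  -- The Riesz vector of `⟨e, ·⟩` in the Riemannian inner product has norm at most `K`, so
  -- normalising it costs at most the factor `K`.
  set W := (InnerProductSpace.toDual ℝ (TangentSpace (𝓡 n) y)).symm φ with hW
  have hWi : ∀ ξ, inner ℝ W ξ = φ ξ := fun ξ => InnerProductSpace.toDual_symm_apply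
  have hWn : ‖W‖ ≤ K := by rwa [hW, LinearIsometryEquiv.norm_map]
  have hW0 : 0 < ‖W‖ := by
    rw [norm_pos_iff]
    intro h0
    have h1 := hWi (chartInv n q y e)
    rw [h0, inner_zero_left, hφa, chartD_chartInv hy, real_inner_self_eq_norm_sq, he] at h1
    norm_num at h1
  refine ⟨‖W‖⁻¹ • W, by rw [norm_smul, norm_inv, norm_norm, inv_mul_cancel₀ hW0.ne'],
    fun ξ c hc hcξ => ?_⟩
  rw [real_inner_smul_right, real_inner_comm, hWi, hφa, inv_mul_eq_div]
  exact div_le_div₀ (hc.trans hcξ) hcξ hW0 hWn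

theorem localCoord_chartD {F : M → N} {p x : M} (hx : x ∈ (extChartAt (𝓡 m) p).source)
    (g : TangentSpace (𝓡 m) x →L[ℝ] TangentSpace (𝓡 n) (F x)) (u : TangentSpace (𝓡 m) x) :
    localCoord F p x g (chartD p x u) = chartD (F p) (F x) (g u) := by
  change chartD (F p) (F x) (g (chartInv m p x (chartD p x u))) = _
  rw [chartInv_chartD hx]

/-- Near a nonsingular point, the generalized differentials map each direction into a half space
that stays away from the origin. -/
theorem IsNonsingular.exists_uniform_direction (hmn : m ≤ n) {F : M → N} (hF : LocallyLipschitz F)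
    {p : M} (hp : IsNonsingular m n F p) : ∃ δ > 0, ∀ᶠ x in 𝓝 p,
      ∀ u : TangentSpace (𝓡 m) p, ‖u‖ = 1 → ∃ V : TangentSpace (𝓡 n) (F x), ‖V‖ = 1 ∧
        ∀ g ∈ generalizedDifferential m n F x,
          δ ≤ inner ℝ (g (parallelTranslation m p x u)) V := by
  -- If `n = 0` then `m = 0` and there are no unit vectors `u`; otherwise unit covectors exist on
  -- the target.
  rcases Nat.eq_zero_or_pos n with hn | hn
  · refine ⟨1, one_pos, Eventually.of_forall fun x u hu => ?_⟩
    have := finiteDimensional_tangentSpace (m := m) p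
    have h0 : Module.finrank ℝ (TangentSpace (𝓡 m) p) = 0 := by
      rw [finrank_tangentSpace]; omega
    have : Subsingleton (TangentSpace (𝓡 m) p) := Module.finrank_zero_iff.1 h0
    rw [Subsingleton.elim u 0, norm_zero] at hu
    exact absurd hu zero_ne_one
  have : Nontrivial (EuclideanSpace ℝ (Fin n)) :=
    Module.nontrivial_of_finrank_pos (R := ℝ) (by rwa [finrank_euclideanSpace_fin])
  have hsp := mem_extChartAt_source (I := 𝓡 m) p
  have hsq := mem_extChartAt_source (I := 𝓡 n) (F p)
  obtain ⟨C, hC, hconv, hrep, hnear⟩ :=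
    exists_compact_convex_generalizedDifferential (m := m) (n := n) hF p
  have hinj : ∀ A ∈ C, Function.Injective A := by
    intro A hA
    obtain ⟨G, hG, rfl⟩ := hrep A hA
    have h1 := hp G hG
    rw [min_eq_left hmn, finrank_range_eq_iff_injective] at h1
    have h2 : Function.Injective (chartInv m p p) := fun a b hab => by
      rw [← chartD_chartInv hsp a, hab, chartD_chartInv hsp]
    exact (chartD_injective hsq).comp (h1.comp h2)
  obtain ⟨d, hd, hsep⟩ := exists_uniform_separation hC hconv hinj
  obtain ⟨B, hB, hCB⟩ := hC.isBounded.exists_pos_norm_le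
  obtain ⟨K₁, hK₁, h₁⟩ := exists_norm_chartD_comparison (m := m) p
  obtain ⟨K₂, hK₂, h₂⟩ := exists_norm_chartD_comparison (m := n) (F p)
  -- The errors are at most `2 ε ‖u₀‖` from replacing `g'` by `a ∈ C` and `B ε ‖u₀‖` from parallel
  -- translation; this `ε` keeps their sum below half the margin `d ‖u₀‖`.
  set ε := min 1 (d / (2 * (2 + B))) with hεdef
  have hε : 0 < ε := by positivity
  obtain ⟨U, hU, hUs, hUt⟩ := exists_nhds_parallelTranslation (m := m) p hε
  -- The remaining margin is `d / 2 * ‖u₀‖`. A unit `u` has coordinate norm at least `K₁⁻¹`, and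
  -- `K₂` is the cost of normalising `V`.
  refine ⟨d / 2 * K₁⁻¹ / K₂, by positivity, ?_⟩
  filter_upwards [hU, hnear ε hε, hF.continuous.continuousAt.eventually h₂] with x hxU hx h₂ u hu
  obtain ⟨P, hP, hPu⟩ := hUt p (mem_of_mem_nhds hU) x hxU
  set u₀ := chartD p p u with hu₀
  have hu₀n : K₁⁻¹ ≤ ‖u₀‖ := by
    have h3 := (h₁.self_of_nhds.2 u).1
    rw [hu] at h3
    rw [inv_le_iff_one_le_mul₀' hK₁]
    exact h3
  have hu₀0 : u₀ ≠ 0 := norm_pos_iff.1 (lt_of_lt_of_le (by positivity) hu₀n)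
  obtain ⟨e, he, hea⟩ := hsep u₀ hu₀0
  obtain ⟨V, hV, hVi⟩ := exists_unit_vector h₂.1 hK₂ (fun v => (h₂.2 v).2) he
  refine ⟨V, hV, fun g hg => hVi _ _ (by positivity) ?_⟩
  rw [← localCoord_chartD (hUs hxU), hPu]
  have hmem := hx g hg
  rw [hC.cthickening_eq_biUnion_closedBall hε.le] at hmem
  obtain ⟨a, haC, ha⟩ := mem_iUnion₂.1 hmem
  rw [mem_closedBall_iff_norm] at ha
  set g' := localCoord F p x g with hg'
  have hPn : ‖P u₀ - u₀‖ ≤ ε * ‖u₀‖ := by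
    have := (P - ContinuousLinearMap.id ℝ _).le_of_opNorm_le hP u₀
    simpa using this
  have hPn2 : ‖P u₀‖ ≤ 2 * ‖u₀‖ := by
    have h3 := norm_add_le (P u₀ - u₀) u₀
    rw [sub_add_cancel] at h3
    have : ε * ‖u₀‖ ≤ 1 * ‖u₀‖ := mul_le_mul_of_nonneg_right (min_le_left _ _) (norm_nonneg _)
    linarith
  have hdiff : ‖g' (P u₀) - a u₀‖ ≤ d / 2 * ‖u₀‖ := by
    have e1 : g' (P u₀) - a u₀ = (g' - a) (P u₀) + a (P u₀ - u₀) := by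
      rw [sub_apply, map_sub]; abel
    have h3 : ‖(g' - a) (P u₀)‖ ≤ ε * (2 * ‖u₀‖) :=
      ((g' - a).le_opNorm _).trans (mul_le_mul ha hPn2 (norm_nonneg _) hε.le)
    have h4 : ‖a (P u₀ - u₀)‖ ≤ B * (ε * ‖u₀‖) :=
      (a.le_opNorm _).trans (mul_le_mul (hCB a haC) hPn (norm_nonneg _) hB.le)
    have h5 : ε * (2 + B) ≤ d / 2 := by
      calc ε * (2 + B) ≤ d / (2 * (2 + B)) * (2 + B) :=
            mul_le_mul_of_nonneg_right (min_le_right _ _) (by positivity)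
        _ = d / 2 := by field_simp
    rw [e1]
    refine (norm_add_le _ _).trans ?_
    calc _ ≤ ε * (2 * ‖u₀‖) + B * (ε * ‖u₀‖) := add_le_add h3 h4
      _ = ε * (2 + B) * ‖u₀‖ := by ring
      _ ≤ _ := mul_le_mul_of_nonneg_right h5 (norm_nonneg _)
  have h6 := hea a haC
  have h7 : -‖g' (P u₀) - a u₀‖ ≤ inner ℝ e (g' (P u₀) - a u₀) := by
    have := abs_real_inner_le_norm e (g' (P u₀) - a u₀)
    rw [he, one_mul] at this
    exact (abs_le.1 this).1
  rw [inner_sub_right] at h7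
  have h8 : d / 2 * K₁⁻¹ ≤ d / 2 * ‖u₀‖ := mul_le_mul_of_nonneg_left hu₀n (by positivity)
  linarith

/-- A map within `1/2` of the identity is injective, and the tangent spaces have equal dimension. -/
theorem eventually_parallelTranslation_surjective (p : M) :
    ∀ᶠ x in 𝓝 p, Function.Surjective (parallelTranslation m p x) := by
  obtain ⟨U, hU, hUs, hUt⟩ := exists_nhds_parallelTranslation (m := m) p (ε := 1 / 2) (by norm_num)
  filter_upwards [hU] with x hx
  obtain ⟨P, hP, hPu⟩ := hUt p (mem_of_mem_nhds hU) x hx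
  have := finiteDimensional_tangentSpace (m := m) p
  have := finiteDimensional_tangentSpace (m := m) x
  have hinj : Function.Injective (parallelTranslation m p x).toLinearMap := by
    rw [← LinearMap.ker_eq_bot, LinearMap.ker_eq_bot']
    intro u hu
    have hu' : parallelTranslation m p x u = 0 := hu
    have h1 := hPu u
    rw [hu', map_zero] at h1
    have h2 := (P - ContinuousLinearMap.id ℝ _).le_of_opNorm_le hP (chartD p p u)
    rw [sub_apply, ← h1, zero_sub, norm_neg] at h2
    have h3 : chartD p p u = 0 := by
      rw [← norm_le_zero_iff]
      have h4 : ‖chartD p p u‖ ≤ 1 / 2 * ‖chartD p p u‖ := h2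
      linarith
    exact chartD_injective (hUs (mem_of_mem_nhds hU)) (h3.trans (map_zero _).symm)
  exact (LinearMap.injective_iff_surjective_of_finrank_eq_finrank (by
    rw [finrank_tangentSpace, finrank_tangentSpace])).1 hinj

/-- A nonzero kernel vector of `g` would be the translate of some `u ≠ 0`, and its pairing with the
vector for `u / ‖u‖` would vanish instead of being at least `δ`. This is why surjectivity of the
translation matters. -/
theorem isNonsingular_of_direction (hmn : m ≤ n) {F : M → N} {p x : M} {δ : ℝ} (hδ : 0 < δ)
    (hsurj : Function.Surjective (parallelTranslation m p x))
    (h : ∀ u : TangentSpace (𝓡 m) p, ‖u‖ = 1 → ∃ V : TangentSpace (𝓡 n) (F x), ‖V‖ = 1 ∧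
        ∀ g ∈ generalizedDifferential m n F x,
          δ ≤ inner ℝ (g (parallelTranslation m p x u)) V) : IsNonsingular m n F x := by
  intro g hg
  rw [min_eq_left hmn, finrank_range_eq_iff_injective]
  rw [injective_iff_map_eq_zero]
  intro v hv
  obtain ⟨u, rfl⟩ := hsurj v
  by_contra hne
  have hu : u ≠ 0 := by
    rintro rfl
    exact hne (map_zero _)
  have hu' : 0 < ‖u‖ := norm_pos_iff.2 hu
  obtain ⟨V, -, hVg⟩ := h (‖u‖⁻¹ • u)
    (by rw [norm_smul, norm_inv, norm_norm, inv_mul_cancel₀ hu'.ne'])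
  have h1 := hVg g hg
  rw [map_smul, map_smul, hv, smul_zero, inner_zero_left] at h1
  linarith

end Nonsingular

end ClarkeLip

end

/-! ### The proposition. -/

theorem proposition3p12 {m n : ℕ} {M N : Type*}
    [EMetricSpace M] [ChartedSpace (EuclideanSpace ℝ (Fin m)) M] [IsManifold (𝓡 m) ∞ M]
    [RiemannianBundle (fun x : M => TangentSpace (𝓡 m) x)]
    [IsContMDiffRiemannianBundle (𝓡 m) ∞ (EuclideanSpace ℝ (Fin m))
      (fun x : M => TangentSpace (𝓡 m) x)]
    [IsRiemannianManifold (𝓡 m) M]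
    [EMetricSpace N] [ChartedSpace (EuclideanSpace ℝ (Fin n)) N] [IsManifold (𝓡 n) ∞ N]
    [RiemannianBundle (fun y : N => TangentSpace (𝓡 n) y)]
    [IsContMDiffRiemannianBundle (𝓡 n) ∞ (EuclideanSpace ℝ (Fin n))
      (fun y : N => TangentSpace (𝓡 n) y)]
    [IsRiemannianManifold (𝓡 n) N]
    (hmn : m ≤ n) (F : M → N) (hF : LocallyLipschitz F)
    (p : M) (hp : ClarkeLip.IsNonsingular m n F p) (t : ℝ) (ht : 0 < t) :
    ∃ lam δ : ℝ, 0 < lam ∧ 0 < δ ∧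
      (ClarkeLip.IsStronglyConvexBall m p (2 * lam) ∧
        ClarkeLip.IsExpDiffeoBall m p (2 * lam)) ∧
      ((∃ K : ℝ≥0, LipschitzOnWith K F (Metric.eball p (ENNReal.ofReal (2 * lam)))) ∧
        MapsTo F (Metric.eball p (ENNReal.ofReal (2 * lam)))
          (Metric.eball (F p) (ENNReal.ofReal t))) ∧
      (∀ u : TangentSpace (𝓡 m) p, ‖u‖ = 1 →
        ∀ x ∈ Metric.eball p (ENNReal.ofReal (2 * lam)),
          ∃ V : TangentSpace (𝓡 n) (F x), ‖V‖ = 1 ∧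
            ∀ g ∈ ClarkeLip.generalizedDifferential m n F x,
              δ ≤ inner ℝ (g (ClarkeLip.parallelTranslation m p x u)) V) ∧
      (∀ x ∈ Metric.eball p (ENNReal.ofReal (2 * lam)), ClarkeLip.IsNonsingular m n F x) := by
  obtain ⟨δ, hδ, hdir⟩ := hp.exists_uniform_direction hmn hF
  obtain ⟨C⟩ := ClarkeLip.nonempty_normalChart (m := m) p
  obtain ⟨K, s, hs, hK⟩ := hF p
  have hball : F ⁻¹' Metric.eball (F p) (ENNReal.ofReal t) ∈ 𝓝 p :=
    hF.continuous.continuousAt (Metric.eball_mem_nhds _ (ENNReal.ofReal_pos.2 ht))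
  -- Every local condition is placed in the neighbourhood of one normal ball, so a single radius
  -- serves all four assertions.
  obtain ⟨R, hR, hsub⟩ := ClarkeLip.exists_isNormalBall C
    (inter_mem (inter_mem hs hball)
      (hdir.and (ClarkeLip.eventually_parallelTranslation_surjective (m := m) p)))
  have hRp := hR.pos
  have hsub' : Metric.eball p (ENNReal.ofReal (2 * (R / 64))) ⊆
      Metric.eball p (ENNReal.ofReal R) := ClarkeLip.eball_ofReal_subset (by linarith)
  -- With `λ = R / 64` the radius `2λ` is `R / 32`, the bound required for strong convexity.
  refine ⟨R / 64, δ, by linarith, hδ,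
    ⟨hR.isStronglyConvexBall (by linarith) (by linarith),
      hR.isExpDiffeoBall (by linarith) (by linarith)⟩,
    ⟨⟨K, hK.mono fun x hx => (hsub (hsub' hx)).1.1⟩, fun x hx => (hsub (hsub' hx)).1.2⟩,
    fun u hu x hx => (hsub (hsub' hx)).2.1 u hu,
    fun x hx => ClarkeLip.isNonsingular_of_direction hmn hδ (hsub (hsub' hx)).2.2
      (hsub (hsub' hx)).2.1⟩
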